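/- Let $\mathfrak P$ be the ring of polytopes: the free abelian group generated by the combinatorial equivalence classes of (nonempty) convex polytopes, with multiplication given by the product of polytopes and the point as unit. The motivic interior of a polytope $P$ is $P^\circ=\sum_F(-1)^{\operatorname{codim}F}F\in\mathfrak P$, the sum over all nonempty faces $F$ of $P$ (including $P$ itself). For a connected graph $\Gamma$ with vertex set $\{1,\dots,n\}$ the graph-associahedron of $\Gamma$ is $$\Big\{x\in\mathbb R^n:\ \sum_{i=1}^n x_i=3^n,\ \ \sum_{i\in S}x_i\ge 3^{|S|}\ \text{ for all nonempty } S\subsetneq\{1,\dots,n\} \text{ with } \Gamma|_S \text{ connected}\Big\}.$$ For $n\ge1$ let $\mathfrak a_n$ (associahedron) and $W_n$ (cyclohedron) be the graph-associahedra of the path and of the cycle with $n$ vertices (the cycle being one vertex for $n=1$ and one edge for $n=2$), and put $\mathfrak a_0=1$. For sequences $a=(a_n)_{n\ge1}$, $b=(b_n)_{n\ge1}$ with $b_1=1$ in a commutative $\mathbb Q$-algebra $K$, define for $n\ge 1$ $$D_n(a,b)=\sum_{k_1+2k_2+\dots+nk_n=n}\frac{k!}{k_1!\cdots k_n!}\,a_k\prod_{j=1}^n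 \beta_j^{k_j},\qquad k=k_1+\dots+k_n,$$ where, for $m\ge 0$, $$\beta_{m+1}=\frac1{(m+1)!}\sum_{k_1+2k_2+\dots+mk_m=m}(-1)^k\frac{(m+k)!}{k_1!\cdots k_m!}\,b_2^{k_1}b_3^{k_2}\cdots b_{m+1}^{k_m},\qquad k=k_1+\dots+k_m,$$ both sums being over vectors of nonnegative integers $k_i$. (1) For all such $K,a,b$, the series $g(x)=\sum_{n\ge1}b_nx^n$ has a unique compositional inverse $g^{(-1)}$ in $K[[x]]$, and with $f(x)=\sum_{n\ge1}a_nx^n$ one has $f(g^{(-1)}(x))=\sum_{n\ge1}D_n(a,b)x^n$. (2) In $\mathfrak P\otimes\mathbb Q$, for every $n\ge1$, $$W_n^\circ=n\,D_n(a,b),\qquad a_j=\frac{W_j}{j},\quad b_j=\mathfrak a_{j-1}\quad(j\ge1).$$ -/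

import Mathlib

open scoped Nat

/-! ### Convex polytopes and their faces -/

/-- A (nonempty) convex polytope in some coordinate space `ℝᵈ`: a nonempty bounded intersection of
finitely many closed half-spaces `{x | ℓ x ≤ c}`. -/
structure ConvexPolytope where
  ambientDim : ℕ
  carrier : Set (Fin ambientDim → ℝ)
  nonempty : carrier.Nonempty
  bounded : Bornology.IsBounded carrier
  halfSpaces : ∃ H : Set (StrongDual ℝ (Fin ambientDim → ℝ) × ℝ), H.Finite ∧
    carrier = {x | ∀ p ∈ H, p.1 x ≤ p.2}

namespace ConvexPolytope

/-- The dimension of a polytope: the dimension of its affine hull. -/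
noncomputable def dim (P : ConvexPolytope) : ℕ :=
  Module.finrank ℝ (vectorSpan ℝ P.carrier)

/-- The poset of nonempty faces of `P`, ordered by inclusion. A nonempty face is the set of
maximizers over `P` of a linear functional; `P` itself is a face (take the zero functional). -/
abbrev Face (P : ConvexPolytope) : Type :=
  {F : Set (Fin P.ambientDim → ℝ) // F.Nonempty ∧ IsExposed ℝ P.carrier F}

theorem Face.exists_functional {P : ConvexPolytope} (F : P.Face) :
    ∃ l : StrongDual ℝ (Fin P.ambientDim → ℝ),
      F.1 = {x ∈ P.carrier | ∀ y ∈ P.carrier, l y ≤ l x} :=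
  F.2.2 F.2.1

/-- A nonempty face of a polytope is a polytope. -/
def Face.toPolytope {P : ConvexPolytope} (F : P.Face) : ConvexPolytope where
  ambientDim := P.ambientDim
  carrier := F.1
  nonempty := F.2.1
  bounded := P.bounded.subset F.2.2.subset
  halfSpaces := by
    obtain ⟨l, hl⟩ := F.exists_functional
    obtain ⟨H, hH, hP⟩ := P.halfSpaces
    obtain ⟨z, hz⟩ := F.2.1
    rw [hl] at hz
    refine ⟨insert (-l, -(l z)) H, hH.insert _, ?_⟩
    rw [hl]
    ext x
    simp only [Set.mem_ofPred_eq, Set.mem_insert_iff, forall_eq_or_imp,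
      neg_apply, neg_le_neg_iff]
    constructor
    · rintro ⟨hx, hm⟩
      refine ⟨hm z hz.1, ?_⟩
      rw [hP] at hx
      exact hx
    · rintro ⟨hm, hx⟩
      refine ⟨?_, fun y hy => (hz.2 y hy).trans hm⟩
      rw [hP]
      exact hx

/-- A polytope has finitely many faces: a face is determined by the defining inequalities that
are equalities on it. -/
instance Face.finite (P : ConvexPolytope) : Finite P.Face := by
  obtain ⟨H, hH, hP⟩ := P.halfSpaces
  have hmem : ∀ x, x ∈ P.carrier ↔ ∀ p ∈ H, p.1 x ≤ p.2 := fun x => by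
    constructor
    · intro h; rw [hP] at h; exact h
    · intro h; rw [hP]; exact h
  have := hH.to_subtype
  let act : P.Face → Set H := fun F => {p | ∀ x ∈ F.1, p.1.1 x = p.1.2}
  suffices key : ∀ F G : P.Face, act F ⊆ act G → G.1 ⊆ F.1 by
    refine Finite.of_injective act fun F G h => Subtype.ext ?_
    exact (key G F h.ge).antisymm (key F G h.le)
  intro F G hFG y hy
  have hyP : y ∈ P.carrier := G.2.2.subset hy
  have hFP : ∀ x ∈ F.1, ∀ p : H, p.1.1 x ≤ p.1.2 := fun x hx p =>
    (hmem x).1 (F.2.2.subset hx) p.1 p.2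
  obtain ⟨l, hl⟩ := F.exists_functional
  obtain ⟨z, hz⟩ := F.2.1
  -- a point of `F` in which every inequality that is not active on `F` is strict
  have hconv : Convex ℝ F.1 := by
    refine F.2.2.convex ?_
    intro a ha b hb s t hs ht hst
    rw [hmem] at ha hb ⊢
    intro p hp
    have h1 := mul_le_mul_of_nonneg_left (ha p hp) hs
    have h2 := mul_le_mul_of_nonneg_left (hb p hp) ht
    have h3 : s * p.2 + t * p.2 = p.2 := by rw [← add_mul, hst, one_mul]
    simp only [map_add, map_smul, smul_eq_mul]
    linarith
  have hrel : ∀ T : Finset H, ∃ w ∈ F.1, ∀ p ∈ T, p ∉ act F → p.1.1 w < p.1.2 := by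
    classical
    intro T
    induction T using Finset.induction_on with
    | empty => exact ⟨z, hz, by simp⟩
    | insert p T _ ih =>
      obtain ⟨w, hw, hwT⟩ := ih
      by_cases hp : p ∈ act F
      · refine ⟨w, hw, fun q hq hqF => ?_⟩
        rcases Finset.mem_insert.1 hq with rfl | hq
        · exact absurd hp hqF
        · exact hwT q hq hqF
      · have : ∃ v ∈ F.1, p.1.1 v ≠ p.1.2 := by
          by_contra! hcon
          exact hp hcon
        obtain ⟨v, hv, hne⟩ := this
        refine ⟨(1 / 2 : ℝ) • w + (1 / 2 : ℝ) • v,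
          hconv hw hv (by norm_num) (by norm_num) (by norm_num), fun q hq hqF => ?_⟩
        have h1 := hFP w hw q
        have h2 := hFP v hv q
        simp only [map_add, map_smul, smul_eq_mul]
        rcases Finset.mem_insert.1 hq with rfl | hq
        · have := lt_of_le_of_ne h2 hne
          linarith
        · have := hwT q hq hqF
          linarith
  have := Fintype.ofFinite H
  obtain ⟨w, hw, hwlt⟩ := hrel Finset.univ
  -- moving slightly from `w` away from `y` stays inside `P`
  have hstep : ∀ T : Finset H, ∃ e : ℝ, 0 < e ∧
      ∀ p ∈ T, p.1.1 (w + e • (w - y)) ≤ p.1.2 := by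
    classical
    have hone : ∀ p : H, ∃ e : ℝ, 0 < e ∧ ∀ e', 0 < e' → e' ≤ e →
        p.1.1 (w + e' • (w - y)) ≤ p.1.2 := by
      intro p
      by_cases hp : p ∈ act F
      · refine ⟨1, one_pos, fun e' _ _ => ?_⟩
        have h1 : p.1.1 w = p.1.2 := hp w hw
        have h2 : p.1.1 y = p.1.2 := hFG hp y hy
        simp [h1, h2]
      · have hlt := hwlt p (Finset.mem_univ p) hp
        have hpos : 0 < |p.1.1 w - p.1.1 y| + 1 := by positivity
        refine ⟨(p.1.2 - p.1.1 w) / (|p.1.1 w - p.1.1 y| + 1),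
          div_pos (sub_pos.2 hlt) hpos, fun e' he' hle => ?_⟩
        rw [le_div_iff₀ hpos] at hle
        have h3 : e' * (p.1.1 w - p.1.1 y) ≤ e' * (|p.1.1 w - p.1.1 y| + 1) :=
          mul_le_mul_of_nonneg_left ((le_abs_self _).trans (by linarith)) he'.le
        simp only [map_add, map_smul, map_sub, smul_eq_mul]
        linarith
    choose e he hle using hone
    intro T
    suffices ∃ e' : ℝ, 0 < e' ∧ ∀ p ∈ T, e' ≤ e p by
      obtain ⟨e', he', h⟩ := this
      exact ⟨e', he', fun p hp => hle p e' he' (h p hp)⟩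
    induction T using Finset.induction_on with
    | empty => exact ⟨1, one_pos, by simp⟩
    | insert p T _ ih =>
      obtain ⟨e', he', h⟩ := ih
      refine ⟨min e' (e p), lt_min he' (he p), fun q hq => ?_⟩
      rcases Finset.mem_insert.1 hq with rfl | hq
      · exact min_le_right _ _
      · exact (min_le_left _ _).trans (h q hq)
  obtain ⟨e, he, hmove⟩ := hstep Finset.univ
  have hin : w + e • (w - y) ∈ P.carrier :=
    (hmem _).2 fun p hp => hmove ⟨p, hp⟩ (Finset.mem_univ _)
  rw [hl] at hw ⊢
  refine ⟨hyP, fun x hx => (hw.2 x hx).trans ?_⟩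
  have h := hw.2 _ hin
  simp only [map_add, map_smul, map_sub, smul_eq_mul] at h
  nlinarith

noncomputable instance Face.fintype (P : ConvexPolytope) : Fintype P.Face := Fintype.ofFinite _

/-- The codimension of a face of `P` in `P`. -/
noncomputable def Face.codim {P : ConvexPolytope} (F : P.Face) : ℕ :=
  P.dim - F.toPolytope.dim

/-! ### Products of polytopes -/

section Product

variable (m n : ℕ)

/-- The projection of `ℝᵐ⁺ⁿ` to the first `m` coordinates. -/
noncomputable def fstL : (Fin (m + n) → ℝ) →L[ℝ] (Fin m → ℝ) :=
  ContinuousLinearMap.pi fun i => ContinuousLinearMap.proj (Fin.castAdd n i)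

/-- The projection of `ℝᵐ⁺ⁿ` to the last `n` coordinates. -/
noncomputable def sndL : (Fin (m + n) → ℝ) →L[ℝ] (Fin n → ℝ) :=
  ContinuousLinearMap.pi fun i => ContinuousLinearMap.proj (Fin.natAdd m i)

/-- The inclusion of `ℝᵐ` into `ℝᵐ⁺ⁿ` as the first coordinates. -/
noncomputable def inlL : (Fin m → ℝ) →L[ℝ] (Fin (m + n) → ℝ) :=
  ContinuousLinearMap.pi fun i =>
    Fin.addCases (motive := fun _ => (Fin m → ℝ) →L[ℝ] ℝ)
      (fun i => ContinuousLinearMap.proj i) (fun _ => 0) i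

/-- The inclusion of `ℝⁿ` into `ℝᵐ⁺ⁿ` as the last coordinates. -/
noncomputable def inrL : (Fin n → ℝ) →L[ℝ] (Fin (m + n) → ℝ) :=
  ContinuousLinearMap.pi fun i =>
    Fin.addCases (motive := fun _ => (Fin n → ℝ) →L[ℝ] ℝ)
      (fun _ => 0) (fun i => ContinuousLinearMap.proj i) i

variable {m n}

@[simp] theorem fstL_append (x : Fin m → ℝ) (y : Fin n → ℝ) : fstL m n (Fin.append x y) = x := by
  ext i; simp [fstL]

@[simp] theorem sndL_append (x : Fin m → ℝ) (y : Fin n → ℝ) : sndL m n (Fin.append x y) = y := by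
  ext i; simp [sndL]

theorem append_fstL_sndL (x : Fin (m + n) → ℝ) : Fin.append (fstL m n x) (sndL m n x) = x := by
  ext i
  refine Fin.addCases (fun i => ?_) (fun i => ?_) i <;> simp [fstL, sndL]

theorem inlL_add_inrL (x : Fin (m + n) → ℝ) :
    inlL m n (fstL m n x) + inrL m n (sndL m n x) = x := by
  ext i
  refine Fin.addCases (fun i => ?_) (fun i => ?_) i <;> simp [fstL, sndL, inlL, inrL]

theorem exists_functionals (l : StrongDual ℝ (Fin (m + n) → ℝ)) :
    ∃ (l₁ : StrongDual ℝ (Fin m → ℝ)) (l₂ : StrongDual ℝ (Fin n → ℝ)),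
      l = l₁.comp (fstL m n) + l₂.comp (sndL m n) := by
  refine ⟨l.comp (inlL m n), l.comp (inrL m n), ContinuousLinearMap.ext fun x => ?_⟩
  conv_lhs => rw [← inlL_add_inrL x]
  exact map_add l _ _

/-- The product of two sets of coordinate vectors, as a set of concatenated vectors. -/
def setProd (A : Set (Fin m → ℝ)) (B : Set (Fin n → ℝ)) : Set (Fin (m + n) → ℝ) :=
  {x | fstL m n x ∈ A ∧ sndL m n x ∈ B}

theorem append_mem_setProd {A : Set (Fin m → ℝ)} {B : Set (Fin n → ℝ)} {x : Fin m → ℝ}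
    {y : Fin n → ℝ} : Fin.append x y ∈ setProd A B ↔ x ∈ A ∧ y ∈ B := by
  simp [setProd]

theorem setProd_subset_iff {A A' : Set (Fin m → ℝ)} {B B' : Set (Fin n → ℝ)}
    (hA : A.Nonempty) (hB : B.Nonempty) : setProd A B ⊆ setProd A' B' ↔ A ⊆ A' ∧ B ⊆ B' := by
  constructor
  · intro h
    obtain ⟨a, ha⟩ := hA
    obtain ⟨b, hb⟩ := hB
    exact ⟨fun x hx => (append_mem_setProd.1 (h (append_mem_setProd.2 ⟨hx, hb⟩))).1,
      fun y hy => (append_mem_setProd.1 (h (append_mem_setProd.2 ⟨ha, hy⟩))).2⟩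
  · rintro ⟨h1, h2⟩ x ⟨hx, hy⟩
    exact ⟨h1 hx, h2 hy⟩

/-- The maximizers of `l x + k y` on a product are the products of maximizers. -/
theorem setProd_maximizers (A : Set (Fin m → ℝ)) (B : Set (Fin n → ℝ))
    (l : StrongDual ℝ (Fin m → ℝ)) (k : StrongDual ℝ (Fin n → ℝ)) :
    setProd {x ∈ A | ∀ y ∈ A, l y ≤ l x} {x ∈ B | ∀ y ∈ B, k y ≤ k x} =
      {x ∈ setProd A B | ∀ y ∈ setProd A B,
        (l.comp (fstL m n) + k.comp (sndL m n)) y ≤ (l.comp (fstL m n) + k.comp (sndL m n)) x} := by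
  have happ : ∀ x, (l.comp (fstL m n) + k.comp (sndL m n)) x = l (fstL m n x) + k (sndL m n x) :=
    fun _ => rfl
  ext x
  simp only [happ]
  constructor
  · rintro ⟨hx, hy⟩
    exact ⟨⟨hx.1, hy.1⟩, fun z hz => add_le_add (hx.2 _ hz.1) (hy.2 _ hz.2)⟩
  · rintro ⟨⟨hx, hy⟩, hm⟩
    refine ⟨⟨hx, fun z hz => ?_⟩, ⟨hy, fun z hz => ?_⟩⟩
    · simpa using hm (Fin.append z (sndL m n x)) (append_mem_setProd.2 ⟨hz, hy⟩)
    · simpa using hm (Fin.append (fstL m n x) z) (append_mem_setProd.2 ⟨hx, hz⟩)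

end Product

/-- The product of two polytopes. -/
def prod (P Q : ConvexPolytope) : ConvexPolytope where
  ambientDim := P.ambientDim + Q.ambientDim
  carrier := setProd P.carrier Q.carrier
  nonempty := by
    obtain ⟨x, hx⟩ := P.nonempty
    obtain ⟨y, hy⟩ := Q.nonempty
    exact ⟨Fin.append x y, append_mem_setProd.2 ⟨hx, hy⟩⟩
  bounded := by
    obtain ⟨C, hC⟩ := isBounded_iff_forall_norm_le.1 P.bounded
    obtain ⟨D, hD⟩ := isBounded_iff_forall_norm_le.1 Q.bounded
    refine isBounded_iff_forall_norm_le.2 ⟨max (max C D) 0, fun x hx => ?_⟩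
    rw [pi_norm_le_iff_of_nonneg (le_max_right _ _)]
    intro i
    refine Fin.addCases (fun i => ?_) (fun i => ?_) i
    · exact ((norm_le_pi_norm (fstL P.ambientDim Q.ambientDim x) i).trans (hC _ hx.1)).trans
        ((le_max_left _ _).trans (le_max_left _ _))
    · exact ((norm_le_pi_norm (sndL P.ambientDim Q.ambientDim x) i).trans (hD _ hx.2)).trans
        ((le_max_right _ _).trans (le_max_left _ _))
  halfSpaces := by
    obtain ⟨H, hH, hP⟩ := P.halfSpaces
    obtain ⟨K, hK, hQ⟩ := Q.halfSpaces
    refine ⟨(fun p => (p.1.comp (fstL P.ambientDim Q.ambientDim), p.2)) '' H ∪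
      (fun p => (p.1.comp (sndL P.ambientDim Q.ambientDim), p.2)) '' K,
      (hH.image _).union (hK.image _), ?_⟩
    rw [hP, hQ]
    ext x
    simp only [setProd, Set.mem_ofPred_eq, Set.mem_union, Set.mem_image]
    constructor
    · rintro ⟨h1, h2⟩ p (⟨q, hq, rfl⟩ | ⟨q, hq, rfl⟩)
      · exact h1 q hq
      · exact h2 q hq
    · intro h
      exact ⟨fun q hq => h _ (Or.inl ⟨q, hq, rfl⟩), fun q hq => h _ (Or.inr ⟨q, hq, rfl⟩)⟩

/-- The product of two faces, as a face of the product. -/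
def Face.prod {P Q : ConvexPolytope} (F : P.Face) (G : Q.Face) : (P.prod Q).Face :=
  ⟨setProd F.1 G.1, by
    obtain ⟨x, hx⟩ := F.2.1
    obtain ⟨y, hy⟩ := G.2.1
    exact ⟨Fin.append x y, append_mem_setProd.2 ⟨hx, hy⟩⟩, fun _ => by
    obtain ⟨l, hl⟩ := F.exists_functional
    obtain ⟨k, hk⟩ := G.exists_functional
    refine ⟨l.comp (fstL P.ambientDim Q.ambientDim) + k.comp (sndL P.ambientDim Q.ambientDim), ?_⟩
    rw [hl, hk]
    exact setProd_maximizers _ _ l k⟩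

theorem Face.prod_surjective {P Q : ConvexPolytope} (K : (P.prod Q).Face) :
    ∃ (F : P.Face) (G : Q.Face), F.prod G = K := by
  obtain ⟨l, hl⟩ := K.exists_functional
  obtain ⟨z, hz⟩ := K.2.1
  obtain ⟨l₁, l₂, h⟩ := exists_functionals (m := P.ambientDim) (n := Q.ambientDim) l
  have hK : K.1 = setProd {x ∈ P.carrier | ∀ y ∈ P.carrier, l₁ y ≤ l₁ x}
      {x ∈ Q.carrier | ∀ y ∈ Q.carrier, l₂ y ≤ l₂ x} := by
    rw [setProd_maximizers, hl, h]
    rfl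
  rw [hK] at hz
  exact ⟨⟨_, ⟨_, hz.1⟩, fun _ => ⟨l₁, rfl⟩⟩, ⟨_, ⟨_, hz.2⟩, fun _ => ⟨l₂, rfl⟩⟩,
    Subtype.ext hK.symm⟩

/-- The face poset of a product is the product of the face posets. -/
noncomputable def faceProd (P Q : ConvexPolytope) : P.Face × Q.Face ≃o (P.prod Q).Face :=
  RelIso.ofSurjective
    (OrderEmbedding.ofMapLEIff (fun x : P.Face × Q.Face => x.1.prod x.2)
      fun x y => setProd_subset_iff x.1.2.1 x.2.2.1)
    fun K => by
      obtain ⟨F, G, h⟩ := Face.prod_surjective K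
      exact ⟨(F, G), h⟩

/-- The point, as a polytope in `ℝ⁰`. -/
def point : ConvexPolytope where
  ambientDim := 0
  carrier := Set.univ
  nonempty := Set.univ_nonempty
  bounded := (Set.toFinite _).isBounded
  halfSpaces := ⟨∅, Set.finite_empty, by simp⟩

instance : Unique point.Face where
  default := ⟨Set.univ, Set.univ_nonempty, IsExposed.refl _⟩
  uniq F := Subtype.ext <| by
    obtain ⟨x, hx⟩ := F.2.1
    refine Set.eq_univ_of_forall fun y => ?_
    have : y = x := funext fun i => Fin.elim0 i
    rwa [this]

/-! ### Combinatorial polytopes and the ring of polytopes -/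

/-- Two polytopes are combinatorially equivalent if their face posets are isomorphic. -/
instance combinatorialSetoid : Setoid ConvexPolytope where
  r P Q := Nonempty (P.Face ≃o Q.Face)
  iseqv := ⟨fun _ => ⟨OrderIso.refl _⟩, fun ⟨e⟩ => ⟨e.symm⟩, fun ⟨e⟩ ⟨f⟩ => ⟨e.trans f⟩⟩

end ConvexPolytope

/-- Combinatorial equivalence classes of convex polytopes. -/
def CombPolytope : Type := Quotient ConvexPolytope.combinatorialSetoid

namespace CombPolytope

/-- The combinatorial type of a polytope. -/
def mk (P : ConvexPolytope) : CombPolytope := Quotient.mk _ P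

/-- The product of two order isomorphisms. -/
def prodIso {α β γ δ : Type} [LE α] [LE β] [LE γ] [LE δ] (e : α ≃o β) (f : γ ≃o δ) :
    α × γ ≃o β × δ where
  toEquiv := Equiv.prodCongr e.toEquiv f.toEquiv
  map_rel_iff' := by simp [Prod.le_def]

open ConvexPolytope

/-- Combinatorial types form a commutative monoid under the product of polytopes, with the point
as the unit. -/
noncomputable instance : CommMonoid CombPolytope where
  mul := Quotient.map₂ ConvexPolytope.prod fun _ _ ⟨e⟩ _ _ ⟨f⟩ =>
    ⟨(faceProd _ _).symm.trans ((prodIso e f).trans (faceProd _ _))⟩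
  one := mk point
  mul_assoc := by
    rintro ⟨P⟩ ⟨Q⟩ ⟨R⟩
    exact Quotient.sound ⟨(faceProd _ _).symm.trans <|
      (prodIso (faceProd P Q).symm (OrderIso.refl R.Face)).trans <|
      (OrderIso.prodAssoc _ _ _).trans <|
      (prodIso (OrderIso.refl P.Face) (faceProd Q R)).trans <| faceProd _ _⟩
  one_mul := by
    rintro ⟨P⟩
    exact Quotient.sound ⟨(faceProd _ _).symm.trans
      { Equiv.uniqueProd P.Face point.Face with
        map_rel_iff' := fun {a b} => by
          simp [Prod.le_def, Subsingleton.elim a.1 b.1] }⟩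
  mul_one := by
    rintro ⟨P⟩
    exact Quotient.sound ⟨(faceProd _ _).symm.trans
      { Equiv.prodUnique P.Face point.Face with
        map_rel_iff' := fun {a b} => by
          simp [Prod.le_def, Subsingleton.elim a.2 b.2] }⟩
  mul_comm := by
    rintro ⟨P⟩ ⟨Q⟩
    exact Quotient.sound ⟨(faceProd _ _).symm.trans <| OrderIso.prodComm.trans (faceProd _ _)⟩

end CombPolytope

/-- The ring of polytopes `𝔓`: the free abelian group on the combinatorial types of convex
polytopes, with the product of polytopes as multiplication. -/
abbrev PolytopeRing : Type := MonoidAlgebra ℤ CombPolytope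

/-- The rational polytope algebra `𝔓 ⊗ ℚ`. -/
abbrev RatPolytopeAlgebra : Type := MonoidAlgebra ℚ CombPolytope

/-- The canonical (injective) ring homomorphism `𝔓 → 𝔓 ⊗ ℚ`. -/
noncomputable def PolytopeRing.toRat : PolytopeRing →+* RatPolytopeAlgebra :=
  MonoidAlgebra.mapRingHom CombPolytope (Int.castRingHom ℚ)

namespace ConvexPolytope

/-- The class `[P] ∈ 𝔓` of a polytope. -/
noncomputable def toRing (P : ConvexPolytope) : PolytopeRing :=
  MonoidAlgebra.of ℤ CombPolytope (CombPolytope.mk P)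

/-- The motivic interior `P° = ∑ (-1)^(codim F) [F] ∈ 𝔓`, over all nonempty faces `F` of `P`. -/
noncomputable def motivicInterior (P : ConvexPolytope) : PolytopeRing :=
  ∑ F : P.Face, (-1) ^ F.codim * F.toPolytope.toRing

/-! ### Graph-associahedra -/

/-- The graph-associahedron of a connected graph `Γ` on `n` vertices:
`{x ∈ ℝⁿ | ∑ i, x i = 3 ^ n, ∑ i ∈ S, x i ≥ 3 ^ |S|}`, where `S` runs over the proper vertex subsets
with connected (in particular nonempty) induced subgraph. -/
noncomputable def graphAssociahedron {n : ℕ} (Γ : SimpleGraph (Fin n)) (hΓ : Γ.Connected) :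
    ConvexPolytope where
  ambientDim := n
  carrier := {x | ∑ i, x i = 3 ^ n ∧ ∀ S : Finset (Fin n),
    (Γ.induce (S : Set (Fin n))).Connected → S ≠ Finset.univ → 3 ^ S.card ≤ ∑ i ∈ S, x i}
  nonempty := by
    have hne := hΓ.nonempty
    have hn : 0 < n := Fin.pos_iff_nonempty.2 hne
    have hn' : (0 : ℝ) < n := by exact_mod_cast hn
    refine ⟨fun _ => 3 ^ n / n, ?_, fun S hS _ => ?_⟩
    · simp; field_simp
    · have hmono : ∀ k j : ℕ, (3 : ℝ) ^ (k + 1) * ((k + 1 + j : ℕ) : ℝ) ≤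
          3 ^ (k + 1 + j) * ((k + 1 : ℕ) : ℝ) := by
        intro k j
        induction j with
        | zero => simp
        | succ j ih =>
          have h1 : (1 : ℝ) ≤ 3 ^ j := one_le_pow₀ (by norm_num)
          have h2 : (0 : ℝ) < 3 ^ (k + 1) := by positivity
          push_cast at ih ⊢
          rw [show k + 1 + (j + 1) = k + 1 + j + 1 from rfl, pow_succ (3 : ℝ) (k + 1 + j)]
          have h3 : (3 : ℝ) ^ (k + 1) * 1 ≤ 3 ^ (k + 1) * 3 ^ j :=
            mul_le_mul_of_nonneg_left h1 h2.le
          rw [← pow_add] at h3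
          have h4 : (0 : ℝ) ≤ k * 3 ^ (k + 1 + j) := by positivity
          nlinarith
      have hS0 : 0 < S.card := by
        obtain ⟨⟨i, hi⟩⟩ := hS.nonempty
        exact Finset.card_pos.2 ⟨i, by simpa using hi⟩
      have hSn : S.card ≤ n := by simpa using S.card_le_univ
      obtain ⟨k, hk⟩ := Nat.exists_eq_add_of_lt hS0
      obtain ⟨j, hj⟩ := Nat.exists_eq_add_of_le hSn
      have hk' : S.card = k + 1 := by omega
      have := hmono k j
      rw [← hk', ← hj] at this
      rw [Finset.sum_const, nsmul_eq_mul, mul_div_assoc', le_div_iff₀ hn']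
      linarith
  bounded := by
    refine isBounded_iff_forall_norm_le.2 ⟨3 ^ n, fun x hx => ?_⟩
    obtain ⟨hsum, hS⟩ := hx
    have h0 : ∀ i, 0 ≤ x i := by
      intro i
      by_cases hi : ({i} : Finset (Fin n)) = Finset.univ
      · have : ∑ j, x j = x i := by rw [← hi, Finset.sum_singleton]
        rw [← this, hsum]
        positivity
      · have hc : (Γ.induce (({i} : Finset (Fin n)) : Set (Fin n))).Connected := by
          rw [Finset.coe_singleton]
          exact ⟨fun a b => by rw [Subsingleton.elim a b]⟩
        have := hS {i} hc hi
        simp only [Finset.sum_singleton] at this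
        exact le_trans (by positivity) this
    rw [pi_norm_le_iff_of_nonneg (by positivity)]
    intro i
    rw [Real.norm_of_nonneg (h0 i), ← hsum]
    exact Finset.single_le_sum (fun j _ => h0 j) (Finset.mem_univ i)
  halfSpaces := by
    let s : Finset (Fin n) → StrongDual ℝ (Fin n → ℝ) := fun S =>
      ∑ i ∈ S, ContinuousLinearMap.proj i
    have hs : ∀ S x, s S x = ∑ i ∈ S, x i := fun S x => by
      simp [s]
    refine ⟨{(s Finset.univ, 3 ^ n), (-s Finset.univ, -3 ^ n)} ∪
      (fun S => (-s S, -3 ^ S.card)) '' {S : Finset (Fin n) |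
        (Γ.induce (S : Set (Fin n))).Connected ∧ S ≠ Finset.univ}, ?_, ?_⟩
    · exact (Set.toFinite _).union ((Set.toFinite _).image _)
    · ext x
      simp only [Set.mem_ofPred_eq, Set.mem_union, Set.mem_insert_iff, Set.mem_singleton_iff,
        Set.mem_image]
      constructor
      · rintro ⟨h1, h2⟩ p ((rfl | rfl) | ⟨S, ⟨hS, hS'⟩, rfl⟩)
        · simp only [hs]; exact h1.le
        · simp only [neg_apply, hs]; linarith
        · simp only [neg_apply, hs]
          exact neg_le_neg (h2 S hS hS')
      · intro h
        have h1 := h _ (Or.inl (Or.inl rfl))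
        have h2 := h _ (Or.inl (Or.inr rfl))
        simp only [neg_apply, hs] at h1 h2
        refine ⟨by linarith, fun S hS hS' => ?_⟩
        have h3 := h _ (Or.inr ⟨S, ⟨hS, hS'⟩, rfl⟩)
        simp only [neg_apply, hs] at h3
        linarith

/-- The associahedron `𝔞_{n+1}`, of dimension `n`: the graph-associahedron of the path with
`n + 1` vertices. -/
noncomputable def associahedron (n : ℕ) : ConvexPolytope :=
  graphAssociahedron (SimpleGraph.pathGraph (n + 1)) (SimpleGraph.pathGraph_connected n)

/-- The cyclohedron `W_{n+1}`, of dimension `n`: the graph-associahedron of the cycle with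
`n + 1` vertices (for one vertex a single point, for two vertices a single edge). -/
noncomputable def cyclohedron (n : ℕ) : ConvexPolytope :=
  graphAssociahedron (SimpleGraph.cycleGraph (n + 1)) SimpleGraph.cycleGraph_connected

end ConvexPolytope

/-- The class of the associahedron `𝔞_n` in the ring of polytopes, with the convention `𝔞₀ = 1`. -/
noncomputable def associahedronClass : ℕ → PolytopeRing
  | 0 => 1
  | n + 1 => (ConvexPolytope.associahedron n).toRing

/-- The class of the cyclohedron `W_n` in the ring of polytopes, for `n ≥ 1` (and `0` for
`n = 0`). -/
noncomputable def cyclohedronClass : ℕ → PolytopeRing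
  | 0 => 0
  | n + 1 => (ConvexPolytope.cyclohedron n).toRing

/-- The motivic interior `W°_n` of the cyclohedron `W_n`, for `n ≥ 1` (and `0` for `n = 0`). -/
noncomputable def cyclohedronInterior : ℕ → PolytopeRing
  | 0 => 0
  | n + 1 => (ConvexPolytope.cyclohedron n).motivicInterior

/-! ### Composition and inversion of formal power series -/

section Series

variable {K : Type*} [CommRing K]

/-- The vectors `(k₁, …, kₙ)` of nonnegative integers with `k₁ + 2 k₂ + ⋯ + n kₙ = n`; the entry
`k i` with `i : Fin n` stands for `k_{i+1}`. -/
def weightVectors (n : ℕ) : Finset (Fin n → ℕ) :=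
  (Fintype.piFinset fun _ : Fin n => Finset.range (n + 1)).filter
    fun k => ∑ i : Fin n, ((i : ℕ) + 1) * k i = n

theorem mem_weightVectors {n : ℕ} {k : Fin n → ℕ} :
    k ∈ weightVectors n ↔ ∑ i : Fin n, ((i : ℕ) + 1) * k i = n := by
  simp only [weightVectors, Finset.mem_filter, Fintype.mem_piFinset, Finset.mem_range,
    and_iff_right_iff_imp]
  intro h i
  have := Finset.single_le_sum (f := fun i : Fin n => ((i : ℕ) + 1) * k i)
    (fun _ _ => Nat.zero_le _) (Finset.mem_univ i)
  simp only [h] at this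
  nlinarith [Nat.zero_le ((i : ℕ) * k i)]

/-- The power series `∑_{n ≥ 1} a_n xⁿ`; the value `a 0` is ignored. -/
noncomputable def seriesOf (a : ℕ → K) : PowerSeries K :=
  PowerSeries.mk fun n => if n = 0 then 0 else a n

/-- `h` is the compositional inverse of `g`: both have zero constant term and
`g(h(x)) = x = h(g(x))`. -/
def IsCompInverse (g h : PowerSeries K) : Prop :=
  PowerSeries.constantCoeff g = 0 ∧ PowerSeries.constantCoeff h = 0 ∧
    g.subst h = PowerSeries.X ∧ h.subst g = PowerSeries.X

/-- Faà di Bruno's formula for the coefficient of `xⁿ` in `f(g(x))`, where `f = ∑_{n ≥ 1} a_n xⁿ` and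
`g = ∑_{n ≥ 1} b_n xⁿ`: the sum of `k! / (k₁! ⋯ kₙ!) a_k b₁^k₁ ⋯ bₙ^kₙ`, `k = k₁ + ⋯ + kₙ`, over the
vectors with `k₁ + 2 k₂ + ⋯ + n kₙ = n`. -/
noncomputable def faaDiBruno (n : ℕ) (a b : ℕ → K) : K :=
  ∑ k ∈ weightVectors n,
    (Nat.multinomial Finset.univ k : K) * (a (∑ i, k i) * ∏ i : Fin n, b ((i : ℕ) + 1) ^ k i)

variable [Algebra ℚ K]

/-- The inversion formula: for the series `x + ∑_{n ≥ 1} c_n x^(n+1)`, the coefficient of `x^(n+1)`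
in its compositional inverse,
`1 / (n+1)! ∑ (-1)^k (n+k)! / (k₁! ⋯ kₙ!) c₁^k₁ ⋯ cₙ^kₙ`, `k = k₁ + ⋯ + kₙ`, over the vectors with
`k₁ + 2 k₂ + ⋯ + n kₙ = n`. -/
noncomputable def inversionCoeff (n : ℕ) (c : ℕ → K) : K :=
  (1 / ((n + 1)! : ℚ)) • ∑ k ∈ weightVectors n,
    ((-1) ^ (∑ i, k i) * ((n + ∑ i, k i)! : ℚ) / (∏ i, (k i)! : ℕ)) • ∏ i : Fin n, c ((i : ℕ) + 1) ^ k i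

/-- The polynomials `D_n(a, b)`, `n ≥ 1`, in `a₁, a₂, …` and `b₂, b₃, …`: Faà di Bruno's formula for
`f = ∑ a_n xⁿ`, into which the coefficients of the compositional inverse of
`g = x + ∑_{n ≥ 2} b_n xⁿ`, as given by the inversion formula, are substituted. -/
noncomputable def compInvPoly (n : ℕ) (a b : ℕ → K) : K :=
  faaDiBruno n a fun m => inversionCoeff (m - 1) fun i => b (i + 1)

end Series

/-! The faces of a graph-associahedron correspond, with inclusion reversed, to the nested sets of
the building set of connected vertex sets: a face is given by the inequalities that are tight on it
(`faceIso`), and its codimension is the number of these (`finrank_vectorSpan_tightFace`). Hence the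
motivic interior is a signed sum over nested sets `T`, the term of `T` being the class of the poset
of nested sets containing `T`. A combinatorial type is determined by its face poset, so everything
is computed in the monoid algebra of posets, into which 𝔓 ⊗ ℚ embeds.

Group the nested sets by the set `R` of vertices that no member covers. In a path, `R` separates the
remaining vertices into gaps; every nonempty gap is itself a member of `T`. The nested sets
containing a member `C` are pairs of a nested set of the restriction to `C` and one of the
contraction by `C` (`linkIso`). Splitting off a gap of m vertices therefore produces a factor -𝔞_m°,
and the contraction is again a path. Once all gaps are gone, only the empty nested set covers
nothing more, and it contributes 𝔞_k with k = |R|. In terms of the gap series φ = x - ∑_{m ≥ 1} 𝔞_m°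
x^(m+1) this reads 𝔞_m° = ∑_{k ≥ 1} 𝔞_k [x^(m+1)] φ^(k+1). Since [x^(m+1)] φ = -𝔞_m° is the missing
term k = 0, the sum over all k ≥ 0 vanishes for m ≥ 1; thus φ is the compositional inverse of g =
∑_{j ≥ 1} 𝔞_{j-1} x^j (`sum_coeff_gapSeries_pow`, `map_eq_gapSeries`).

For a cycle, mark one uncovered vertex with weight 1/|R| and rotate it to the last place. This cuts
the cycle open, the gaps are again intervals, and W_n° = n ∑_k (1/k) W_k [x^n] φ^k
(`nestedInterior_cycleGraph`), which is n times the coefficient of x^n in f(g^(-1)(x)) for f = ∑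
(W_k/k) x^k.

The identification of these coefficients with D_n is the multinomial theorem
(`coeff_subst_eq_sum_weightVectors`) combined with Lagrange inversion (`coeff_eq_of_subst_eq_X`),
applied to x(1 + u) with the binomial series for (1 + u)^(-(m+1)). -/

/-! ### Isomorphism classes of posets -/

/-- A bundled partial order. -/
structure BundledPoset where
  carrier : Type
  order : PartialOrder carrier

namespace BundledPoset

instance (X : BundledPoset) : PartialOrder X.carrier := X.order

instance isoSetoid : Setoid BundledPoset where
  r X Y := Nonempty (X.carrier ≃o Y.carrier)
  iseqv := ⟨fun _ => ⟨OrderIso.refl _⟩, fun ⟨e⟩ => ⟨e.symm⟩, fun ⟨e⟩ ⟨f⟩ => ⟨e.trans f⟩⟩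

end BundledPoset

/-- Isomorphism classes of posets. -/
def PosetClass : Type 1 := Quotient BundledPoset.isoSetoid

namespace PosetClass

/-- The isomorphism class of a poset. -/
def of (α : Type) [PartialOrder α] : PosetClass := Quotient.mk _ ⟨α, inferInstance⟩

theorem of_eq_of_iff {α β : Type} [PartialOrder α] [PartialOrder β] :
    of α = of β ↔ Nonempty (α ≃o β) :=
  ⟨fun h => Quotient.exact h, fun h => Quotient.sound h⟩

theorem of_congr {α β : Type} [PartialOrder α] [PartialOrder β] (e : α ≃o β) : of α = of β :=
  of_eq_of_iff.2 ⟨e⟩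

noncomputable instance : CommMonoid PosetClass where
  mul := Quotient.map₂ (fun X Y => ⟨X.carrier × Y.carrier, inferInstance⟩)
    fun _ _ ⟨e⟩ _ _ ⟨f⟩ => ⟨CombPolytope.prodIso e f⟩
  one := of Unit
  mul_assoc := by
    rintro ⟨P⟩ ⟨Q⟩ ⟨R⟩
    exact Quotient.sound ⟨OrderIso.prodAssoc _ _ _⟩
  one_mul := by
    rintro ⟨P⟩
    exact Quotient.sound ⟨
      { Equiv.punitProd P.carrier with
        map_rel_iff' := fun {a b} => by simp [Prod.le_def] }⟩
  mul_one := by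
    rintro ⟨P⟩
    exact Quotient.sound ⟨
      { Equiv.prodPUnit P.carrier with
        map_rel_iff' := fun {a b} => by simp [Prod.le_def] }⟩
  mul_comm := by
    rintro ⟨P⟩ ⟨Q⟩
    exact Quotient.sound ⟨OrderIso.prodComm⟩

theorem of_mul_of (α β : Type) [PartialOrder α] [PartialOrder β] :
    of α * of β = of (α × β) := rfl

theorem of_eq_one (α : Type) [PartialOrder α] [Unique α] : of α = 1 :=
  of_congr
    { Equiv.equivPUnit α with
      map_rel_iff' := fun {a b} => by simp [Subsingleton.elim a b] }

end PosetClass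

/-! ### Combinatorial types inside the algebra of posets -/

namespace CombPolytope

open ConvexPolytope

/-- The isomorphism class of the opposite of the face poset, as a function of the
combinatorial type. -/
noncomputable def dualFaceClass : CombPolytope →* PosetClass where
  toFun := Quotient.lift (fun P : ConvexPolytope => PosetClass.of (P.Face)ᵒᵈ)
    fun _ _ ⟨e⟩ => PosetClass.of_congr e.dual
  map_one' := PosetClass.of_eq_one (point.Face)ᵒᵈ
  map_mul' := by
    rintro ⟨P⟩ ⟨Q⟩
    refine PosetClass.of_congr ?_
    exact (faceProd P Q).symm.dual.trans
      { toFun := fun x => (OrderDual.toDual (OrderDual.ofDual x).1,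
          OrderDual.toDual (OrderDual.ofDual x).2)
        invFun := fun x => OrderDual.toDual (OrderDual.ofDual x.1, OrderDual.ofDual x.2)
        left_inv := fun _ => rfl
        right_inv := fun _ => rfl
        map_rel_iff' := Iff.rfl }

theorem dualFaceClass_mk (P : ConvexPolytope) :
    dualFaceClass (mk P) = PosetClass.of (P.Face)ᵒᵈ := rfl

theorem dualFaceClass_injective : Function.Injective dualFaceClass := by
  rintro ⟨P⟩ ⟨Q⟩ h
  obtain ⟨e⟩ := PosetClass.of_eq_of_iff.1 h
  exact Quotient.sound ⟨e.dual⟩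

end CombPolytope

/-- The rational monoid algebra on isomorphism classes of posets. -/
abbrev PosetAlgebra : Type 1 := MonoidAlgebra ℚ PosetClass

namespace PosetAlgebra

/-- The basis element of an isomorphism class of posets. -/
noncomputable def cls (α : Type) [PartialOrder α] : PosetAlgebra :=
  MonoidAlgebra.of ℚ PosetClass (PosetClass.of α)

theorem cls_congr {α β : Type} [PartialOrder α] [PartialOrder β] (e : α ≃o β) :
    cls α = cls β := by rw [cls, PosetClass.of_congr e, cls]

theorem cls_mul_cls (α β : Type) [PartialOrder α] [PartialOrder β] :
    cls α * cls β = cls (α × β) := by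
  rw [cls, cls, cls, ← map_mul, PosetClass.of_mul_of]

theorem cls_eq_one (α : Type) [PartialOrder α] [Unique α] : cls α = 1 := by
  rw [cls, PosetClass.of_eq_one, map_one]

end PosetAlgebra

/-- The embedding of the rational polytope algebra into the monoid algebra of posets. -/
noncomputable def RatPolytopeAlgebra.toPosetAlgebra : RatPolytopeAlgebra →ₐ[ℚ] PosetAlgebra :=
  MonoidAlgebra.mapDomainAlgHom ℚ ℚ CombPolytope.dualFaceClass

/-- Combinatorial equivalence is isomorphism of face posets. Identities may thus be checked on
posets, where restrictions and contractions need not be realised as polytopes. -/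
theorem RatPolytopeAlgebra.toPosetAlgebra_injective :
    Function.Injective RatPolytopeAlgebra.toPosetAlgebra :=
  MonoidAlgebra.mapDomain_injective CombPolytope.dualFaceClass_injective

theorem RatPolytopeAlgebra.toPosetAlgebra_toRing (P : ConvexPolytope) :
    RatPolytopeAlgebra.toPosetAlgebra (PolytopeRing.toRat P.toRing) =
      PosetAlgebra.cls (P.Face)ᵒᵈ := by
  simp [RatPolytopeAlgebra.toPosetAlgebra, PolytopeRing.toRat, ConvexPolytope.toRing,
    PosetAlgebra.cls, MonoidAlgebra.of_apply, CombPolytope.dualFaceClass_mk]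

/-! ### Building sets and nested sets -/

/-- A connected building set `B` on a nonempty finite set `V`. -/
structure IsBuildingSet {α : Type} [DecidableEq α] (V : Finset α) (B : Set (Finset α)) : Prop where
  subset : ∀ S ∈ B, S ⊆ V
  nonempty : ∀ S ∈ B, S.Nonempty
  top_mem : V ∈ B
  union_mem : ∀ S ∈ B, ∀ S' ∈ B, (S ∩ S').Nonempty → S ∪ S' ∈ B

/-- Nested sets of a building set `B` on `V`: sets `T` of proper members of `B` such that a
nonempty union of members of `T` lies in `B` only if it is one of these members. -/
structure IsNested {α : Type} [DecidableEq α] (V : Finset α) (B : Set (Finset α))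
    (T : Finset (Finset α)) : Prop where
  mem : ∀ S ∈ T, S ∈ B
  ne_top : ∀ S ∈ T, S ≠ V
  sup_mem : ∀ T₀ ⊆ T, T₀.Nonempty → T₀.sup id ∈ B → T₀.sup id ∈ T₀

/-- The poset of nested sets. -/
abbrev NestedSet {α : Type} [DecidableEq α] (V : Finset α) (B : Set (Finset α)) : Type :=
  {T : Finset (Finset α) // IsNested V B T}

/-- The restriction of a building set to one of its members. -/
def restrictTo {α : Type} (B : Set (Finset α)) (C : Finset α) : Set (Finset α) :=
  {S | S ∈ B ∧ S ⊆ C}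

/-- The contraction of a building set by one of its members. -/
def contractBy {α : Type} [DecidableEq α] (B : Set (Finset α)) (C : Finset α) : Set (Finset α) :=
  {U | ∃ S ∈ B, ¬ S ⊆ C ∧ S \ C = U}

namespace IsNested

variable {α : Type} [DecidableEq α] {V : Finset α} {B : Set (Finset α)} {T : Finset (Finset α)}

theorem mono (hT : IsNested V B T) {T' : Finset (Finset α)} (h : T' ⊆ T) : IsNested V B T' :=
  ⟨fun S hS => hT.mem S (h hS), fun S hS => hT.ne_top S (h hS),
    fun T₀ h₀ => hT.sup_mem T₀ (h₀.trans h)⟩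

theorem empty : IsNested V B ∅ :=
  ⟨by simp, by simp, fun T₀ h₀ hne => by
    rw [Finset.subset_empty.1 h₀] at hne; exact absurd hne Finset.not_nonempty_empty⟩

theorem pair (hT : IsNested V B T) {S S' : Finset α} (hS : S ∈ T) (hS' : S' ∈ T)
    (h : S ∪ S' ∈ B) : S ⊆ S' ∨ S' ⊆ S := by
  have := hT.sup_mem {S, S'} (by simp [Finset.insert_subset_iff, hS, hS']) (by simp)
    (by simpa using h)
  simp only [Finset.sup_insert, id, Finset.sup_singleton, Finset.mem_insert,
    Finset.mem_singleton] at this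
  rcases this with h | h
  · exact Or.inr (Finset.union_eq_left.1 h)
  · exact Or.inl (Finset.union_eq_right.1 h)

/-- If two members meet, their union is in `B`, and nestedness forces it to be one of the two. -/
theorem subset_or_subset_or_disjoint (hB : IsBuildingSet V B) (hT : IsNested V B T)
    {S S' : Finset α} (hS : S ∈ T) (hS' : S' ∈ T) : S ⊆ S' ∨ S' ⊆ S ∨ Disjoint S S' := by
  by_cases h : Disjoint S S'
  · exact Or.inr (Or.inr h)
  · rw [Finset.disjoint_iff_inter_eq_empty, ← ne_eq, ← Finset.nonempty_iff_ne_empty] at h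
    rcases hT.pair hS hS' (hB.union_mem S (hT.mem S hS) S' (hT.mem S' hS') h) with h | h
    · exact Or.inl h
    · exact Or.inr (Or.inl h)

end IsNested

namespace IsBuildingSet

variable {α : Type} [DecidableEq α] {V : Finset α} {B : Set (Finset α)}

theorem union_sup_mem (hB : IsBuildingSet V B) {X : Finset α} (hX : X ∈ B)
    (T : Finset (Finset α)) (hT : ∀ S ∈ T, S ∈ B ∧ (S ∩ X).Nonempty) : X ∪ T.sup id ∈ B := by
  induction T using Finset.induction_on with
  | empty => simpa using hX
  | insert S T _ ih =>
    have h1 := ih fun S hS => hT S (Finset.mem_insert_of_mem hS)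
    obtain ⟨h2, h3⟩ := hT S (Finset.mem_insert_self S T)
    have := hB.union_mem S h2 _ h1 (h3.mono (Finset.inter_subset_inter_left
      Finset.subset_union_left))
    simp only [Finset.sup_insert, id, Finset.sup_eq_union]
    rwa [Finset.union_left_comm]

/-- A member of `B` covered by a nested set is contained in a member of the nested set. -/
theorem exists_subset_of_subset_sup (hB : IsBuildingSet V B) {T : Finset (Finset α)}
    (hT : IsNested V B T) {X : Finset α} (hX : X ∈ B) (h : X ⊆ T.sup id) : ∃ S ∈ T, X ⊆ S := by
  classical
  -- The members meeting `X` already cover it, and their union is in `B` by repeated use of the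
  -- union axiom; nestedness makes this union one of them.
  let T₀ := T.filter fun S => (S ∩ X).Nonempty
  have hsub : X ⊆ T₀.sup id := by
    intro x hx
    obtain ⟨S, hS, hxS⟩ := Finset.mem_sup.1 (h hx)
    exact Finset.mem_sup.2 ⟨S, Finset.mem_filter.2 ⟨hS, x, Finset.mem_inter.2 ⟨hxS, hx⟩⟩, hxS⟩
  have hmem := hB.union_sup_mem hX T₀ fun S hS =>
    ⟨hT.mem S (Finset.mem_filter.1 hS).1, (Finset.mem_filter.1 hS).2⟩
  rw [Finset.union_eq_right.2 hsub] at hmem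
  have hne : T₀.Nonempty := by
    obtain ⟨x, hx⟩ := hB.nonempty X hX
    obtain ⟨S, hS, -⟩ := Finset.mem_sup.1 (hsub hx)
    exact ⟨S, hS⟩
  exact ⟨_, (Finset.mem_filter.1 (hT.sup_mem T₀ (Finset.filter_subset _ _) hne hmem)).1, hsub⟩

/-- A nested set covering `V` would have `V` as a member. So some element always stays uncovered,
and the term `R = ∅` of the motivic interior vanishes. -/
theorem sup_ssubset (hB : IsBuildingSet V B) {T : Finset (Finset α)}
    (hT : IsNested V B T) : T.sup id ⊂ V := by
  refine Finset.ssubset_iff_subset_ne.2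
    ⟨Finset.sup_le fun S hS => hB.subset S (hT.mem S hS), fun h => ?_⟩
  obtain ⟨S, hS, h'⟩ := hB.exists_subset_of_subset_sup hT hB.top_mem h.ge
  exact hT.ne_top S hS ((hB.subset S (hT.mem S hS)).antisymm h')

theorem finite_nestedSet (hB : IsBuildingSet V B) : Finite (NestedSet V B) := by
  have : Set.Finite {T : Finset (Finset α) | IsNested V B T} :=
    (Finset.finite_toSet V.powerset.powerset).subset fun T hT => by
      simp only [Finset.mem_coe, Finset.mem_powerset]
      exact fun S hS => Finset.mem_powerset.2 (hB.subset S (hT.mem S hS))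
  exact this.to_subtype

theorem restrictTo (hB : IsBuildingSet V B) {C : Finset α} (hC : C ∈ B) :
    IsBuildingSet C (restrictTo B C) where
  subset _ hS := hS.2
  nonempty _ hS := hB.nonempty _ hS.1
  top_mem := ⟨hC, subset_rfl⟩
  union_mem _ hS _ hS' h := ⟨hB.union_mem _ hS.1 _ hS'.1 h, Finset.union_subset hS.2 hS'.2⟩

variable {C : Finset α}

theorem mem_or_union_mem_of_mem_contractBy (hB : IsBuildingSet V B) (hC : C ∈ B) {U : Finset α}
    (hU : U ∈ contractBy B C) : U.Nonempty ∧ Disjoint U C ∧ (U ∈ B ∨ U ∪ C ∈ B) := by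
  obtain ⟨S, hS, hSC, rfl⟩ := hU
  refine ⟨Finset.sdiff_nonempty.2 hSC, Finset.sdiff_disjoint, ?_⟩
  by_cases h : (S ∩ C).Nonempty
  · right
    rw [Finset.sdiff_union_self_eq_union]
    exact hB.union_mem S hS C hC h
  · left
    rw [Finset.not_nonempty_iff_eq_empty, ← Finset.disjoint_iff_inter_eq_empty] at h
    rwa [Finset.sdiff_eq_self_of_disjoint h]

end IsBuildingSet

/-! ### The link of a member of a nested set -/

section Link

variable {α : Type} [DecidableEq α] {V : Finset α} {B : Set (Finset α)} {C : Finset α}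

/-- The member of a building set `B` that becomes `U` in the contraction by `C`, among those
compatible with `C`. -/
noncomputable def liftMember (B : Set (Finset α)) (C U : Finset α) : Finset α :=
  open Classical in if U ∪ C ∈ B then U ∪ C else U

theorem liftMember_sdiff {U : Finset α} (h : Disjoint U C) : liftMember B C U \ C = U := by
  rw [liftMember]
  split_ifs
  · rw [Finset.union_sdiff_right, Finset.sdiff_eq_self_of_disjoint h]
  · exact Finset.sdiff_eq_self_of_disjoint h

namespace IsNested

variable {T : Finset (Finset α)}

theorem subset_or_disjoint (hB : IsBuildingSet V B) (hT : IsNested V B T) (hC : C ∈ T)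
    {S : Finset α} (hS : S ∈ T) (hSC : ¬ S ⊆ C) :
    C ⊆ S ∨ (Disjoint S C ∧ S ∪ C ∉ B) := by
  rcases hT.subset_or_subset_or_disjoint hB hS hC with h | h | h
  · exact absurd h hSC
  · exact Or.inl h
  · by_cases h' : S ∪ C ∈ B
    · rcases hT.pair hS hC h' with h | h
      · exact absurd h hSC
      · exact Or.inl h
    · exact Or.inr ⟨h, h'⟩

/-- Such an `S` either contains `C` or is disjoint from it with `S ∪ C ∉ B`, and `liftMember`
distinguishes the two cases. So removing `C` loses no information. -/
theorem liftMember_sdiff_self (hB : IsBuildingSet V B) (hT : IsNested V B T) (hC : C ∈ T)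
    {S : Finset α} (hS : S ∈ T) (hSC : ¬ S ⊆ C) : liftMember B C (S \ C) = S := by
  rcases hT.subset_or_disjoint hB hC hS hSC with h | ⟨h, h'⟩
  · rw [liftMember, Finset.sdiff_union_of_subset h, if_pos (hT.mem S hS)]
  · rw [liftMember, Finset.sdiff_eq_self_of_disjoint h, if_neg h']

theorem restrictTo (hT : IsNested V B T) :
    IsNested C (restrictTo B C) (T.filter fun S => S ⊂ C) where
  mem _ hS := ⟨hT.mem _ (Finset.mem_filter.1 hS).1, (Finset.mem_filter.1 hS).2.1⟩
  ne_top _ hS := (Finset.mem_filter.1 hS).2.ne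
  sup_mem T₀ h₀ hne h := hT.sup_mem T₀ (h₀.trans (Finset.filter_subset _ _)) hne h.1

theorem contractBy (hB : IsBuildingSet V B) (hT : IsNested V B T) (hC : C ∈ T) :
    IsNested (V \ C) (contractBy B C) ((T.filter fun S => ¬ S ⊆ C).image (· \ C)) where
  mem U hU := by
    obtain ⟨S, hS, rfl⟩ := Finset.mem_image.1 hU
    rw [Finset.mem_filter] at hS
    exact ⟨S, hT.mem S hS.1, hS.2, rfl⟩
  ne_top U hU h := by
    obtain ⟨S, hS, rfl⟩ := Finset.mem_image.1 hU
    rw [Finset.mem_filter] at hS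
    have hCV := hB.subset C (hT.mem C hC)
    have hSV := hB.subset S (hT.mem S hS.1)
    have hu : S ∪ C = V := by
      rw [← Finset.sdiff_union_self_eq_union, h, Finset.sdiff_union_of_subset hCV]
    rcases hT.subset_or_disjoint hB hC hS.1 hS.2 with h' | ⟨-, h'⟩
    · rw [Finset.union_eq_left.2 h'] at hu
      exact hT.ne_top S hS.1 hu
    · rw [hu] at h'
      exact h' hB.top_mem
  sup_mem T₀ h₀ hne h := by
    classical
    let T₁ := (T.filter fun S => ¬ S ⊆ C).filter fun S => S \ C ∈ T₀
    have hT₁ : ∀ S, S ∈ T₁ ↔ (S ∈ T ∧ ¬ S ⊆ C) ∧ S \ C ∈ T₀ := by simp [T₁]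
    have himg : T₁.image (· \ C) = T₀ := by
      ext U
      simp only [Finset.mem_image, hT₁]
      constructor
      · rintro ⟨S, hS, rfl⟩
        exact hS.2
      · intro hU
        obtain ⟨S, hS, rfl⟩ := Finset.mem_image.1 (h₀ hU)
        rw [Finset.mem_filter] at hS
        exact ⟨S, ⟨hS, hU⟩, rfl⟩
    have hT₁T : T₁ ⊆ T := fun S hS => ((hT₁ S).1 hS).1.1
    have hsup : T₀.sup id = T₁.sup id \ C := by
      rw [← himg, Finset.sup_image]
      ext x
      simp only [Finset.mem_sup, Finset.mem_sdiff, Function.comp, id]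
      tauto
    have hne₁ : T₁.Nonempty := by
      rw [← himg] at hne
      exact Finset.image_nonempty.1 hne
    have hfin : T₁.sup id ∈ T₁ → T₀.sup id ∈ T₀ := fun h' => by
      rw [hsup]
      exact ((hT₁ _).1 h').2
    obtain ⟨hXne, -, hX⟩ := hB.mem_or_union_mem_of_mem_contractBy (hT.mem C hC) h
    -- If a chosen member contains `C`, uniting with it puts the whole union in `B`. Otherwise all
    -- chosen members are disjoint from `C`, and if their union were in `B` only after adding `C`,
    -- nestedness of `insert C T₁` would fail.
    by_cases hCT : ∃ S ∈ T₁, C ⊆ S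
    · obtain ⟨S, hS, hCS⟩ := hCT
      have hCsup : C ⊆ T₁.sup id := hCS.trans (Finset.le_sup (f := id) hS)
      rw [hsup, Finset.sdiff_union_of_subset hCsup] at hX
      refine hfin (hT.sup_mem T₁ hT₁T hne₁ ?_)
      rcases hX with hX | hX
      · have hS' := (hT₁ S).1 hS
        have := hB.union_mem S (hT.mem S hS'.1.1) _ hX (by
          obtain ⟨x, hx⟩ := Finset.sdiff_nonempty.2 hS'.1.2
          rw [Finset.mem_sdiff] at hx
          exact ⟨x, Finset.mem_inter.2 ⟨hx.1, Finset.mem_sdiff.2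
            ⟨(Finset.le_sup (f := id) hS : S ≤ T₁.sup id) hx.1, hx.2⟩⟩⟩)
        convert this using 1
        refine (Finset.union_subset (Finset.le_sup (f := id) hS) Finset.sdiff_subset).antisymm'
          fun x hx => ?_
        by_cases hxC : x ∈ C
        · exact Finset.mem_union_left _ (hCS hxC)
        · exact Finset.mem_union_right _ (Finset.mem_sdiff.2 ⟨hx, hxC⟩)
      · exact hX
    · have hdisj : Disjoint (T₁.sup id) C := by
        rw [Finset.disjoint_sup_left]
        intro S hS
        rcases hT.subset_or_disjoint hB hC ((hT₁ S).1 hS).1.1 ((hT₁ S).1 hS).1.2 with h' | h'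
        · exact absurd ⟨S, hS, h'⟩ hCT
        · exact h'.1
      rw [hsup, Finset.sdiff_eq_self_of_disjoint hdisj] at hX
      rcases hX with hX | hX
      · exact hfin (hT.sup_mem T₁ hT₁T hne₁ hX)
      · have := hT.sup_mem (insert C T₁) (Finset.insert_subset hC hT₁T) (by simp)
          (by simpa [Finset.union_comm] using hX)
        rw [Finset.sup_insert, Finset.mem_insert] at this
        rcases this with h' | h'
        · rw [hsup] at hXne
          rw [Finset.sdiff_eq_empty_iff_subset.2] at hXne
          · exact absurd hXne Finset.not_nonempty_empty
          · exact le_sup_right.trans h'.le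
        · exact absurd ⟨_, h', le_sup_left⟩ hCT

/-- A nested set is assembled from a nested set of the restriction to `C` and a nested set of the
contraction by `C`. -/
theorem assemble (hB : IsBuildingSet V B) (hC : C ∈ B) (hCV : C ≠ V)
    {T₁ T₂ : Finset (Finset α)} (h₁ : IsNested C (_root_.restrictTo B C) T₁)
    (h₂ : IsNested (V \ C) (_root_.contractBy B C) T₂) :
    IsNested V B (insert C (T₁ ∪ T₂.image (liftMember B C))) where
  mem S hS := by
    rw [Finset.mem_insert, Finset.mem_union, Finset.mem_image] at hS
    rcases hS with rfl | hS | ⟨U, hU, rfl⟩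
    · exact hC
    · exact (h₁.mem S hS).1
    · rw [liftMember]
      split_ifs with h
      · exact h
      · exact (hB.mem_or_union_mem_of_mem_contractBy hC (h₂.mem U hU)).2.2.resolve_right h
  ne_top S hS := by
    rw [Finset.mem_insert, Finset.mem_union, Finset.mem_image] at hS
    rcases hS with rfl | hS | ⟨U, hU, rfl⟩
    · exact hCV
    · rintro rfl
      exact hCV ((hB.subset C hC).antisymm (h₁.mem S hS).2)
    · intro h
      refine h₂.ne_top U hU ?_
      rw [← h, liftMember_sdiff (hB.mem_or_union_mem_of_mem_contractBy hC (h₂.mem U hU)).2.1]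
  sup_mem T₀ h₀ hne hX := by
    classical
    -- Outside `C` the union of `T₀` is the union of `T₃`. If `T₃` is empty, everything happens
    -- inside `C`; otherwise nestedness of `T₂` applies to it.
    let T₃ := T₂.filter fun U => liftMember B C U ∈ T₀
    have hT₃ : ∀ U, U ∈ T₃ ↔ U ∈ T₂ ∧ liftMember B C U ∈ T₀ := by simp [T₃]
    have hdisj : ∀ U ∈ T₂, Disjoint U C := fun U hU =>
      (hB.mem_or_union_mem_of_mem_contractBy hC (h₂.mem U hU)).2.1
    have hsup : T₀.sup id \ C = T₃.sup id := by
      ext x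
      simp only [Finset.mem_sup, Finset.mem_sdiff, id, hT₃]
      constructor
      · rintro ⟨⟨S, hS, hx⟩, hxC⟩
        have := h₀ hS
        rw [Finset.mem_insert, Finset.mem_union, Finset.mem_image] at this
        rcases this with rfl | hS' | ⟨U, hU, rfl⟩
        · exact absurd hx hxC
        · exact absurd ((h₁.mem S hS').2 hx) hxC
        · refine ⟨U, ⟨hU, hS⟩, ?_⟩
          rw [← liftMember_sdiff (B := B) (hdisj U hU)]
          exact Finset.mem_sdiff.2 ⟨hx, hxC⟩
      · rintro ⟨U, ⟨hU, hS⟩, hx⟩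
        rw [← liftMember_sdiff (B := B) (hdisj U hU), Finset.mem_sdiff] at hx
        exact ⟨⟨_, hS, hx.1⟩, hx.2⟩
    rcases T₃.eq_empty_or_nonempty with h | h
    · have hsub : T₀ ⊆ insert C T₁ := fun S hS => by
        have := h₀ hS
        rw [Finset.mem_insert, Finset.mem_union, Finset.mem_image] at this
        rcases this with rfl | hS' | ⟨U, hU, rfl⟩
        · simp
        · simp [hS']
        · exact absurd ((hT₃ U).2 ⟨hU, hS⟩) (by simp [h])
      have hle : T₀.sup id ⊆ C := by
        rw [h, Finset.sup_empty] at hsup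
        exact Finset.sdiff_eq_empty_iff_subset.1 hsup
      by_cases hCT : C ∈ T₀
      · rwa [hle.antisymm (Finset.le_sup (f := id) hCT)]
      · exact h₁.sup_mem T₀ (fun S hS => (Finset.mem_insert.1 (hsub hS)).resolve_left
          fun h => hCT (h ▸ hS)) hne ⟨hX, hle⟩
    · have hXC : ¬ T₀.sup id ⊆ C := fun h' => by
        rw [Finset.sdiff_eq_empty_iff_subset.2 h'] at hsup
        obtain ⟨U, hU⟩ := h
        obtain ⟨x, hx⟩ := (hB.mem_or_union_mem_of_mem_contractBy hC
          (h₂.mem U ((hT₃ U).1 hU).1)).1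
        have : x ∈ T₃.sup id := Finset.mem_sup.2 ⟨U, hU, hx⟩
        rw [← hsup] at this
        exact absurd this (Finset.notMem_empty x)
      have hU := h₂.sup_mem T₃ (Finset.filter_subset _ _) h (hsup ▸ ⟨_, hX, hXC, rfl⟩)
      rw [← hsup, hT₃] at hU
      have hle : liftMember B C (T₀.sup id \ C) ⊆ T₀.sup id := Finset.le_sup (f := id) hU.2
      convert hU.2 using 1
      refine hle.antisymm' ?_
      -- When the lift does not include `C`, the union cannot meet `C`, since otherwise its union
      -- with `C` would be in `B`.
      by_cases hm : (T₀.sup id \ C) ∪ C ∈ B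
      · rw [liftMember, if_pos hm, Finset.sdiff_union_self_eq_union]
        exact Finset.subset_union_left
      · rw [liftMember, if_neg hm]
        have : Disjoint (T₀.sup id) C := by
          by_contra hd
          rw [Finset.disjoint_iff_inter_eq_empty, ← ne_eq, ← Finset.nonempty_iff_ne_empty] at hd
          rw [Finset.sdiff_union_self_eq_union] at hm
          exact hm (hB.union_mem _ hX C hC hd)
        rw [Finset.sdiff_eq_self_of_disjoint this]

end IsNested

/-- The nested sets containing `C` are the pairs of nested sets of the restriction to `C` and of
the contraction by `C`. -/
noncomputable def linkIso (hB : IsBuildingSet V B) (hC : C ∈ B) (hCV : C ≠ V) :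
    {T : NestedSet V B // C ∈ T.1} ≃o
      NestedSet C (restrictTo B C) × NestedSet (V \ C) (contractBy B C) where
  toFun T := (⟨_, T.1.2.restrictTo⟩, ⟨_, T.1.2.contractBy hB T.2⟩)
  invFun P := ⟨⟨_, P.1.2.assemble hB hC hCV P.2.2⟩, Finset.mem_insert_self _ _⟩
  left_inv := by
    rintro ⟨⟨T, hT⟩, hCT⟩
    refine Subtype.ext (Subtype.ext ?_)
    ext S
    simp only [Finset.mem_insert, Finset.mem_union, Finset.mem_filter, Finset.mem_image]
    constructor
    · rintro (rfl | h | ⟨U, ⟨S', ⟨hS', hSC⟩, rfl⟩, rfl⟩)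
      · exact hCT
      · exact h.1
      · rwa [hT.liftMember_sdiff_self hB hCT hS' hSC]
    · intro hS
      by_cases hSC : S ⊆ C
      · rcases hSC.eq_or_ssubset with h | h
        · exact Or.inl h
        · exact Or.inr (Or.inl ⟨hS, h⟩)
      · exact Or.inr (Or.inr ⟨_, ⟨S, ⟨hS, hSC⟩, rfl⟩, hT.liftMember_sdiff_self hB hCT hS hSC⟩)
  right_inv := by
    rintro ⟨⟨T₁, h₁⟩, ⟨T₂, h₂⟩⟩
    have hlift : ∀ U ∈ T₂, liftMember B C U \ C = U ∧ ¬ liftMember B C U ⊆ C := by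
      intro U hU
      obtain ⟨hne, hd, -⟩ := hB.mem_or_union_mem_of_mem_contractBy hC (h₂.mem U hU)
      have := liftMember_sdiff (B := B) hd
      refine ⟨this, fun h => ?_⟩
      rw [Finset.sdiff_eq_empty_iff_subset.2 h] at this
      exact hne.ne_empty this.symm
    refine Prod.ext (Subtype.ext ?_) (Subtype.ext ?_)
    · ext S
      simp only [Finset.mem_insert, Finset.mem_union, Finset.mem_filter, Finset.mem_image]
      constructor
      · rintro ⟨rfl | h | ⟨U, hU, rfl⟩, hSC⟩
        · exact absurd rfl hSC.ne
        · exact h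
        · exact absurd hSC.1 (hlift U hU).2
      · intro hS
        exact ⟨Or.inr (Or.inl hS), (h₁.mem S hS).2.ssubset_of_ne (h₁.ne_top S hS)⟩
    · ext U
      simp only [Finset.mem_insert, Finset.mem_union, Finset.mem_filter, Finset.mem_image]
      constructor
      · rintro ⟨S, ⟨rfl | h | ⟨U', hU', rfl⟩, hSC⟩, rfl⟩
        · exact absurd subset_rfl hSC
        · exact absurd (h₁.mem S h).2 hSC
        · rwa [(hlift U' hU').1]
      · intro hU
        exact ⟨_, ⟨Or.inr (Or.inr ⟨U, hU, rfl⟩), (hlift U hU).2⟩, (hlift U hU).1⟩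
  map_rel_iff' := by
    rintro ⟨⟨T, hT⟩, hCT⟩ ⟨⟨T', hT'⟩, hCT'⟩
    constructor
    · rintro ⟨h1, h2⟩ S hS
      by_cases hSC : S ⊆ C
      · rcases hSC.eq_or_ssubset with h | h
        · exact h ▸ hCT'
        · exact (Finset.mem_filter.1 (h1 (Finset.mem_filter.2 ⟨hS, h⟩))).1
      · have : S \ C ∈ (T'.filter fun S => ¬ S ⊆ C).image (· \ C) :=
          h2 (Finset.mem_image.2 ⟨S, Finset.mem_filter.2 ⟨hS, hSC⟩, rfl⟩)
        obtain ⟨S', hS', heq⟩ := Finset.mem_image.1 this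
        rw [Finset.mem_filter] at hS'
        rw [← hT.liftMember_sdiff_self hB hCT hS hSC, ← heq,
          hT'.liftMember_sdiff_self hB hCT' hS'.1 hS'.2]
        exact hS'.1
    · intro h
      exact ⟨Finset.filter_subset_filter _ h,
        Finset.image_subset_image (Finset.filter_subset_filter _ h)⟩

theorem card_eq_of_linkIso (hB : IsBuildingSet V B) (hC : C ∈ B) (hCV : C ≠ V)
    (T : {T : NestedSet V B // C ∈ T.1}) :
    T.1.1.card = (linkIso hB hC hCV T).1.1.card + (linkIso hB hC hCV T).2.1.card + 1 := by
  classical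
  obtain ⟨⟨T, hT⟩, hCT⟩ := T
  change T.card = (T.filter fun S => S ⊂ C).card +
    ((T.filter fun S => ¬ S ⊆ C).image (· \ C)).card + 1
  have hCT : C ∈ T := hCT
  have hinj : Set.InjOn (· \ C) ((T.filter fun S => ¬ S ⊆ C : Finset (Finset α)) :
      Set (Finset α)) := by
    intro S hS S' hS' h
    simp only [Finset.coe_filter, Set.mem_ofPred_eq] at hS hS' h
    rw [← hT.liftMember_sdiff_self hB hCT hS.1 hS.2, h,
      hT.liftMember_sdiff_self hB hCT hS'.1 hS'.2]
  rw [Finset.card_image_of_injOn hinj]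
  have h1 := Finset.card_filter_add_card_filter_not (s := T) (fun S => S ⊆ C)
  have h2 : T.filter (fun S => S ⊆ C) = insert C (T.filter fun S => S ⊂ C) := by
    ext S
    simp only [Finset.mem_filter, Finset.mem_insert]
    constructor
    · rintro ⟨h, h'⟩
      rcases h'.eq_or_ssubset with h'' | h''
      · exact Or.inl h''
      · exact Or.inr ⟨h, h''⟩
    · rintro (rfl | h)
      · exact ⟨hCT, subset_rfl⟩
      · exact ⟨h.1, h.2.1⟩
  rw [h2, Finset.card_insert_of_notMem (by simp)] at h1
  omega

/-- `C` is covered by itself, so the component in the restriction has no influence on what is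
uncovered. -/
theorem sdiff_sup_of_linkIso (hB : IsBuildingSet V B) (hC : C ∈ B) (hCV : C ≠ V)
    (T : {T : NestedSet V B // C ∈ T.1}) :
    (V \ C) \ (linkIso hB hC hCV T).2.1.sup id = V \ T.1.1.sup id := by
  obtain ⟨⟨T, hT⟩, hCT⟩ := T
  change (V \ C) \ ((T.filter fun S => ¬ S ⊆ C).image (· \ C)).sup id = V \ T.sup id
  have hCT : C ∈ T := hCT
  ext x
  simp only [Finset.mem_sdiff, Finset.mem_sup, Finset.mem_image, Finset.mem_filter, id, not_exists,
    not_and]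
  constructor
  · rintro ⟨⟨hV, hxC⟩, h⟩
    refine ⟨hV, fun S hS hx => ?_⟩
    exact h (S \ C) ⟨S, ⟨hS, fun h' => hxC (h' hx)⟩, rfl⟩ (Finset.mem_sdiff.2 ⟨hx, hxC⟩)
  · rintro ⟨hV, h⟩
    refine ⟨⟨hV, h C hCT⟩, ?_⟩
    rintro _ ⟨S, ⟨hS, -⟩, rfl⟩ hx
    exact h S hS (Finset.mem_sdiff.1 hx).1

end Link

/-! ### Signed sums over nested sets -/

/-- Principal filters are preserved by order isomorphisms. -/
def OrderIso.iciCongr {α β : Type} [PartialOrder α] [PartialOrder β] (e : α ≃o β) (a : α) :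
    Set.Ici a ≃o Set.Ici (e a) where
  toFun x := ⟨e x.1, e.le_iff_le.2 x.2⟩
  invFun y := ⟨e.symm y.1, by
    have := y.2
    rw [Set.mem_Ici] at this ⊢
    rwa [e.le_symm_apply]⟩
  left_inv x := by simp
  right_inv y := by simp
  map_rel_iff' := e.le_iff_le

/-- A principal filter of a product is a product of principal filters. -/
def iciProdIso {α β : Type} [PartialOrder α] [PartialOrder β] (p : α × β) :
    Set.Ici p ≃o Set.Ici p.1 × Set.Ici p.2 where
  toFun x := (⟨x.1.1, x.2.1⟩, ⟨x.1.2, x.2.2⟩)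
  invFun y := ⟨(y.1.1, y.2.1), ⟨y.1.2, y.2.2⟩⟩
  left_inv _ := rfl
  right_inv _ := rfl
  map_rel_iff' := Iff.rfl

/-- A principal filter of an upper set, as a principal filter of the whole poset. -/
def iciSubtypeIso {α : Type} [PartialOrder α] (p : α → Prop) (hp : ∀ a b, a ≤ b → p a → p b)
    (a : {a // p a}) : Set.Ici a.1 ≃o Set.Ici a where
  toFun x := ⟨⟨x.1, hp _ _ x.2 a.2⟩, x.2⟩
  invFun x := ⟨x.1.1, x.2⟩
  left_inv _ := rfl
  right_inv _ := rfl
  map_rel_iff' := Iff.rfl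

section NestedSums

variable {α : Type} [DecidableEq α] {V : Finset α} {B : Set (Finset α)} {C : Finset α}

/-- The contribution of a nested set to the motivic interior. -/
noncomputable def nestedTerm (T : NestedSet V B) : PosetAlgebra :=
  (-1) ^ T.1.card * PosetAlgebra.cls (Set.Ici T)

/-- The motivic interior of the poset of nested sets. -/
noncomputable def nestedInterior (V : Finset α) (B : Set (Finset α)) : PosetAlgebra :=
  ∑ᶠ T : NestedSet V B, nestedTerm T

/-- The part of the motivic interior contributed by the nested sets that leave exactly the elements
of `R` uncovered. -/
noncomputable def nestedInteriorOver (V : Finset α) (B : Set (Finset α)) (R : Finset α) :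
    PosetAlgebra :=
  ∑ᶠ T : {T : NestedSet V B // V \ T.1.sup id = R}, nestedTerm T.1

/-- All nested sets above `T` contain `C`, so the filter of `T` lies in the link of `C` and splits
as a product. The sign accounts for the member `C` itself. -/
theorem nestedTerm_linkIso (hB : IsBuildingSet V B) (hC : C ∈ B) (hCV : C ≠ V)
    (T : {T : NestedSet V B // C ∈ T.1}) :
    nestedTerm T.1 =
      -(nestedTerm (linkIso hB hC hCV T).1 * nestedTerm (linkIso hB hC hCV T).2) := by
  rw [nestedTerm, nestedTerm, nestedTerm, card_eq_of_linkIso hB hC hCV,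
    PosetAlgebra.cls_congr ((iciSubtypeIso (fun T : NestedSet V B => C ∈ T.1)
      (fun T T' (h : T.1 ⊆ T'.1) h' => h h') T).trans (((linkIso hB hC hCV).iciCongr T).trans (iciProdIso _))),
    ← PosetAlgebra.cls_mul_cls]
  ring

/-- If `T` leaves exactly `R` uncovered, then `C` is covered, hence inside a member of `T`. That
member avoids `R`, so it is `C` by maximality. All contributing nested sets therefore lie in the
link of `C`. -/
theorem nestedInteriorOver_eq_mul (hB : IsBuildingSet V B) {R : Finset α}
    (hC : C ∈ B) (hCV : C ≠ V) (hCR : Disjoint C R)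
    (hmax : ∀ S ∈ B, C ⊆ S → Disjoint S R → S = C)
    (hB' : IsBuildingSet (V \ C) (contractBy B C)) :
    nestedInteriorOver V B R =
      -nestedInterior C (restrictTo B C) * nestedInteriorOver (V \ C) (contractBy B C) R := by
  have hmem : ∀ T : NestedSet V B, V \ T.1.sup id = R → C ∈ T.1 := by
    rintro ⟨T, hT⟩ hR
    have : C ⊆ T.sup id := fun x hx => by
      by_contra h
      have : x ∈ R := hR ▸ Finset.mem_sdiff.2 ⟨hB.subset C hC hx, h⟩
      exact absurd hx (Finset.disjoint_right.1 hCR this)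
    obtain ⟨S, hS, hCS⟩ := hB.exists_subset_of_subset_sup hT hC this
    have hSR : Disjoint S R := by
      rw [← hR]
      exact Finset.disjoint_sdiff.mono_left (Finset.le_sup (f := id) hS)
    exact hmax S (hT.mem S hS) hCS hSR ▸ hS
  have := hB.finite_nestedSet
  have := (hB.restrictTo hC).finite_nestedSet
  have := hB'.finite_nestedSet
  have := Fintype.ofFinite {T : NestedSet V B // V \ T.1.sup id = R}
  have := Fintype.ofFinite (NestedSet C (restrictTo B C))
  have := Fintype.ofFinite {T : NestedSet (V \ C) (contractBy B C) // (V \ C) \ T.1.sup id = R}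
  rw [nestedInteriorOver, nestedInterior, nestedInteriorOver, finsum_eq_sum_of_fintype,
    finsum_eq_sum_of_fintype, finsum_eq_sum_of_fintype, neg_mul, Finset.sum_mul_sum,
    ← Finset.sum_product', ← Finset.sum_neg_distrib]
  let e : {T : NestedSet V B // V \ T.1.sup id = R} ≃
      NestedSet C (restrictTo B C) ×
        {T : NestedSet (V \ C) (contractBy B C) // (V \ C) \ T.1.sup id = R} :=
    { toFun := fun T => ((linkIso hB hC hCV ⟨T.1, hmem T.1 T.2⟩).1,
        ⟨(linkIso hB hC hCV ⟨T.1, hmem T.1 T.2⟩).2, by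
          rw [sdiff_sup_of_linkIso]; exact T.2⟩)
      invFun := fun P => ⟨((linkIso hB hC hCV).symm (P.1, P.2.1)).1, by
          rw [← sdiff_sup_of_linkIso hB hC hCV, OrderIso.apply_symm_apply]
          exact P.2.2⟩
      left_inv := fun T => by
        refine Subtype.ext ?_
        simp
      right_inv := fun P => by simp }
  refine Fintype.sum_equiv e _ _ fun T => ?_
  exact nestedTerm_linkIso hB hC hCV ⟨T.1, hmem T.1 T.2⟩

/-- The only nested set that covers nothing is the empty one. -/
theorem nestedInteriorOver_self (hB : IsBuildingSet V B) :
    nestedInteriorOver V B V = PosetAlgebra.cls (NestedSet V B) := by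
  have hempty : ∀ T : NestedSet V B, V \ T.1.sup id = V → T.1 = ∅ := by
    rintro ⟨T, hT⟩ h
    refine Finset.eq_empty_of_forall_notMem fun S hS => ?_
    obtain ⟨x, hx⟩ := hB.nonempty S (hT.mem S hS)
    have hxV : x ∈ V \ T.sup id := by
      rw [h]
      exact hB.subset S (hT.mem S hS) hx
    exact (Finset.mem_sdiff.1 hxV).2 ((Finset.le_sup (f := id) hS : S ≤ _) hx)
  let T₀ : {T : NestedSet V B // V \ T.1.sup id = V} := ⟨⟨∅, IsNested.empty⟩, by simp⟩
  have : Unique {T : NestedSet V B // V \ T.1.sup id = V} :=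
    ⟨⟨T₀⟩, fun T => Subtype.ext (Subtype.ext (hempty T.1 T.2))⟩
  rw [nestedInteriorOver, finsum_unique, Subsingleton.elim default T₀]
  change (-1) ^ 0 * _ = _
  rw [pow_zero, one_mul]
  exact PosetAlgebra.cls_congr
    { toFun := fun T => T.1
      invFun := fun T => ⟨T, Finset.empty_subset _⟩
      left_inv := fun _ => rfl
      right_inv := fun _ => rfl
      map_rel_iff' := Iff.rfl }

theorem nestedInterior_eq_sum (hB : IsBuildingSet V B) :
    nestedInterior V B = ∑ R ∈ V.powerset, nestedInteriorOver V B R := by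
  classical
  have := hB.finite_nestedSet
  have := Fintype.ofFinite (NestedSet V B)
  rw [nestedInterior, finsum_eq_sum_of_fintype,
    ← Finset.sum_fiberwise_of_maps_to (t := V.powerset)
      (g := fun T : NestedSet V B => V \ T.1.sup id)]
  · refine Finset.sum_congr rfl fun R _ => ?_
    have := Fintype.ofFinite {T : NestedSet V B // V \ T.1.sup id = R}
    rw [nestedInteriorOver, finsum_eq_sum_of_fintype, Finset.sum_subtype]
    simp
  · intro T _
    exact Finset.mem_powerset.2 Finset.sdiff_subset

theorem nestedInteriorOver_empty (hB : IsBuildingSet V B) : nestedInteriorOver V B ∅ = 0 := by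
  have : IsEmpty {T : NestedSet V B // V \ T.1.sup id = ∅} :=
    ⟨fun T => (hB.sup_ssubset T.1.2).2 (Finset.sdiff_eq_empty_iff_subset.1 T.2)⟩
  rw [nestedInteriorOver, finsum_of_isEmpty]

end NestedSums

/-! ### Relabelling -/

section Relabel

variable {α β : Type} [DecidableEq α] [DecidableEq β] {V : Finset α} {B : Set (Finset α)}
  {V' : Finset β} {B' : Set (Finset β)}

theorem sup_map_mapEmbedding (f : α ↪ β) (T : Finset (Finset α)) :
    (T.map (Finset.mapEmbedding f).toEmbedding).sup id = (T.sup id).map f := by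
  ext x
  simp only [Finset.mem_sup, Finset.mem_map, id, RelEmbedding.coe_toEmbedding,
    Finset.mapEmbedding_apply]
  constructor
  · rintro ⟨_, ⟨S, hS, rfl⟩, hx⟩
    obtain ⟨y, hy, rfl⟩ := Finset.mem_map.1 hx
    exact ⟨y, ⟨S, hS, hy⟩, rfl⟩
  · rintro ⟨y, ⟨S, hS, hy⟩, rfl⟩
    exact ⟨_, ⟨S, hS, rfl⟩, Finset.mem_map.2 ⟨y, hy, rfl⟩⟩

theorem isNested_map (f : α ↪ β) (hV : V' = V.map f) (hB : B' = Finset.map f '' B)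
    {T : Finset (Finset α)} :
    IsNested V' B' (T.map (Finset.mapEmbedding f).toEmbedding) ↔ IsNested V B T := by
  subst hV hB
  have hmem : ∀ S, S.map f ∈ Finset.map f '' B ↔ S ∈ B :=
    fun S => (Finset.map_injective f).mem_set_image
  constructor
  · intro h
    refine ⟨fun S hS => ?_, fun S hS => ?_, fun T₀ h₀ hne hm => ?_⟩
    · exact (hmem S).1 (h.mem _ (Finset.mem_map_of_mem _ hS))
    · rintro rfl
      exact h.ne_top _ (Finset.mem_map_of_mem _ hS) rfl
    · have := h.sup_mem (T₀.map (Finset.mapEmbedding f).toEmbedding) (Finset.map_subset_map.2 h₀)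
        (hne.map) (by rw [sup_map_mapEmbedding]; exact (hmem _).2 hm)
      rw [sup_map_mapEmbedding] at this
      exact (Finset.mem_map' _).1 this
  · intro h
    refine ⟨fun S hS => ?_, fun S hS => ?_, fun T₀ h₀ hne hm => ?_⟩
    · obtain ⟨S, hS', rfl⟩ := Finset.mem_map.1 hS
      exact (hmem S).2 (h.mem S hS')
    · obtain ⟨S, hS', rfl⟩ := Finset.mem_map.1 hS
      intro heq
      exact h.ne_top S hS' (Finset.map_injective f heq)
    · obtain ⟨T₁, hT₁, rfl⟩ := Finset.subset_map_iff.1 h₀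
      rw [sup_map_mapEmbedding] at hm ⊢
      exact Finset.mem_map_of_mem _ (h.sup_mem T₁ hT₁ (Finset.map_nonempty.1 hne) ((hmem _).1 hm))

/-- Relabelling the ground set of a building set. -/
noncomputable def relabelIso (f : α ↪ β) (hV : V' = V.map f) (hB : B' = Finset.map f '' B) :
    NestedSet V B ≃o NestedSet V' B' :=
  RelIso.ofSurjective
    (OrderEmbedding.ofMapLEIff
      (fun T : NestedSet V B => (⟨_, (isNested_map f hV hB).2 T.2⟩ : NestedSet V' B'))
      fun _ _ => Finset.map_subset_map)
    fun T => by
      obtain ⟨T, hT⟩ := T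
      have hsub : (T : Set (Finset β)) ⊆ Set.range (Finset.mapEmbedding f).toEmbedding := by
        intro S hS
        have := hT.mem S hS
        rw [hB] at this
        obtain ⟨S', -, rfl⟩ := this
        exact ⟨S', rfl⟩
      obtain ⟨T', -, rfl⟩ : ∃ T' : Finset (Finset α), (T' : Set (Finset α)) ⊆ Set.univ ∧
          T'.map (Finset.mapEmbedding f).toEmbedding = T := by
        rw [← Set.image_univ] at hsub
        obtain ⟨T', h, h'⟩ := Finset.subset_set_image_iff.1 hsub
        exact ⟨T', h, by rw [Finset.map_eq_image]; exact h'⟩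
      exact ⟨⟨T', (isNested_map f hV hB).1 hT⟩, rfl⟩

theorem relabelIso_coe (f : α ↪ β) (hV : V' = V.map f) (hB : B' = Finset.map f '' B)
    (T : NestedSet V B) :
    (relabelIso f hV hB T).1 = T.1.map (Finset.mapEmbedding f).toEmbedding := rfl

theorem nestedTerm_relabelIso (f : α ↪ β) (hV : V' = V.map f) (hB : B' = Finset.map f '' B)
    (T : NestedSet V B) : nestedTerm (relabelIso f hV hB T) = nestedTerm T := by
  rw [nestedTerm, nestedTerm, relabelIso_coe, Finset.card_map,
    PosetAlgebra.cls_congr ((relabelIso f hV hB).iciCongr T)]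

theorem nestedInterior_relabel (f : α ↪ β) (hV : V' = V.map f) (hB : B' = Finset.map f '' B) :
    nestedInterior V' B' = nestedInterior V B := by
  rw [nestedInterior, nestedInterior, ← finsum_comp_equiv (relabelIso f hV hB).toEquiv]
  exact finsum_congr fun T => nestedTerm_relabelIso f hV hB T

theorem nestedInteriorOver_relabel (f : α ↪ β) (hV : V' = V.map f) (hB : B' = Finset.map f '' B)
    (R : Finset α) : nestedInteriorOver V' B' (R.map f) = nestedInteriorOver V B R := by
  have hiff : ∀ T : NestedSet V B, V \ T.1.sup id = R ↔
      V' \ (relabelIso f hV hB T).1.sup id = R.map f := fun T => by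
    rw [relabelIso_coe, sup_map_mapEmbedding, hV, ← Finset.map_sdiff, (Finset.map_injective f).eq_iff]
  rw [nestedInteriorOver, nestedInteriorOver,
    ← finsum_comp_equiv ((relabelIso f hV hB).toEquiv.subtypeEquiv hiff)]
  exact finsum_congr fun T => nestedTerm_relabelIso f hV hB T.1

end Relabel

/-! ### Faces of nestohedra -/

section Nestohedron

open Finset

variable {n : ℕ}

/-- The points of the nestohedron of the building set `B` at which the inequalities indexed by the
members of `T` are equalities. -/
def tightFace (B : Set (Finset (Fin n))) (T : Finset (Finset (Fin n))) : Set (Fin n → ℝ) :=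
  {x | ∑ i, x i = 3 ^ n ∧ (∀ S ∈ B, S ≠ univ → 3 ^ #S ≤ ∑ i ∈ S, x i) ∧
    ∀ S ∈ T, ∑ i ∈ S, x i = 3 ^ #S}

variable {B : Set (Finset (Fin n))} {T T' : Finset (Finset (Fin n))}

theorem tightFace_anti (h : T ⊆ T') : tightFace B T' ⊆ tightFace B T :=
  fun _ hx => ⟨hx.1, hx.2.1, fun S hS => hx.2.2 S (h hS)⟩

theorem nonneg_of_mem_tightFace (hs : ∀ i, {i} ∈ B) {x : Fin n → ℝ} (hx : x ∈ tightFace B T)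
    (i : Fin n) : 0 ≤ x i := by
  by_cases hi : ({i} : Finset (Fin n)) = univ
  · have h1 := hx.1
    rw [← hi, sum_singleton] at h1
    rw [h1]
    positivity
  · have := hx.2.1 {i} (hs i) hi
    rw [sum_singleton] at this
    exact le_trans (by positivity) this

/-- Strict superadditivity of the right-hand sides `3 ^ |S|` keeps disjoint tight sets from having
their union in the building set. -/
theorem pow_add_pow_lt_pow_add {a b : ℕ} (ha : 0 < a) (hb : 0 < b) :
    (3 : ℝ) ^ a + 3 ^ b < 3 ^ (a + b) := by
  have h1 : (3 : ℝ) ≤ 3 ^ a := le_self_pow₀ (by norm_num) ha.ne'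
  have h2 : (3 : ℝ) ≤ 3 ^ b := le_self_pow₀ (by norm_num) hb.ne'
  rw [pow_add]
  nlinarith

/-- If the coordinate sum over each member `S` of a laminar family is `3 ^ |S|`, then it is
smaller than this value over each union that is not a member. -/
theorem sup_mem_or_sum_lt (x : Fin n → ℝ) (T : Finset (Finset (Fin n))) (hne : T.Nonempty)
    (hlam : ∀ S ∈ T, ∀ S' ∈ T, S ⊆ S' ∨ S' ⊆ S ∨ Disjoint S S') (hS : ∀ S ∈ T, S.Nonempty)
    (hx : ∀ S ∈ T, ∑ i ∈ S, x i = 3 ^ #S) :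
    T.sup id ∈ T ∨ ∑ i ∈ T.sup id, x i < 3 ^ #(T.sup id) := by
  classical
  induction hk : #T using Nat.strong_induction_on generalizing T with
  | _ k ih =>
  -- Members not inside a member `S` of maximal size are disjoint from it. The union is then `S`
  -- together with the union of a smaller family, and superadditivity gives strictness unless that
  -- family is empty.
  obtain ⟨S, hST, hmax⟩ := exists_max_image T card hne
  let T₀ := T.filter fun S' => ¬ S' ⊆ S
  have hT₀ : ∀ S' ∈ T₀, S' ∈ T ∧ Disjoint S S' := by
    intro S' hS'
    rw [mem_filter] at hS'
    refine ⟨hS'.1, ?_⟩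
    rcases hlam S hST S' hS'.1 with h | h | h
    · exact absurd (eq_of_subset_of_card_le h (hmax S' hS'.1)).ge hS'.2
    · exact absurd h hS'.2
    · exact h
  have hsup : T.sup id = S ∪ T₀.sup id := by
    refine le_antisymm (Finset.sup_le fun S' hS' => ?_)
      (union_subset (le_sup (f := id) hST) (sup_mono (filter_subset _ _)))
    by_cases h : S' ⊆ S
    · exact h.trans subset_union_left
    · exact (le_sup (f := id) (mem_filter.2 ⟨hS', h⟩ : S' ∈ T₀)).trans subset_union_right
  rcases T₀.eq_empty_or_nonempty with h₀ | h₀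
  · rw [hsup, h₀]
    simp [hST]
  · right
    have hdisj : Disjoint S (T₀.sup id) :=
      Finset.disjoint_sup_right.2 fun S' hS' => (hT₀ S' hS').2
    have hcard : #T₀ < k := by
      rw [← hk]
      exact card_lt_card (filter_ssubset.2 ⟨S, hST, by simp⟩)
    have hb : ∑ i ∈ T₀.sup id, x i ≤ 3 ^ #(T₀.sup id) := by
      rcases ih _ hcard T₀ h₀ (fun S₁ h₁ S₂ h₂ => hlam S₁ (hT₀ S₁ h₁).1 S₂ (hT₀ S₂ h₂).1)
        (fun S₁ h₁ => hS S₁ (hT₀ S₁ h₁).1) (fun S₁ h₁ => hx S₁ (hT₀ S₁ h₁).1) rfl with h | h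
      · exact (hx _ (hT₀ _ h).1).le
      · exact h.le
    have hpos : 0 < #(T₀.sup id) := by
      obtain ⟨S', hS'⟩ := h₀
      exact card_pos.2 ((hS S' (hT₀ S' hS').1).mono (le_sup (f := id) hS'))
    rw [hsup, sum_union hdisj, card_union_of_disjoint hdisj, hx S hST]
    have := pow_add_pow_lt_pow_add (card_pos.2 (hS S hST)) hpos
    linarith

/-- The inequalities that are equalities at a point form a nested set. -/
theorem isNested_of_tight (hB : IsBuildingSet univ B) (hs : ∀ i, {i} ∈ B) {x : Fin n → ℝ}
    (hx : x ∈ tightFace B ∅)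
    (hT : ∀ S ∈ T, S ∈ B ∧ S ≠ univ ∧ ∑ i ∈ S, x i = 3 ^ #S) : IsNested univ B T where
  mem S hS := (hT S hS).1
  ne_top S hS := (hT S hS).2.1
  sup_mem T₀ h₀ hne hmem := by
    have hle : ∀ S ∈ B, (3 : ℝ) ^ #S ≤ ∑ i ∈ S, x i := fun S hS => by
      by_cases h : S = univ
      · rw [h, hx.1, card_univ, Fintype.card_fin]
      · exact hx.2.1 S hS h
    have hnn := nonneg_of_mem_tightFace hs hx
    refine (sup_mem_or_sum_lt x T₀ hne (fun S hS S' hS' => ?_)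
      (fun S hS => hB.nonempty S (hT S (h₀ hS)).1) fun S hS => (hT S (h₀ hS)).2.2).resolve_right
      (hle _ hmem).not_gt
    obtain ⟨hSB, -, hSx⟩ := hT S (h₀ hS)
    obtain ⟨hSB', -, hSx'⟩ := hT S' (h₀ hS')
    by_contra! hcon
    obtain ⟨h1, h2, h3⟩ := hcon
    rw [disjoint_iff_inter_eq_empty, ← ne_eq, ← nonempty_iff_ne_empty] at h3
    have hu := hle _ (hB.union_mem S hSB S' hSB' h3)
    have hsum := sum_union_inter (s₁ := S) (s₂ := S') (f := x)
    have hint : 0 ≤ ∑ i ∈ S ∩ S', x i := sum_nonneg fun i _ => hnn i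
    -- For crossing tight sets, each of the two sums is at most a third of `3 ^ #(S ∪ S')`, so
    -- together they cannot reach the lower bound for the union.
    have c1 : #S + 1 ≤ #(S ∪ S') := card_lt_card
      (subset_union_left.ssubset_of_ne fun h => h2 (h ▸ subset_union_right))
    have c2 : #S' + 1 ≤ #(S ∪ S') := card_lt_card
      (subset_union_right.ssubset_of_ne fun h => h1 (h ▸ subset_union_left))
    have p1 : (3 : ℝ) ^ (#S + 1) ≤ 3 ^ #(S ∪ S') := pow_le_pow_right₀ (by norm_num) c1
    have p2 : (3 : ℝ) ^ (#S' + 1) ≤ 3 ^ #(S ∪ S') := pow_le_pow_right₀ (by norm_num) c2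
    rw [pow_succ] at p1 p2
    have : (0 : ℝ) < 3 ^ #(S ∪ S') := by positivity
    linarith

/-! #### A point in the relative interior of a face -/

/-- The vector with prescribed sums `τ S` over the members `S` of a nested family, constant on the
elements `v` with the same smallest member `cell v` of the family containing `v`. -/
noncomputable def nestedPoint (cell : Fin n → Finset (Fin n)) (τ : Finset (Fin n) → ℝ)
    (v : Fin n) : ℝ :=
  -- Elements with smaller cells have their values already; what remains of `τ (cell v)` is shared
  -- equally among the others.
  (τ (cell v) - ∑ w ∈ ((cell v).filter fun w => #(cell w) < #(cell v)).attach,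
    nestedPoint cell τ w.1) / #((cell v).filter fun w => ¬ #(cell w) < #(cell v))
termination_by #(cell v)
decreasing_by exact (mem_filter.1 w.2).2

theorem nestedPoint_eq (cell : Fin n → Finset (Fin n)) (τ : Finset (Fin n) → ℝ) (v : Fin n) :
    nestedPoint cell τ v =
      (τ (cell v) - ∑ w ∈ (cell v).filter fun w => #(cell w) < #(cell v), nestedPoint cell τ w) /
        #((cell v).filter fun w => ¬ #(cell w) < #(cell v)) := by
  rw [nestedPoint, sum_attach _ (nestedPoint cell τ)]

theorem exists_smallest_superset (hB : IsBuildingSet univ B) (hT : IsNested univ B T)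
    {X : Finset (Fin n)} (hX : X.Nonempty) :
    ∃ S ∈ insert univ T, X ⊆ S ∧ ∀ S' ∈ insert univ T, X ⊆ S' → S ⊆ S' := by
  classical
  obtain ⟨S, hS, hmin⟩ := exists_min_image ((insert univ T).filter fun S => X ⊆ S) card
    ⟨univ, by simp⟩
  rw [mem_filter] at hS
  refine ⟨S, hS.1, hS.2, fun S' hS' hXS' => ?_⟩
  have hc := hmin S' (mem_filter.2 ⟨hS', hXS'⟩)
  rcases mem_insert.1 hS' with rfl | hS'
  · exact subset_univ _
  rcases mem_insert.1 hS.1 with rfl | hST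
  · exact (eq_of_subset_of_card_le (subset_univ S') hc).ge
  rcases hT.subset_or_subset_or_disjoint hB hST hS' with h | h | h
  · exact h
  · exact (eq_of_subset_of_card_le h hc).ge
  · obtain ⟨x, hx⟩ := hX
    exact absurd (hXS' hx) (disjoint_left.1 h (hS.2 hx))

/-- `cell v` is the smallest member of `T ∪ {univ}` containing `v`. -/
structure IsCellMap (T : Finset (Finset (Fin n))) (cell : Fin n → Finset (Fin n)) : Prop where
  mem : ∀ v, cell v ∈ insert univ T
  self_mem : ∀ v, v ∈ cell v
  subset : ∀ v, ∀ S ∈ insert univ T, v ∈ S → cell v ⊆ S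

theorem exists_isCellMap (hB : IsBuildingSet univ B) (hT : IsNested univ B T) :
    ∃ cell, IsCellMap T cell := by
  choose cell h1 h2 h3 using fun v : Fin n =>
    exists_smallest_superset hB hT (singleton_nonempty v)
  exact ⟨cell, h1, fun v => singleton_subset_iff.1 (h2 v),
    fun v S hS hv => h3 v S hS (singleton_subset_iff.2 hv)⟩

namespace IsCellMap

variable {cell : Fin n → Finset (Fin n)}

theorem filter_lt_eq_sup (hc : IsCellMap T cell) {S : Finset (Fin n)} (hS : S ∈ insert univ T) :
    (S.filter fun w => #(cell w) < #S) = (T.filter fun S' => S' ⊂ S).sup id := by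
  ext w
  simp only [mem_filter, mem_sup, id]
  constructor
  · rintro ⟨hw, hlt⟩
    refine ⟨cell w, ⟨(mem_insert.1 (hc.mem w)).resolve_left fun h => ?_,
      (hc.subset w S hS hw).ssubset_of_ne fun h => ?_⟩, hc.self_mem w⟩
    · rw [h] at hlt
      exact absurd (card_le_univ S) hlt.not_ge
    · rw [h] at hlt
      exact lt_irrefl _ hlt
  · rintro ⟨S', ⟨hS', hlt⟩, hw⟩
    exact ⟨hlt.1 hw, (card_le_card (hc.subset w S' (mem_insert_of_mem hS') hw)).trans_lt
      (card_lt_card hlt)⟩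

/-- Otherwise the members of `T` strictly inside `S` would cover `S`, and one of them would contain
it. This keeps the denominator in `nestedPoint` nonzero. -/
theorem filter_not_lt_nonempty (hB : IsBuildingSet univ B) (hT : IsNested univ B T)
    (hc : IsCellMap T cell) {S : Finset (Fin n)} (hS : S ∈ insert univ T) :
    (S.filter fun w => ¬ #(cell w) < #S).Nonempty := by
  by_contra h
  rw [not_nonempty_iff_eq_empty, filter_eq_empty_iff] at h
  have hsub : S ⊆ (T.filter fun S' => S' ⊂ S).sup id := by
    rw [← hc.filter_lt_eq_sup hS]
    exact fun w hw => mem_filter.2 ⟨hw, not_not.1 (h hw)⟩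
  have hSB : S ∈ B := by
    rcases mem_insert.1 hS with rfl | hS
    · exact hB.top_mem
    · exact hT.mem S hS
  obtain ⟨S', hS', hle⟩ := hB.exists_subset_of_subset_sup (hT.mono (filter_subset _ _)) hSB hsub
  exact (mem_filter.1 hS').2.2 hle

theorem cell_eq (hc : IsCellMap T cell) {S : Finset (Fin n)} (hS : S ∈ insert univ T)
    {w : Fin n} (hw : w ∈ S.filter fun w => ¬ #(cell w) < #S) : cell w = S :=
  eq_of_subset_of_card_le (hc.subset w S hS (mem_filter.1 hw).1) (not_lt.1 (mem_filter.1 hw).2)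

theorem sum_nestedPoint (hB : IsBuildingSet univ B) (hT : IsNested univ B T)
    (hc : IsCellMap T cell) (τ : Finset (Fin n) → ℝ) {S : Finset (Fin n)}
    (hS : S ∈ insert univ T) : ∑ i ∈ S, nestedPoint cell τ i = τ S := by
  have hne := card_pos.2 (hc.filter_not_lt_nonempty hB hT hS)
  have hne' : (#(S.filter fun w => ¬ #(cell w) < #S) : ℝ) ≠ 0 := by exact_mod_cast hne.ne'
  rw [← sum_filter_add_sum_filter_not S fun w => #(cell w) < #S,
    sum_congr (s₁ := S.filter fun w => ¬ #(cell w) < #S) rfl fun w hw => by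
      rw [nestedPoint_eq, hc.cell_eq hS hw],
    sum_const, nsmul_eq_mul, mul_div_cancel₀ _ hne', add_sub_cancel]

end IsCellMap

/-- Here s and p are the sizes of a cell `S` and of a set `S'` properly inside it; r elements of `S`
lie in no smaller cell, and a of these are in `S'`. Each of the r carries at least `(3 ^ s - 3 ^ (s
- r)) / r`, so the inequality says that the a of them alone exceed `3 ^ p`. -/
theorem mul_pow_lt_mul_pow_sub_pow {a r s p : ℕ} (ha : 0 < a) (har : a ≤ r) (hrs : r ≤ s)
    (hps : p < s) (h : p + r ≤ a + s) :
    (r : ℝ) * 3 ^ p < a * (3 ^ s - 3 ^ (s - r)) := by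
  obtain ⟨d, rfl⟩ := Nat.exists_eq_add_of_lt hps
  have hp : (0 : ℝ) < 3 ^ p := by positivity
  have hd : (1 + (d + 1 : ℕ) * 2 : ℝ) ≤ (1 + 2) ^ (d + 1) :=
    one_add_mul_le_pow (by norm_num) _
  norm_num at hd
  have ha' : (1 : ℝ) ≤ a := by exact_mod_cast ha
  have hr : (r : ℝ) ≤ a + (d + 1) := by exact_mod_cast (by omega : r ≤ a + (d + 1))
  have hd0 : (0 : ℝ) ≤ d := by positivity
  have hsplit : (3 : ℝ) ^ (p + d + 1) = 3 ^ p * 3 ^ (d + 1) := by rw [← pow_add, add_assoc]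
  rw [hsplit]
  generalize (3 : ℝ) ^ (d + 1) = q at *
  -- For r ≥ 2 the subtracted power is at most a ninth of `3 ^ s`; for r = 1 it is a third, and then
  -- a = 1.
  rcases Nat.lt_or_ge r 2 with hr2 | hr2
  · obtain rfl : r = 1 := by omega
    obtain rfl : a = 1 := by omega
    have h1 : (3 : ℝ) ^ (p + d) * 3 = 3 ^ p * q := by rw [← pow_succ, hsplit]
    have h2 : (3 : ℝ) ^ p * 3 ≤ 3 ^ p * q := by nlinarith
    simp only [Nat.add_sub_cancel, Nat.cast_one, one_mul]
    linarith
  · have h1 : (3 : ℝ) ^ (p + d + 1 - r) * 9 ≤ 3 ^ p * q := by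
      rw [← hsplit, show (9 : ℝ) = 3 ^ 2 by norm_num, ← pow_add]
      exact pow_le_pow_right₀ (by norm_num) (by omega)
    have h2 : (r : ℝ) * 9 < a * (8 * q) := by nlinarith
    have h3 : (r : ℝ) * 9 * 3 ^ p < a * (8 * q) * 3 ^ p := by nlinarith
    nlinarith

/-- The equalities valid on a face can be prescribed to be any nested set. -/
theorem exists_mem_tightFace_strict (hB : IsBuildingSet univ B) (hT : IsNested univ B T) :
    ∃ x ∈ tightFace B T, ∀ S ∈ B, S ≠ univ → S ∉ T → (3 : ℝ) ^ #S < ∑ i ∈ S, x i := by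
  classical
  obtain ⟨cell, hc⟩ := exists_isCellMap hB hT
  let x := nestedPoint cell fun S => 3 ^ #S
  have hx : ∀ S ∈ insert univ T, ∑ i ∈ S, x i = 3 ^ #S := fun S hS =>
    hc.sum_nestedPoint hB hT _ hS
  -- The smaller cells form the union of the members of `T` strictly inside `S`, to which
  -- `sup_mem_or_sum_lt` applies. This bounds from below what is left for the other elements of `S`.
  have hlow : ∀ S ∈ insert univ T, ∑ i ∈ S.filter fun w => #(cell w) < #S, x i ≤
      3 ^ #(S.filter fun w => #(cell w) < #S) := by
    intro S hS
    rw [hc.filter_lt_eq_sup hS]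
    rcases (T.filter fun S' => S' ⊂ S).eq_empty_or_nonempty with h | h
    · simp [h]
    · have hsub : ∀ S' ∈ T.filter fun S' => S' ⊂ S, S' ∈ T := fun S' hS' => (mem_filter.1 hS').1
      rcases sup_mem_or_sum_lt x _ h
        (fun S₁ h₁ S₂ h₂ => hT.subset_or_subset_or_disjoint hB (hsub _ h₁) (hsub _ h₂))
        (fun S₁ h₁ => hB.nonempty _ (hT.mem _ (hsub _ h₁)))
        (fun S₁ h₁ => hx _ (mem_insert_of_mem (hsub _ h₁))) with h' | h'
      · exact (hx _ (mem_insert_of_mem (hsub _ h'))).le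
      · exact h'.le
  have hval : ∀ S ∈ insert univ T, ∀ w ∈ S.filter fun w => ¬ #(cell w) < #S,
      (3 ^ #S - 3 ^ (#S - #(S.filter fun w => ¬ #(cell w) < #S))) /
        #(S.filter fun w => ¬ #(cell w) < #S) ≤ x w := by
    intro S hS w hw
    have h1 := hlow S hS
    have h2 := card_filter_add_card_filter_not (s := S) (fun w => #(cell w) < #S)
    rw [show x w = _ from nestedPoint_eq _ _ _, hc.cell_eq hS hw]
    have h3 : #S - #(S.filter fun w => ¬ #(cell w) < #S) =
      #(S.filter fun w => #(cell w) < #S) := by omega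
    rw [h3]
    gcongr
  have hnn : ∀ v, 0 ≤ x v := by
    intro v
    refine le_trans ?_ (hval (cell v) (hc.mem v) v (mem_filter.2 ⟨hc.self_mem v, lt_irrefl _⟩))
    refine div_nonneg (sub_nonneg.2 (pow_le_pow_right₀ (by norm_num) (Nat.sub_le _ _)))
      (Nat.cast_nonneg _)
  have hstrict : ∀ S ∈ B, S ≠ univ → S ∉ T → (3 : ℝ) ^ #S < ∑ i ∈ S, x i := by
    intro S' hS'B hS' hS'T
    obtain ⟨S, hS, hsub, hmin⟩ := exists_smallest_superset hB hT (hB.nonempty S' hS'B)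
    have hne : S' ≠ S := by
      rintro rfl
      rcases mem_insert.1 hS with h | h
      · exact hS' h
      · exact hS'T h
    have hlt : #S' < #S := card_lt_card (hsub.ssubset_of_ne hne)
    -- `A` and `Q` are the elements of `S'` and `S` whose cell is `S`. If `A` were empty, a member
    -- of `T` strictly inside `S` would contain `S'`, against the minimality of `S`.
    set A := S'.filter fun w => ¬ #(cell w) < #S with hA
    set Q := S.filter fun w => ¬ #(cell w) < #S with hQ
    have hAQ : A ⊆ Q := filter_subset_filter _ hsub
    have hAne : A.Nonempty := by
      by_contra h
      rw [not_nonempty_iff_eq_empty, hA, filter_eq_empty_iff] at h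
      have hsub' : S' ⊆ (T.filter fun S' => S' ⊂ S).sup id := by
        rw [← hc.filter_lt_eq_sup hS]
        exact fun w hw => mem_filter.2 ⟨hsub hw, not_not.1 (h hw)⟩
      obtain ⟨S'', hS'', hle⟩ :=
        hB.exists_subset_of_subset_sup (hT.mono (filter_subset _ _)) hS'B hsub'
      rw [mem_filter] at hS''
      exact hS''.2.2 (hmin S'' (mem_insert_of_mem hS''.1) hle)
    have hQne := hAne.mono hAQ
    have hcard : #S' + #Q ≤ #A + #S := by
      have h1 := card_filter_add_card_filter_not (s := S) (fun w => #(cell w) < #S)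
      have h2 := card_filter_add_card_filter_not (s := S') (fun w => #(cell w) < #S)
      have h3 := card_le_card (filter_subset_filter (fun w => #(cell w) < #S) hsub)
      rw [← hQ] at h1
      rw [← hA] at h2
      omega
    have hnum := mul_pow_lt_mul_pow_sub_pow (card_pos.2 hAne) (card_le_card hAQ)
      (card_le_card (filter_subset _ _)) hlt hcard
    have hQpos : (0 : ℝ) < #Q := by exact_mod_cast card_pos.2 hQne
    calc (3 : ℝ) ^ #S' < #A * ((3 ^ #S - 3 ^ (#S - #Q)) / #Q) := by
          rw [← mul_div_assoc, lt_div_iff₀ hQpos, mul_comm]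
          exact hnum
      _ ≤ ∑ i ∈ A, x i := by
          rw [← nsmul_eq_mul]
          exact card_nsmul_le_sum _ _ _ fun w hw => hval S hS w (hAQ hw)
      _ ≤ ∑ i ∈ S', x i :=
          sum_le_sum_of_subset_of_nonneg (filter_subset _ _) fun i _ _ => hnn i
  refine ⟨x, ⟨?_, fun S hSB hS => ?_, fun S hS => hx S (mem_insert_of_mem hS)⟩, hstrict⟩
  · rw [hx univ (mem_insert_self _ _), card_univ, Fintype.card_fin]
  · by_cases h : S ∈ T
    · exact (hx S (mem_insert_of_mem h)).ge
    · exact (hstrict S hSB hS h).le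

/-! #### The face poset and the dimensions of the faces -/

/-- Finitely many strict inequalities survive a small move, and the equalities are not affected by
`v`. -/
theorem exists_add_smul_mem_tightFace {w v : Fin n → ℝ} (hw : w ∈ tightFace B T)
    (hstrict : ∀ S ∈ B, S ≠ univ → S ∉ T → (3 : ℝ) ^ #S < ∑ i ∈ S, w i)
    (hv : ∑ i, v i = 0) (hvT : ∀ S ∈ T, ∑ i ∈ S, v i = 0) :
    ∃ e : ℝ, 0 < e ∧ w + e • v ∈ tightFace B T := by
  have hsum : ∀ (S : Finset (Fin n)) (e : ℝ),
      ∑ i ∈ S, (w + e • v) i = ∑ i ∈ S, w i + e * ∑ i ∈ S, v i := fun S e => by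
    simp [sum_add_distrib, mul_sum]
  have hev : ∀ᶠ e in nhds (0 : ℝ), ∀ S : Finset (Fin n), S ∈ B → S ≠ univ → S ∉ T →
      (3 : ℝ) ^ #S < ∑ i ∈ S, w i + e * ∑ i ∈ S, v i := by
    refine Filter.eventually_all.2 fun S => ?_
    by_cases h : S ∈ B ∧ S ≠ univ ∧ S ∉ T
    · have hcont : ContinuousAt (fun e : ℝ => ∑ i ∈ S, w i + e * ∑ i ∈ S, v i) 0 := by fun_prop
      have := hcont.eventually (lt_mem_nhds (a := (3 : ℝ) ^ #S)
        (by simpa using hstrict S h.1 h.2.1 h.2.2))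
      exact this.mono fun e he _ _ _ => he
    · exact Filter.Eventually.of_forall fun e h1 h2 h3 => absurd ⟨h1, h2, h3⟩ h
  obtain ⟨e, he, he0⟩ := ((hev.filter_mono nhdsWithin_le_nhds).and
    (self_mem_nhdsWithin : Set.Ioi (0 : ℝ) ∈ nhdsWithin 0 (Set.Ioi 0))).exists
  refine ⟨e, he0, ?_, fun S hS hS' => ?_, fun S hS => ?_⟩
  · rw [hsum, hv, mul_zero, add_zero]
    exact hw.1
  · rw [hsum]
    by_cases h : S ∈ T
    · rw [hvT S h, mul_zero, add_zero]
      exact hw.2.1 S hS hS'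
    · exact (he S hS hS' h).le
  · rw [hsum, hvT S hS, mul_zero, add_zero]
    exact hw.2.2 S hS

theorem convex_tightFace : Convex ℝ (tightFace B T) := by
  intro x hx y hy a b ha hb hab
  have hsum : ∀ S : Finset (Fin n), ∑ i ∈ S, (a • x + b • y) i =
      a * ∑ i ∈ S, x i + b * ∑ i ∈ S, y i := fun S => by
    simp [sum_add_distrib, mul_sum]
  refine ⟨?_, fun S hS hS' => ?_, fun S hS => ?_⟩
  · rw [hsum, hx.1, hy.1, ← add_mul, hab, one_mul]
  · have h1 := mul_le_mul_of_nonneg_left (hx.2.1 S hS hS') ha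
    have h2 := mul_le_mul_of_nonneg_left (hy.2.1 S hS hS') hb
    have h3 : a * (3 : ℝ) ^ #S + b * 3 ^ #S = 3 ^ #S := by rw [← add_mul, hab, one_mul]
    rw [hsum]
    linarith
  · rw [hsum, hx.2.2 S hS, hy.2.2 S hS, ← add_mul, hab, one_mul]

/-- A face is determined by the inequalities that are equalities on it. -/
theorem eq_tightFace_of_isExposed {F : Set (Fin n → ℝ)} (hne : F.Nonempty)
    (hF : IsExposed ℝ (tightFace B T) F) (hTT' : T ⊆ T')
    (hT' : ∀ S, S ∈ T' ↔ S ∈ B ∧ S ≠ univ ∧ ∀ x ∈ F, ∑ i ∈ S, x i = 3 ^ #S) :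
    F = tightFace B T' := by
  classical
  have hconv : Convex ℝ F := hF.convex convex_tightFace
  have hsubT' : F ⊆ tightFace B T' := fun x hx =>
    ⟨(hF.subset hx).1, (hF.subset hx).2.1, fun S hS => ((hT' S).1 hS).2.2 x hx⟩
  -- Averaging with a point at which one more inequality is strict yields a relatively interior
  -- point of `F`.
  have hrel : ∀ U : Finset (Finset (Fin n)), ∃ w ∈ F, ∀ S ∈ U, S ∈ B → S ≠ univ → S ∉ T' →
      (3 : ℝ) ^ #S < ∑ i ∈ S, w i := by
    intro U
    induction U using Finset.induction_on with
    | empty =>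
      obtain ⟨z, hz⟩ := hne
      exact ⟨z, hz, by simp⟩
    | insert S U _ ih =>
      obtain ⟨w, hw, hwU⟩ := ih
      by_cases hS : S ∈ B ∧ S ≠ univ ∧ S ∉ T'
      · obtain ⟨v, hv, hvne⟩ : ∃ v ∈ F, ∑ i ∈ S, v i ≠ 3 ^ #S := by
          by_contra! hcon
          exact hS.2.2 ((hT' S).2 ⟨hS.1, hS.2.1, hcon⟩)
        refine ⟨(1 / 2 : ℝ) • w + (1 / 2 : ℝ) • v,
          hconv hw hv (by norm_num) (by norm_num) (by norm_num), fun R hR hRB hRu hRT => ?_⟩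
        have h1 := (hF.subset hw).2.1 R hRB hRu
        have h2 := (hF.subset hv).2.1 R hRB hRu
        have hsum : ∑ i ∈ R, ((1 / 2 : ℝ) • w + (1 / 2 : ℝ) • v) i =
            1 / 2 * ∑ i ∈ R, w i + 1 / 2 * ∑ i ∈ R, v i := by
          simp [sum_add_distrib, mul_sum]
        rw [hsum]
        rcases mem_insert.1 hR with rfl | hR
        · have := lt_of_le_of_ne h2 (Ne.symm hvne)
          linarith
        · have := hwU R hR hRB hRu hRT
          linarith
      · refine ⟨w, hw, fun R hR hRB hRu hRT => ?_⟩
        rcases mem_insert.1 hR with rfl | hR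
        · exact absurd ⟨hRB, hRu, hRT⟩ hS
        · exact hwU R hR hRB hRu hRT
  obtain ⟨w, hw, hwlt⟩ := hrel univ
  refine hsubT'.antisymm fun y hy => ?_
  have hwT' := hsubT' hw
  -- Moving from `w` away from `y` cannot increase the exposing functional, so its value at `y` is
  -- at least the maximum attained at `w`.
  obtain ⟨e, he, hmove⟩ := exists_add_smul_mem_tightFace (v := w - y) hwT'
    (fun S => hwlt S (mem_univ S)) (by simp [hwT'.1, hy.1])
    (fun S hS => by simp [hwT'.2.2 S hS, hy.2.2 S hS])
  obtain ⟨l, hl⟩ := hF hne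
  rw [hl] at hw ⊢
  refine ⟨tightFace_anti hTT' hy, fun z hz => (hw.2 z hz).trans ?_⟩
  have h := hw.2 _ (tightFace_anti hTT' hmove)
  simp only [map_add, map_smul, map_sub, smul_eq_mul] at h
  nlinarith

/-- The sum of the functionals of `T'` is minimal exactly where each of them attains its lower
bound; nonemptiness of the face guarantees that this happens simultaneously. -/
theorem isExposed_tightFace (h : T ⊆ T') (hT' : ∀ S ∈ T', S ∈ B ∧ S ≠ univ) :
    IsExposed ℝ (tightFace B T) (tightFace B T') := by
  rintro ⟨z, hz⟩
  let l : StrongDual ℝ (Fin n → ℝ) :=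
    -∑ S ∈ T', ∑ i ∈ S, (ContinuousLinearMap.proj i : StrongDual ℝ (Fin n → ℝ))
  have hl : ∀ x, l x = -∑ S ∈ T', ∑ i ∈ S, x i := fun x => by
    simp [l]
  refine ⟨l, ?_⟩
  ext x
  constructor
  · intro hx
    refine ⟨tightFace_anti h hx, fun y hy => ?_⟩
    rw [hl, hl, neg_le_neg_iff]
    refine sum_le_sum fun S hS => ?_
    rw [hx.2.2 S hS]
    exact hy.2.1 S (hT' S hS).1 (hT' S hS).2
  · rintro ⟨hx, hmax⟩
    have := hmax z (tightFace_anti h hz)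
    rw [hl, hl, neg_le_neg_iff, sum_congr rfl hz.2.2] at this
    have hle : ∀ S ∈ T', (3 : ℝ) ^ #S ≤ ∑ i ∈ S, x i := fun S hS =>
      hx.2.1 S (hT' S hS).1 (hT' S hS).2
    refine ⟨hx.1, hx.2.1, fun S hS => ?_⟩
    exact ((sum_eq_sum_iff_of_le hle).1 (this.antisymm' (sum_le_sum hle)) S hS).symm

/-- The poset of faces of a face of a nestohedron is dual to the poset of nested sets containing
a given one. -/
noncomputable def faceIso (hB : IsBuildingSet univ B) (hs : ∀ i, {i} ∈ B) (T : NestedSet univ B)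
    {X : Set (Fin n → ℝ)} (hX : X = tightFace B T.1) :
    (Set.Ici T)ᵒᵈ ≃o {F : Set (Fin n → ℝ) // F.Nonempty ∧ IsExposed ℝ X F} :=
  RelIso.ofSurjective
    (OrderEmbedding.ofMapLEIff
      (fun T' : (Set.Ici T)ᵒᵈ =>
        (⟨tightFace B (OrderDual.ofDual T').1.1,
          by
            obtain ⟨x, hx, -⟩ := exists_mem_tightFace_strict hB (OrderDual.ofDual T').1.2
            exact ⟨x, hx⟩,
          by
            rw [hX]
            exact isExposed_tightFace (OrderDual.ofDual T').2
              fun S hS => ⟨(OrderDual.ofDual T').1.2.mem S hS,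
                (OrderDual.ofDual T').1.2.ne_top S hS⟩⟩ :
          {F : Set (Fin n → ℝ) // F.Nonempty ∧ IsExposed ℝ X F}))
      fun T₁ T₂ => by
        constructor
        · intro h S hS
          obtain ⟨x, hx, hstrict⟩ := exists_mem_tightFace_strict hB (OrderDual.ofDual T₁).1.2
          by_contra hS'
          have hx2 := (h hx).2.2 S hS
          have := hstrict S ((OrderDual.ofDual T₂).1.2.mem S hS)
            ((OrderDual.ofDual T₂).1.2.ne_top S hS) hS'
          exact this.ne' hx2
        · intro h
          exact tightFace_anti h)
    fun F => by
      classical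
      obtain ⟨F, hne, hF⟩ := F
      rw [hX] at hF
      let T' : Finset (Finset (Fin n)) :=
        univ.filter fun S => S ∈ B ∧ S ≠ univ ∧ ∀ x ∈ F, ∑ i ∈ S, x i = 3 ^ #S
      have hT' : ∀ S, S ∈ T' ↔ S ∈ B ∧ S ≠ univ ∧ ∀ x ∈ F, ∑ i ∈ S, x i = 3 ^ #S := by
        simp [T']
      have hTT' : T.1 ⊆ T' := fun S hS => (hT' S).2
        ⟨T.2.mem S hS, T.2.ne_top S hS, fun x hx => (hF.subset hx).2.2 S hS⟩
      obtain ⟨z, hz⟩ := hne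
      have hnest : IsNested univ B T' := isNested_of_tight hB hs
        (tightFace_anti (empty_subset _) (hF.subset hz)) fun S hS =>
          ⟨((hT' S).1 hS).1, ((hT' S).1 hS).2.1, ((hT' S).1 hS).2.2 z hz⟩
      exact ⟨OrderDual.toDual ⟨⟨T', hnest⟩, hTT'⟩,
        Subtype.ext (eq_tightFace_of_isExposed ⟨z, hz⟩ hF hTT' hT').symm⟩

/-- The coordinate sums over `univ` and the members of `T` are independent, because `nestedPoint`
realises arbitrary values. Their common kernel is the direction of the face, since a small move from
a strict point along the kernel stays in it. Each member of `T` thus costs one dimension. -/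
theorem finrank_vectorSpan_tightFace (hB : IsBuildingSet univ B) (hT : IsNested univ B T) :
    Module.finrank ℝ (vectorSpan ℝ (tightFace B T)) + (#T + 1) = n := by
  classical
  let Ψ : (Fin n → ℝ) →ₗ[ℝ] (↥(insert univ T) → ℝ) :=
    LinearMap.pi fun S : ↥(insert univ T) =>
      ∑ i ∈ S.1, (LinearMap.proj i : (Fin n → ℝ) →ₗ[ℝ] ℝ)
  have hΨ : ∀ v S, Ψ v S = ∑ i ∈ S.1, v i := fun v S => by simp [Ψ]
  have hker : ∀ v, v ∈ LinearMap.ker Ψ ↔ ∀ S ∈ insert univ T, ∑ i ∈ S, v i = 0 := fun v => by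
    rw [LinearMap.mem_ker, funext_iff]
    simp only [hΨ, Pi.zero_apply, Subtype.forall]
  have hsurj : LinearMap.range Ψ = ⊤ := by
    rw [LinearMap.range_eq_top]
    intro y
    obtain ⟨cell, hc⟩ := exists_isCellMap hB hT
    refine ⟨nestedPoint cell fun S => if h : S ∈ insert univ T then y ⟨S, h⟩ else 0, ?_⟩
    ext S
    rw [hΨ, hc.sum_nestedPoint hB hT _ S.2, dif_pos S.2]
  have hspan : vectorSpan ℝ (tightFace B T) = LinearMap.ker Ψ := by
    apply le_antisymm
    · rw [vectorSpan_def, Submodule.span_le]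
      rintro _ ⟨x, hx, y, hy, rfl⟩
      refine (hker _).2 fun S hS => ?_
      rcases mem_insert.1 hS with rfl | hS
      · simp [hx.1, hy.1]
      · simp [hx.2.2 S hS, hy.2.2 S hS]
    · intro v hv
      rw [hker] at hv
      obtain ⟨w, hw, hstrict⟩ := exists_mem_tightFace_strict hB hT
      obtain ⟨e, he, hmove⟩ := exists_add_smul_mem_tightFace hw hstrict
        (hv univ (mem_insert_self _ _)) (fun S hS => hv S (mem_insert_of_mem hS))
      have := vsub_mem_vectorSpan ℝ hmove hw
      rw [vsub_eq_sub, add_sub_cancel_left] at this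
      exact (Submodule.smul_mem_iff _ he.ne').1 this
  have hrank := Ψ.finrank_range_add_finrank_ker
  have huniv : univ ∉ T := fun h => hT.ne_top _ h rfl
  rw [hsurj, finrank_top, Module.finrank_fintype_fun_eq_card, Fintype.card_coe,
    card_insert_of_notMem huniv, Module.finrank_fintype_fun_eq_card, Fintype.card_fin] at hrank
  rw [hspan]
  omega

end Nestohedron

/-! ### Graph-associahedra -/

section Graph

open Finset

variable {n : ℕ}

/-- The building set of a graph: the vertex sets with connected induced subgraphs. -/
def graphBuilding (Γ : SimpleGraph (Fin n)) : Set (Finset (Fin n)) :=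
  {S | (Γ.induce (S : Set (Fin n))).Connected}

theorem isBuildingSet_graphBuilding {Γ : SimpleGraph (Fin n)} (hΓ : Γ.Connected) :
    IsBuildingSet univ (graphBuilding Γ) where
  subset S _ := subset_univ S
  nonempty S hS := by
    obtain ⟨⟨i, hi⟩⟩ := hS.nonempty
    exact ⟨i, hi⟩
  top_mem := by
    rw [graphBuilding, Set.mem_ofPred_eq, coe_univ]
    exact (SimpleGraph.Iso.connected_iff (SimpleGraph.induceUnivIso Γ)).2 hΓ
  union_mem S hS S' hS' h := by
    rw [graphBuilding, Set.mem_ofPred_eq, coe_union]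
    refine SimpleGraph.induce_union_connected hS.preconnected hS'.preconnected ?_
    rw [← coe_inter]
    exact_mod_cast h

theorem singleton_mem_graphBuilding (Γ : SimpleGraph (Fin n)) (i : Fin n) :
    {i} ∈ graphBuilding Γ := by
  rw [graphBuilding, Set.mem_ofPred_eq, coe_singleton]
  exact ⟨fun a b => by rw [Subsingleton.elim a b]⟩

variable {Γ : SimpleGraph (Fin n)} (hΓ : Γ.Connected)

namespace ConvexPolytope

theorem carrier_graphAssociahedron :
    (graphAssociahedron Γ hΓ).carrier = tightFace (graphBuilding Γ) ∅ := by
  ext x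
  simp [graphAssociahedron, tightFace, graphBuilding]

/-- The faces of a graph-associahedron correspond to the nested sets of its graph. -/
noncomputable def graphAssociahedronFaceIso :
    (NestedSet univ (graphBuilding Γ))ᵒᵈ ≃o (graphAssociahedron Γ hΓ).Face :=
  OrderIso.trans (β := (Set.Ici (⟨∅, IsNested.empty⟩ : NestedSet univ (graphBuilding Γ)))ᵒᵈ)
    (OrderIso.dual
      { toFun := fun T => ⟨T, empty_subset _⟩
        invFun := fun T => T.1
        left_inv := fun _ => rfl
        right_inv := fun _ => rfl
        map_rel_iff' := Iff.rfl })
    (faceIso (isBuildingSet_graphBuilding hΓ) (singleton_mem_graphBuilding Γ)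
      ⟨∅, IsNested.empty⟩ (carrier_graphAssociahedron hΓ))

theorem codim_graphAssociahedronFaceIso (T : (NestedSet univ (graphBuilding Γ))ᵒᵈ) :
    (graphAssociahedronFaceIso hΓ T).codim = #(OrderDual.ofDual T).1 := by
  have h1 := finrank_vectorSpan_tightFace (isBuildingSet_graphBuilding hΓ)
    (OrderDual.ofDual T).2
  have h2 := finrank_vectorSpan_tightFace (isBuildingSet_graphBuilding hΓ)
    (IsNested.empty (V := univ) (B := graphBuilding Γ))
  have h3 : (graphAssociahedron Γ hΓ).dim =
      Module.finrank ℝ (vectorSpan ℝ (tightFace (graphBuilding Γ) ∅)) := by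
    rw [← carrier_graphAssociahedron hΓ]
    rfl
  have h4 : (graphAssociahedronFaceIso hΓ T).toPolytope.dim =
      Module.finrank ℝ (vectorSpan ℝ (tightFace (graphBuilding Γ) (OrderDual.ofDual T).1)) := rfl
  rw [Face.codim, h3, h4]
  rw [card_empty] at h2
  omega

open RatPolytopeAlgebra in
theorem toPosetAlgebra_graphAssociahedron :
    toPosetAlgebra (PolytopeRing.toRat (graphAssociahedron Γ hΓ).toRing) =
      PosetAlgebra.cls (NestedSet univ (graphBuilding Γ)) := by
  rw [toPosetAlgebra_toRing]
  exact PosetAlgebra.cls_congr (graphAssociahedronFaceIso hΓ).symm.dual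

open RatPolytopeAlgebra in
/-- The motivic interior of a graph-associahedron, in terms of nested sets. -/
theorem toPosetAlgebra_motivicInterior :
    toPosetAlgebra (PolytopeRing.toRat (graphAssociahedron Γ hΓ).motivicInterior) =
      nestedInterior univ (graphBuilding Γ) := by
  have := (isBuildingSet_graphBuilding hΓ).finite_nestedSet
  have := Fintype.ofFinite (NestedSet univ (graphBuilding Γ))
  rw [motivicInterior, nestedInterior, finsum_eq_sum_of_fintype, map_sum, map_sum]
  refine (Fintype.sum_equiv (OrderDual.toDual.trans (graphAssociahedronFaceIso hΓ).toEquiv)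
    _ _ fun T => ?_).symm
  change _ = toPosetAlgebra (PolytopeRing.toRat
    ((-1) ^ (graphAssociahedronFaceIso hΓ (OrderDual.toDual T)).codim *
      (graphAssociahedronFaceIso hΓ (OrderDual.toDual T)).toPolytope.toRing))
  rw [codim_graphAssociahedronFaceIso, map_mul, map_mul, toPosetAlgebra_toRing, nestedTerm]
  congr 1
  · simp
  · exact PosetAlgebra.cls_congr (faceIso (isBuildingSet_graphBuilding hΓ)
      (singleton_mem_graphBuilding Γ) T rfl).symm.dual.symm

end ConvexPolytope

end Graph

/-! ### Intervals and arcs of finite linear orders -/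

section Intervals

variable {α β : Type} [LinearOrder α] [LinearOrder β]

/-- `S` contains the elements of `V` that lie between two elements of `S`. -/
def OrdConvexIn (V S : Finset α) : Prop :=
  ∀ a ∈ S, ∀ c ∈ S, ∀ b ∈ V, a < b → b < c → b ∈ S

/-- The nonempty intervals of `V`. -/
def intervalsOf (V : Finset α) : Set (Finset α) :=
  {S | S.Nonempty ∧ S ⊆ V ∧ OrdConvexIn V S}

/-- The nonempty arcs of the cyclically ordered set `V`. -/
def arcsOf (V : Finset α) : Set (Finset α) :=
  {S | S.Nonempty ∧ S ⊆ V ∧ (OrdConvexIn V S ∨ OrdConvexIn V (V \ S))}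

variable {V S S' C : Finset α}

theorem OrdConvexIn.inter (h : OrdConvexIn V S) (h' : OrdConvexIn V S') :
    OrdConvexIn V (S ∩ S') := fun a ha c hc b hb hab hbc => by
  rw [Finset.mem_inter] at *
  exact ⟨h a ha.1 c hc.1 b hb hab hbc, h' a ha.2 c hc.2 b hb hab hbc⟩

theorem OrdConvexIn.union (h : OrdConvexIn V S)
    (h' : OrdConvexIn V S') (hne : (S ∩ S').Nonempty) : OrdConvexIn V (S ∪ S') := by
  obtain ⟨x, hx⟩ := hne
  rw [Finset.mem_inter] at hx
  intro a ha c hc b hb hab hbc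
  rw [Finset.mem_union] at *
  rcases lt_trichotomy b x with hbx | rfl | hbx
  · rcases ha with ha | ha
    · exact Or.inl (h a ha x hx.1 b hb hab hbx)
    · exact Or.inr (h' a ha x hx.2 b hb hab hbx)
  · exact Or.inl hx.1
  · rcases hc with hc | hc
    · exact Or.inl (h x hx.1 c hc b hb hbx hbc)
    · exact Or.inr (h' x hx.2 c hc b hb hbx hbc)

/-- A point of `S'` outside `S` lies to one side of `S`, so `S'` can cut off only an end of `S` and
not a middle piece. -/
theorem OrdConvexIn.sdiff (hS : S ⊆ V) (hS' : S' ⊆ V) (h : OrdConvexIn V S)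
    (h' : OrdConvexIn V S') (hne : ¬ S' ⊆ S) : OrdConvexIn V (S \ S') := by
  obtain ⟨x, hx', hx⟩ := Finset.not_subset.1 hne
  intro a ha c hc b hb hab hbc
  rw [Finset.mem_sdiff] at *
  refine ⟨h a ha.1 c hc.1 b hb hab hbc, fun hbS' => ?_⟩
  rcases lt_trichotomy x a with hxa | rfl | hxa
  · exact ha.2 (h' x hx' b hbS' a (hS ha.1) hxa hab)
  · exact hx ha.1
  · have hcx : c ≤ x := not_lt.1 fun hxc => hx (h a ha.1 c hc.1 x (hS' hx') hxa hxc)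
    rcases hcx.eq_or_lt with rfl | hcx
    · exact hx hc.1
    · exact hc.2 (h' b hbS' x hx' c (hS hc.1) hbc hcx)

theorem ordConvexIn_self : OrdConvexIn V V := fun _ _ _ _ _ hb _ _ => hb

theorem OrdConvexIn.sdiff_sdiff (h : OrdConvexIn V S) : OrdConvexIn (V \ C) (S \ C) :=
  fun a ha c hc b hb hab hbc => by
    rw [Finset.mem_sdiff] at *
    exact ⟨h a ha.1 c hc.1 b hb.1 hab hbc, hb.2⟩

/-- The interval of `V` spanned by `U`. -/
def intervalHull (V U : Finset α) : Finset α :=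
  V.filter fun v => (∃ a ∈ U, a ≤ v) ∧ ∃ c ∈ U, v ≤ c

theorem ordConvexIn_intervalHull (V U : Finset α) : OrdConvexIn V (intervalHull V U) := by
  intro a ha c hc b hb hab hbc
  rw [intervalHull, Finset.mem_filter] at *
  obtain ⟨-, ⟨a', ha', h1⟩, -⟩ := ha
  obtain ⟨-, -, c', hc', h2⟩ := hc
  exact ⟨hb, ⟨a', ha', h1.trans hab.le⟩, c', hc', hbc.le.trans h2⟩

theorem intervalHull_sdiff {U : Finset α} (hU : U ⊆ V \ C) (h : OrdConvexIn (V \ C) U) :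
    intervalHull V U \ C = U := by
  ext v
  rw [Finset.mem_sdiff, intervalHull, Finset.mem_filter]
  constructor
  · rintro ⟨⟨hv, ⟨a, ha, hav⟩, c, hc, hvc⟩, hvC⟩
    rcases hav.eq_or_lt with rfl | hav
    · exact ha
    rcases hvc.eq_or_lt with rfl | hvc
    · exact hc
    exact h a ha c hc v (Finset.mem_sdiff.2 ⟨hv, hvC⟩) hav hvc
  · intro hv
    have := Finset.mem_sdiff.1 (hU hv)
    exact ⟨⟨this.1, ⟨v, hv, le_rfl⟩, v, hv, le_rfl⟩, this.2⟩

theorem isBuildingSet_intervalsOf (hV : V.Nonempty) : IsBuildingSet V (intervalsOf V) where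
  subset _ hS := hS.2.1
  nonempty _ hS := hS.1
  top_mem := ⟨hV, subset_rfl, ordConvexIn_self⟩
  union_mem _ hS _ hS' h := ⟨hS.1.mono Finset.subset_union_left,
    Finset.union_subset hS.2.1 hS'.2.1, hS.2.2.union hS'.2.2 h⟩

theorem isBuildingSet_arcsOf (hV : V.Nonempty) : IsBuildingSet V (arcsOf V) where
  subset _ hS := hS.2.1
  nonempty _ hS := hS.1
  top_mem := ⟨hV, subset_rfl, Or.inl ordConvexIn_self⟩
  union_mem S hS S' hS' h := by
    refine ⟨hS.1.mono Finset.subset_union_left, Finset.union_subset hS.2.1 hS'.2.1, ?_⟩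
    -- In the mixed case the complement of the union is the interval `V \ S'` minus the interval
    -- `S`, which reaches outside it.
    have hsplit : ∀ S S' : Finset α, S ⊆ V → (S ∩ S').Nonempty → OrdConvexIn V S →
        OrdConvexIn V (V \ S') → OrdConvexIn V (V \ (S ∪ S')) := by
      intro S S' hSV hne h1 h2
      have : V \ (S ∪ S') = (V \ S') \ S := by
        ext v
        simp only [Finset.mem_sdiff, Finset.mem_union]
        tauto
      rw [this]
      refine h2.sdiff Finset.sdiff_subset hSV h1 fun hsub => ?_
      obtain ⟨x, hx⟩ := hne
      rw [Finset.mem_inter] at hx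
      exact (Finset.mem_sdiff.1 (hsub hx.1)).2 hx.2
    rcases hS.2.2 with h1 | h1 <;> rcases hS'.2.2 with h2 | h2
    · exact Or.inl (h1.union h2 h)
    · exact Or.inr (hsplit S S' hS.2.1 h h1 h2)
    · right
      rw [Finset.union_comm]
      exact hsplit S' S hS'.2.1 (by rwa [Finset.inter_comm]) h2 h1
    · right
      rw [Finset.sdiff_union_distrib]
      exact h1.inter h2

/-- An interval of `V \ C` is the trace of the interval it spans in `V`. Contracting a path thus
gives a path again. -/
theorem contractBy_intervalsOf (V C : Finset α) :
    contractBy (intervalsOf V) C = intervalsOf (V \ C) := by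
  ext U
  constructor
  · rintro ⟨S, hS, hSC, rfl⟩
    exact ⟨Finset.sdiff_nonempty.2 hSC, Finset.sdiff_subset_sdiff hS.2.1 subset_rfl,
      hS.2.2.sdiff_sdiff⟩
  · rintro ⟨hne, hU, hconv⟩
    have heq := intervalHull_sdiff hU hconv
    have hne' : (intervalHull V U \ C).Nonempty := by rwa [heq]
    exact ⟨intervalHull V U, ⟨hne'.mono Finset.sdiff_subset, Finset.filter_subset _ _,
      ordConvexIn_intervalHull V U⟩, Finset.sdiff_nonempty.1 hne', heq⟩

theorem contractBy_arcsOf (V C : Finset α) :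
    contractBy (arcsOf V) C = arcsOf (V \ C) := by
  ext U
  constructor
  · rintro ⟨S, hS, hSC, rfl⟩
    refine ⟨Finset.sdiff_nonempty.2 hSC, Finset.sdiff_subset_sdiff hS.2.1 subset_rfl, ?_⟩
    rcases hS.2.2 with h | h
    · exact Or.inl h.sdiff_sdiff
    · right
      have : (V \ C) \ (S \ C) = (V \ S) \ C := by
        ext v
        simp only [Finset.mem_sdiff]
        tauto
      rw [this]
      exact h.sdiff_sdiff
  · rintro ⟨hne, hU, hconv | hconv⟩
    · have heq := intervalHull_sdiff hU hconv
      have hne' : (intervalHull V U \ C).Nonempty := by rwa [heq]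
      exact ⟨intervalHull V U, ⟨hne'.mono Finset.sdiff_subset, Finset.filter_subset _ _,
        Or.inl (ordConvexIn_intervalHull V U)⟩, Finset.sdiff_nonempty.1 hne', heq⟩
    -- Here the complement of `U` in `V \ C` is an interval; the complement in `V` of its hull is an
    -- arc with trace `U`.
    · set K := intervalHull V ((V \ C) \ U) with hK
      have hK1 : K \ C = (V \ C) \ U := intervalHull_sdiff Finset.sdiff_subset hconv
      have hKV : K ⊆ V := Finset.filter_subset _ _
      have heq : (V \ K) \ C = U := by
        ext v
        have h1 := Finset.ext_iff.1 hK1 v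
        have h2 := @hU v
        simp only [Finset.mem_sdiff] at h1 h2 ⊢
        tauto
      have hne' : ((V \ K) \ C).Nonempty := by rwa [heq]
      refine ⟨V \ K, ⟨hne'.mono Finset.sdiff_subset, Finset.sdiff_subset, Or.inr ?_⟩,
        Finset.sdiff_nonempty.1 hne', heq⟩
      rw [Finset.sdiff_sdiff_eq_self hKV]
      exact ordConvexIn_intervalHull V _

theorem restrictTo_intervalsOf (hC : C ∈ intervalsOf V) :
    restrictTo (intervalsOf V) C = intervalsOf C := by
  ext S
  constructor
  · rintro ⟨⟨hne, -, h⟩, hSC⟩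
    exact ⟨hne, hSC, fun a ha c hc b hb => h a ha c hc b (hC.2.1 hb)⟩
  · rintro ⟨hne, hSC, h⟩
    exact ⟨⟨hne, hSC.trans hC.2.1, fun a ha c hc b hb hab hbc =>
      h a ha c hc b (hC.2.2 a (hSC ha) c (hSC hc) b hb hab hbc) hab hbc⟩, hSC⟩

theorem intervalsOf_subset_arcsOf : intervalsOf V ⊆ arcsOf V :=
  fun _ h => ⟨h.1, h.2.1, Or.inl h.2.2⟩

/-- An arc avoiding the greatest element is an interval. -/
theorem mem_intervalsOf_of_mem_arcsOf {r : α} (hr : r ∈ V) (hmax : ∀ v ∈ V, v ≤ r)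
    (hS : S ∈ arcsOf V) (hrS : r ∉ S) : S ∈ intervalsOf V := by
  obtain ⟨hne, hSV, h | h⟩ := hS
  · exact ⟨hne, hSV, h⟩
  · refine ⟨hne, hSV, fun a ha c hc b hb hab hbc => ?_⟩
    by_contra hbS
    have hcr : c < r := (hmax c (hSV hc)).lt_of_ne fun hh => hrS (hh ▸ hc)
    have := h b (Finset.mem_sdiff.2 ⟨hb, hbS⟩) r (Finset.mem_sdiff.2 ⟨hr, hrS⟩) c (hSV hc) hbc hcr
    exact (Finset.mem_sdiff.1 this).2 hc

theorem ordConvexIn_map (f : α ↪o β) :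
    OrdConvexIn (V.map f.toEmbedding) (S.map f.toEmbedding) ↔ OrdConvexIn V S := by
  simp only [OrdConvexIn, Finset.mem_map, forall_exists_index, and_imp, forall_apply_eq_imp_iff₂,
    RelEmbedding.coe_toEmbedding, OrderEmbedding.lt_iff_lt, EmbeddingLike.apply_eq_iff_eq,
    exists_eq_right]

theorem intervalsOf_map (f : α ↪o β) (V : Finset α) :
    intervalsOf (V.map f.toEmbedding) = Finset.map f.toEmbedding '' intervalsOf V := by
  ext S
  constructor
  · rintro ⟨hne, hS, h⟩
    obtain ⟨S, hSV, rfl⟩ := Finset.subset_map_iff.1 hS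
    exact ⟨S, ⟨Finset.map_nonempty.1 hne, hSV, (ordConvexIn_map f).1 h⟩, rfl⟩
  · rintro ⟨S, ⟨hne, hSV, h⟩, rfl⟩
    exact ⟨hne.map, Finset.map_subset_map.2 hSV, (ordConvexIn_map f).2 h⟩

theorem arcsOf_map (f : α ↪o β) (V : Finset α) :
    arcsOf (V.map f.toEmbedding) = Finset.map f.toEmbedding '' arcsOf V := by
  ext S
  constructor
  · rintro ⟨hne, hS, h⟩
    obtain ⟨S, hSV, rfl⟩ := Finset.subset_map_iff.1 hS
    rw [← Finset.map_sdiff, ordConvexIn_map, ordConvexIn_map] at h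
    exact ⟨S, ⟨Finset.map_nonempty.1 hne, hSV, h⟩, rfl⟩
  · rintro ⟨S, ⟨hne, hSV, h⟩, rfl⟩
    refine ⟨hne.map, Finset.map_subset_map.2 hSV, ?_⟩
    rwa [← Finset.map_sdiff, ordConvexIn_map, ordConvexIn_map]

end Intervals

/-! ### Connected sets of vertices of paths and cycles -/

section PathCycle

open SimpleGraph

theorem SimpleGraph.Reachable.of_invariant {V : Type*} {G : SimpleGraph V} (p : V → Prop)
    (hp : ∀ u v, G.Adj u v → p u → p v) {u v : V} (h : G.Reachable u v) (hu : p u) : p v := by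
  obtain ⟨w⟩ := h
  induction w with
  | nil => exact hu
  | cons hadj _ ih => exact ih (hp _ _ hadj hu)

variable {n : ℕ}

theorem reachable_of_interval_subset {Γ : SimpleGraph (Fin n)} (hΓ : pathGraph n ≤ Γ)
    {S : Finset (Fin n)} (k : ℕ) (a b : Fin n) (hab : b.val = a.val + k)
    (hS : ∀ z, a ≤ z → z ≤ b → z ∈ S) (ha : a ∈ S) (hb : b ∈ S) :
    (Γ.induce (S : Set (Fin n))).Reachable ⟨a, ha⟩ ⟨b, hb⟩ := by
  induction k generalizing b with
  | zero =>
    obtain rfl : b = a := Fin.ext hab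
    exact Reachable.refl _
  | succ k ih =>
    have hlt : a.val + k < n := by omega
    have hb' : (⟨a.val + k, hlt⟩ : Fin n) ∈ S := hS _ (Fin.le_def.2 (Nat.le_add_right _ _))
      (Fin.le_def.2 (by change a.val + k ≤ b.val; omega))
    refine (ih ⟨a.val + k, hlt⟩ rfl (fun z h1 h2 => hS z h1 (h2.trans ?_)) hb').trans
      (Adj.reachable ?_)
    · exact Fin.le_def.2 (by change a.val + k ≤ b.val; omega)
    · exact hΓ (pathGraph_adj.2 (Or.inl (by change a.val + k + 1 = b.val; omega)))

theorem reachable_of_interval_subset' {Γ : SimpleGraph (Fin n)} (hΓ : pathGraph n ≤ Γ)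
    {S : Finset (Fin n)} {a b : Fin n} (hab : a ≤ b)
    (hS : ∀ z, a ≤ z → z ≤ b → z ∈ S) (ha : a ∈ S) (hb : b ∈ S) :
    (Γ.induce (S : Set (Fin n))).Reachable ⟨a, ha⟩ ⟨b, hb⟩ :=
  reachable_of_interval_subset hΓ (b.val - a.val) a b
    (by rw [Fin.le_def] at hab; omega) hS ha hb

theorem connected_of_ordConvexIn {Γ : SimpleGraph (Fin n)} (hΓ : pathGraph n ≤ Γ)
    {S : Finset (Fin n)} (hne : S.Nonempty) (hS : OrdConvexIn Finset.univ S) :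
    (Γ.induce (S : Set (Fin n))).Connected := by
  obtain ⟨x, hx⟩ := hne
  have hle : ∀ a b, a ≤ b → ∀ (ha : a ∈ S) (hb : b ∈ S),
      (Γ.induce (S : Set (Fin n))).Reachable ⟨a, ha⟩ ⟨b, hb⟩ := by
    intro a b hab ha hb
    refine reachable_of_interval_subset' hΓ hab (fun z h1 h2 => ?_) ha hb
    rcases h1.eq_or_lt with rfl | h1
    · exact ha
    rcases h2.eq_or_lt with rfl | h2
    · exact hb
    exact hS a ha b hb z (Finset.mem_univ z) h1 h2
  have : Nonempty (S : Set (Fin n)) := ⟨⟨x, hx⟩⟩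
  refine ⟨fun ⟨a, ha⟩ ⟨b, hb⟩ => ?_⟩
  rcases le_total a b with h | h
  · exact hle a b h ha hb
  · exact (hle b a h hb ha).symm

theorem graphBuilding_pathGraph (n : ℕ) :
    graphBuilding (pathGraph n) = intervalsOf (Finset.univ : Finset (Fin n)) := by
  ext S
  constructor
  · intro hS
    have hne : S.Nonempty := by
      obtain ⟨⟨x, hx⟩⟩ := hS.nonempty
      exact ⟨x, hx⟩
    refine ⟨hne, Finset.subset_univ S, fun a ha c hc b _ hab hbc => ?_⟩
    by_contra hbS
    have := (hS.preconnected ⟨a, ha⟩ ⟨c, hc⟩).of_invariant (fun u => u.1 < b) (fun u v huv hu => by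
      have hvb : v.1 ≠ b := fun h => hbS (h ▸ v.2)
      have hadj : (pathGraph n).Adj u.1 v.1 := huv
      rw [pathGraph_adj] at hadj
      rw [Fin.lt_def] at hu ⊢
      rw [Ne, Fin.ext_iff] at hvb
      omega) hab
    exact lt_asymm this hbc
  · rintro ⟨hne, -, h⟩
    exact connected_of_ordConvexIn le_rfl hne h

theorem cycleGraph_adj_cases {u v : Fin (n + 1)} (h : (cycleGraph (n + 1)).Adj u v) :
    u.val + 1 = v.val ∨ v.val + 1 = u.val ∨ (u.val = 0 ∧ v.val = n) ∨
      (u.val = n ∧ v.val = 0) := by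
  rw [cycleGraph_adj', Fin.val_sub, Fin.val_sub] at h
  have hu := u.2
  have hv := v.2
  have key : ∀ x y : ℕ, x < n + 1 → y < n + 1 → (n + 1 - y + x) % (n + 1) = 1 →
      y + 1 = x ∨ (x = 0 ∧ y = n) := by
    intro x y hx hy hxy
    rcases le_or_gt y x with hle | hlt
    · rw [show n + 1 - y + x = x - y + (n + 1) by omega, Nat.add_mod_right,
        Nat.mod_eq_of_lt (by omega)] at hxy
      omega
    · rw [Nat.mod_eq_of_lt (by omega)] at hxy
      omega
  rcases h with h | h
  · rcases key _ _ hu hv h with h | h <;> omega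
  · rcases key _ _ hv hu h with h | h <;> omega

theorem cycleGraph_adj_zero_last (hn : n ≠ 0) :
    (cycleGraph (n + 1)).Adj 0 (Fin.last n) := by
  rw [cycleGraph_adj', Fin.val_sub, Fin.val_sub]
  left
  rw [Fin.val_last, Fin.val_zero, show n + 1 - n + 0 = 1 by omega]
  exact Nat.mod_eq_of_lt (by omega)

theorem graphBuilding_cycleGraph (n : ℕ) :
    graphBuilding (cycleGraph (n + 1)) = arcsOf (Finset.univ : Finset (Fin (n + 1))) := by
  ext S
  constructor
  · intro hS
    have hne : S.Nonempty := by
      obtain ⟨⟨x, hx⟩⟩ := hS.nonempty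
      exact ⟨x, hx⟩
    -- Two missing vertices separate the cycle: the edge between `0` and the last vertex does not
    -- touch the part strictly between them.
    have hcut : ∀ p q : Fin (n + 1), p ∉ S → q ∉ S → ∀ x ∈ S, ∀ y ∈ S, p < x → x < q →
        p < y ∧ y < q := by
      intro p q hp hq x hx y hy hpx hxq
      refine (hS.preconnected ⟨x, hx⟩ ⟨y, hy⟩).of_invariant (fun u => p < u.1 ∧ u.1 < q)
        (fun u v huv hu => ?_) ⟨hpx, hxq⟩
      have hvp : v.1 ≠ p := fun h => hp (h ▸ v.2)
      have hvq : v.1 ≠ q := fun h => hq (h ▸ v.2)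
      have hadj : (cycleGraph (n + 1)).Adj u.1 v.1 := huv
      have := cycleGraph_adj_cases hadj
      rw [Fin.lt_def, Fin.lt_def] at hu ⊢
      rw [Ne, Fin.ext_iff] at hvp hvq
      omega
    refine ⟨hne, Finset.subset_univ S, ?_⟩
    by_contra! hcon
    obtain ⟨h1, h2⟩ := hcon
    simp only [OrdConvexIn, not_forall] at h1 h2
    obtain ⟨a, ha, c, hc, b, -, hab, hbc, hb⟩ := h1
    obtain ⟨d, hd, f, hf, e, -, hde, hef, he⟩ := h2
    simp only [Finset.mem_sdiff, Finset.mem_univ, true_and, not_not] at hd hf he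
    rcases lt_trichotomy d a with hda | rfl | had
    · exact lt_asymm (hcut d b hd hb a ha c hc hda hab).2 hbc
    · exact hd ha
    · exact lt_asymm (hcut d f hd hf e he a ha hde hef).1 had
  · rintro ⟨hne, -, h | h⟩
    · exact connected_of_ordConvexIn pathGraph_le_cycleGraph hne h
    · obtain ⟨x₀, hx₀⟩ := hne
      have : Nonempty (S : Set (Fin (n + 1))) := ⟨⟨x₀, hx₀⟩⟩
      -- A missing vertex on each side of `x` would put `x` in the convex complement. So every
      -- vertex of `S` is joined to an end of the path, and the wrapping edge joins the ends.
      have hend : ∀ x ∈ S, (∀ z, z ≤ x → z ∈ S) ∨ ∀ z, x ≤ z → z ∈ S := by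
        intro x hx
        by_contra! hcon
        obtain ⟨⟨b, hb, hbS⟩, d, hd, hdS⟩ := hcon
        have hbx : b < x := hb.lt_of_ne fun h => hbS (h ▸ hx)
        have hxd : x < d := hd.lt_of_ne fun h => hdS (h ▸ hx)
        have := h b (by simpa using hbS) d (by simpa using hdS) x (Finset.mem_univ x) hbx hxd
        exact (Finset.mem_sdiff.1 this).2 hx
      have hwrap : ∀ (h0 : 0 ∈ S) (hl : Fin.last n ∈ S),
          ((cycleGraph (n + 1)).induce (S : Set (Fin (n + 1)))).Reachable
            ⟨0, h0⟩ ⟨Fin.last n, hl⟩ := by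
        intro h0 hl
        by_cases hn : n = 0
        · subst hn
          exact Reachable.refl _
        · exact Adj.reachable (cycleGraph_adj_zero_last hn)
      have hdown : ∀ (x) (hx : x ∈ S) (hz : ∀ z, z ≤ x → z ∈ S),
          ((cycleGraph (n + 1)).induce (S : Set (Fin (n + 1)))).Reachable
            ⟨0, hz 0 (Fin.zero_le x)⟩ ⟨x, hx⟩ := fun x hx hz =>
        reachable_of_interval_subset' pathGraph_le_cycleGraph (Fin.zero_le x)
          (fun z _ h2 => hz z h2) _ hx
      have hup : ∀ (x) (hx : x ∈ S) (hz : ∀ z, x ≤ z → z ∈ S),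
          ((cycleGraph (n + 1)).induce (S : Set (Fin (n + 1)))).Reachable
            ⟨x, hx⟩ ⟨Fin.last n, hz _ (Fin.le_last x)⟩ := fun x hx hz =>
        reachable_of_interval_subset' pathGraph_le_cycleGraph (Fin.le_last x)
          (fun z h1 _ => hz z h1) hx _
      refine ⟨fun ⟨x, hx⟩ ⟨y, hy⟩ => ?_⟩
      rcases hend x hx with h1 | h1 <;> rcases hend y hy with h2 | h2
      · exact (hdown x hx h1).symm.trans (hdown y hy h2)
      · exact (hdown x hx h1).symm.trans ((hwrap _ _).trans (hup y hy h2).symm)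
      · exact (hup x hx h1).trans ((hwrap _ _).symm.trans (hdown y hy h2))
      · exact (hup x hx h1).trans (hup y hy h2).symm

/-- The connected sets of vertices of a cycle are invariant under rotation. -/
theorem graphBuilding_cycleGraph_rotate (n : ℕ) (r : Fin (n + 1)) :
    graphBuilding (cycleGraph (n + 1)) =
      Finset.map (Equiv.addRight r).toEmbedding '' graphBuilding (cycleGraph (n + 1)) := by
  have hmap : ∀ (r : Fin (n + 1)), ∀ S ∈ graphBuilding (cycleGraph (n + 1)),
      S.map (Equiv.addRight r).toEmbedding ∈ graphBuilding (cycleGraph (n + 1)) := by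
    intro r S hS
    refine Connected.map (G := (cycleGraph (n + 1)).induce (S : Set (Fin (n + 1))))
      ⟨fun x => ⟨x.1 + r, by simp⟩, fun {x y} hxy => ?_⟩ ?_ hS
    · have hadj : (cycleGraph (n + 1)).Adj x.1 y.1 := hxy
      change (cycleGraph (n + 1)).Adj (x.1 + r) (y.1 + r)
      rw [cycleGraph_adj'] at hadj ⊢
      simpa using hadj
    · rintro ⟨y, hy⟩
      rw [Finset.mem_coe, Finset.mem_map] at hy
      obtain ⟨x, hx, rfl⟩ := hy
      exact ⟨⟨x, hx⟩, rfl⟩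
  ext S
  constructor
  · intro hS
    refine ⟨_, hmap (-r) S hS, ?_⟩
    rw [Finset.map_map]
    convert Finset.map_refl
    ext x
    simp
  · rintro ⟨S, hS, rfl⟩
    exact hmap r S hS

end PathCycle

/-! ### Sums over the uncovered sets -/

section GapSums

open Finset

/-- The motivic interior of the poset of nested sets of a path. -/
noncomputable def intervalInterior (m : ℕ) : PosetAlgebra :=
  nestedInterior univ (intervalsOf (univ : Finset (Fin m)))

/-- The class of the poset of nested sets of a path. -/
noncomputable def intervalClass (m : ℕ) : PosetAlgebra :=
  PosetAlgebra.cls (NestedSet univ (intervalsOf (univ : Finset (Fin m))))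

/-- The class of the poset of nested sets of a cycle. -/
noncomputable def arcClass (m : ℕ) : PosetAlgebra :=
  PosetAlgebra.cls (NestedSet univ (arcsOf (univ : Finset (Fin m))))

theorem nestedInterior_intervalsOf {V : Finset ℕ} {m : ℕ} (h : #V = m) :
    nestedInterior V (intervalsOf V) = intervalInterior m :=
  nestedInterior_relabel (V.orderEmbOfFin h).toEmbedding (map_orderEmbOfFin_univ V h).symm (by
    rw [← intervalsOf_map, map_orderEmbOfFin_univ])

theorem cls_intervalsOf {V : Finset ℕ} {m : ℕ} (h : #V = m) :
    PosetAlgebra.cls (NestedSet V (intervalsOf V)) = intervalClass m :=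
  (PosetAlgebra.cls_congr (relabelIso (V.orderEmbOfFin h).toEmbedding (map_orderEmbOfFin_univ V h).symm (by
    rw [← intervalsOf_map, map_orderEmbOfFin_univ]))).symm

theorem cls_arcsOf {V : Finset ℕ} {m : ℕ} (h : #V = m) :
    PosetAlgebra.cls (NestedSet V (arcsOf V)) = arcClass m :=
  (PosetAlgebra.cls_congr (relabelIso (V.orderEmbOfFin h).toEmbedding (map_orderEmbOfFin_univ V h).symm (by
    rw [← arcsOf_map, map_orderEmbOfFin_univ]))).symm

theorem intervalClass_zero : intervalClass 0 = 1 := by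
  have : Unique (NestedSet univ (intervalsOf (univ : Finset (Fin 0)))) :=
    { default := ⟨∅, IsNested.empty⟩
      uniq := fun T => Subtype.ext <| eq_empty_of_forall_notMem fun S hS => by
        obtain ⟨x, -⟩ := (T.2.mem S hS).1
        exact x.elim0 }
  exact PosetAlgebra.cls_eq_one _

/-- The generating series of the contributions of the gaps between uncovered elements. -/
noncomputable def gapSeries : PowerSeries PosetAlgebra :=
  PowerSeries.mk fun
    -- The exponent is the length of the gap plus one, the extra unit standing for an uncovered
    -- vertex next to it. Exponent 1 is the empty gap, which contributes 1.
    | 0 => 0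
    | 1 => 1
    | m + 2 => -intervalInterior (m + 1)

theorem coeff_gapSeries_zero : PowerSeries.coeff 0 gapSeries = 0 := by
  rw [gapSeries, PowerSeries.coeff_mk]

theorem coeff_gapSeries_one : PowerSeries.coeff 1 gapSeries = 1 := by
  rw [gapSeries, PowerSeries.coeff_mk]

theorem coeff_gapSeries (m : ℕ) :
    PowerSeries.coeff (m + 2) gapSeries = -intervalInterior (m + 1) := by
  rw [gapSeries, PowerSeries.coeff_mk]

theorem coeff_zero_gapSeries_pow (k : ℕ) : PowerSeries.coeff 0 (gapSeries ^ (k + 1)) = 0 := by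
  rw [PowerSeries.coeff_zero_eq_constantCoeff_apply, map_pow,
    ← PowerSeries.coeff_zero_eq_constantCoeff_apply, coeff_gapSeries_zero, zero_pow k.succ_ne_zero]

/-- A family of building sets on finite sets of natural numbers that is compatible with
contractions, and in which the members avoiding a final segment containing `J₀` are intervals. -/
structure IsGapFamily (𝓑 : Finset ℕ → Set (Finset ℕ)) (w : ℕ → PosetAlgebra)
    (J₀ : Finset ℕ) : Prop where
  isBuildingSet : ∀ V, V.Nonempty → IsBuildingSet V (𝓑 V)
  contractBy : ∀ V C, contractBy (𝓑 V) C = 𝓑 (V \ C)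
  intervalsOf_subset : ∀ V, intervalsOf V ⊆ 𝓑 V
  cls_eq : ∀ V : Finset ℕ, PosetAlgebra.cls (NestedSet V (𝓑 V)) = w #V
  mem_intervalsOf : ∀ m J, J₀ ⊆ J → (∀ j ∈ J, m ≤ j) → ∀ S ∈ 𝓑 (range m ∪ J), Disjoint S J →
    S ∈ intervalsOf (range m ∪ J)

variable {𝓑 : Finset ℕ → Set (Finset ℕ)} {w : ℕ → PosetAlgebra} {J₀ : Finset ℕ}

/-- Contracting the last gap below `J`. -/
theorem IsGapFamily.nestedInteriorOver_eq (h𝓑 : IsGapFamily 𝓑 w J₀) {m t : ℕ} (htm : t ≤ m)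
    {J R : Finset ℕ} (hJ₀ : J₀ ⊆ J) (hJ : ∀ j ∈ J, m ≤ j) (hR : R ⊆ range t ∪ J) (hJR : J ⊆ R)
    (hne : R.Nonempty) (ht : t = 0 ∨ t - 1 ∈ R) :
    nestedInteriorOver (range m ∪ J) (𝓑 (range m ∪ J)) R =
      PowerSeries.coeff (m - t + 1) gapSeries *
        nestedInteriorOver (range t ∪ J) (𝓑 (range t ∪ J)) R := by
  -- For `t = m` the gap is empty and nothing is contracted; otherwise the gap `Ico t m` is split
  -- off.
  rcases htm.eq_or_lt with rfl | htm
  · rw [Nat.sub_self, zero_add, coeff_gapSeries_one, one_mul]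
  have hCR : Disjoint (Ico t m) R := by
    rw [disjoint_left]
    intro x hx hxR
    rw [mem_Ico] at hx
    rcases mem_union.1 (hR hxR) with h | h
    · exact absurd (mem_range.1 h) (by omega)
    · exact absurd (hJ x h) (by omega)
  have hV : R ⊆ range m ∪ J :=
    hR.trans (union_subset_union_left (range_subset_range.2 htm.le))
  have hC : Ico t m ∈ intervalsOf (range m ∪ J) := by
    refine ⟨⟨t, by simp [htm]⟩, fun x hx => ?_, fun a ha c hc b _ hab hbc => ?_⟩
    · rw [mem_Ico] at hx
      exact mem_union_left _ (mem_range.2 hx.2)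
    · rw [mem_Ico] at *
      omega
  have hsdiff : (range m ∪ J) \ Ico t m = range t ∪ J := by
    ext x
    have := hJ x
    simp only [mem_sdiff, mem_union, mem_range, mem_Ico]
    by_cases hx : x ∈ J
    · simp only [hx, or_true, true_and, iff_true]
      have := this hx
      omega
    · simp only [hx, or_false]
      omega
  have hVne : (range m ∪ J).Nonempty := hne.mono hV
  rw [nestedInteriorOver_eq_mul (h𝓑.isBuildingSet _ hVne) (h𝓑.intervalsOf_subset _ hC) ?_ hCR ?_ ?_,
    h𝓑.contractBy, hsdiff]
  · have hres : restrictTo (𝓑 (range m ∪ J)) (Ico t m) = intervalsOf (Ico t m) := by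
      rw [← restrictTo_intervalsOf hC]
      ext S
      exact ⟨fun h => ⟨h𝓑.mem_intervalsOf m J hJ₀ hJ S h.1 ((hCR.mono_left h.2).mono_right hJR), h.2⟩,
        fun h => ⟨h𝓑.intervalsOf_subset _ h.1, h.2⟩⟩
    obtain ⟨d, rfl⟩ := Nat.exists_eq_add_of_lt htm
    rw [hres, nestedInterior_intervalsOf (m := d + 1) (by simp; omega),
      show t + d + 1 - t + 1 = d + 2 by omega, coeff_gapSeries]
  · rintro heq
    obtain ⟨x, hx⟩ := hne
    exact disjoint_right.1 hCR hx (heq ▸ hV hx)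
  -- The gap is maximal: it is bounded above by `J` or the end of the ground set, and below by the
  -- uncovered `t - 1` or the start.
  · intro S hS hCS hSR
    have hSi := h𝓑.mem_intervalsOf m J hJ₀ hJ S hS (hSR.mono_right hJR)
    refine (hCS.antisymm fun x hx => ?_).symm
    have hxm : x < m := by
      rcases mem_union.1 (hSi.2.1 hx) with h | h
      · exact mem_range.1 h
      · exact absurd (hJR h) (disjoint_left.1 hSR hx)
    rw [mem_Ico]
    refine ⟨?_, hxm⟩
    by_contra! hxt
    have htR : t - 1 ∈ R := ht.resolve_left (by omega)
    refine disjoint_right.1 hSR htR ?_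
    rcases (show x ≤ t - 1 by omega).eq_or_lt with h | h
    · exact h ▸ hx
    · exact hSi.2.2 x hx t (hCS (by simp [htm])) (t - 1)
        (mem_union_left _ (mem_range.2 (by omega))) h (by omega)
  · rw [h𝓑.contractBy, hsdiff]
    exact h𝓑.isBuildingSet _ (hne.mono hR)

/-- The subsets are sorted by their largest element `r`. -/
theorem sum_powersetCard_range {M : Type*} [AddCommMonoid M] (F : Finset ℕ → M) (k m : ℕ) :
    ∑ R ∈ powersetCard (k + 1) (range m), F R =
      ∑ r ∈ range m, ∑ R ∈ powersetCard k (range r), F (insert r R) := by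
  induction m with
  | zero => rw [range_zero, powersetCard_eq_empty.2 (by simp), sum_empty, sum_empty]
  | succ m ih =>
    rw [sum_range_succ, ← ih, range_add_one, powersetCard_succ_insert (by simp), sum_union]
    · rw [sum_image]
      intro R hR R' hR' h
      have hm : ∀ R ∈ powersetCard k (range m), m ∉ R := fun R hR hmR =>
        absurd ((mem_powersetCard.1 hR).1 hmR) (by simp)
      rw [← erase_insert (hm R hR), h, erase_insert (hm R' hR')]
    · rw [disjoint_left]
      intro R hR hR'
      obtain ⟨R', -, rfl⟩ := mem_image.1 hR'
      exact absurd ((mem_powersetCard.1 hR).1 (mem_insert_self m R')) (by simp)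

/-- The nested sets with `k` uncovered elements below `J`, in terms of the powers of the gap
series. -/
theorem IsGapFamily.sum_nestedInteriorOver (h𝓑 : IsGapFamily 𝓑 w J₀) (k m : ℕ) (J : Finset ℕ)
    (hJ₀ : J₀ ⊆ J) (hJ : ∀ j ∈ J, m ≤ j) (hk : 0 < k + #J) :
    ∑ R ∈ powersetCard k (range m),
        nestedInteriorOver (range m ∪ J) (𝓑 (range m ∪ J)) (R ∪ J) =
      PowerSeries.coeff (m + 1) (gapSeries ^ (k + 1)) * w (k + #J) := by
  induction k generalizing m J with
  | zero =>
    have hJne : J.Nonempty := card_pos.1 (by omega)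
    rw [powersetCard_zero, sum_singleton, empty_union,
      h𝓑.nestedInteriorOver_eq (Nat.zero_le m) hJ₀ hJ subset_union_right subset_rfl hJne
        (Or.inl rfl), range_zero, empty_union, nestedInteriorOver_self (h𝓑.isBuildingSet J hJne),
      h𝓑.cls_eq, Nat.sub_zero, zero_add, zero_add, pow_one]
  | succ k ih =>
    rw [sum_powersetCard_range]
    -- With `r` the largest uncovered element below `J`, the gap above it has m - r - 1 elements.
    -- Once it is split off, `r` joins `J` and the induction hypothesis applies below `r`.
    have hstep : ∀ r ∈ range m, ∑ R ∈ powersetCard k (range r),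
        nestedInteriorOver (range m ∪ J) (𝓑 (range m ∪ J)) (insert r R ∪ J) =
        PowerSeries.coeff (r + 1) (gapSeries ^ (k + 1)) * PowerSeries.coeff (m - r) gapSeries *
          w (k + 1 + #J) := by
      intro r hr
      rw [mem_range] at hr
      have hrJ : r ∉ J := fun h => absurd (hJ r h) (by omega)
      have h1 : range (r + 1) ∪ J = range r ∪ insert r J := by
        rw [range_add_one, insert_union, union_insert]
      have h2 := ih r (insert r J) (hJ₀.trans (subset_insert _ _)) (fun j hj => by
        rcases mem_insert.1 hj with rfl | hj
        · exact le_rfl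
        · exact hr.le.trans (hJ j hj)) (by rw [card_insert_of_notMem hrJ]; omega)
      rw [card_insert_of_notMem hrJ, ← h1, show k + (#J + 1) = k + 1 + #J by omega] at h2
      rw [mul_comm (PowerSeries.coeff (r + 1) _), mul_assoc, ← h2, mul_sum]
      refine sum_congr rfl fun R hR => ?_
      rw [mem_powersetCard] at hR
      rw [h𝓑.nestedInteriorOver_eq (t := r + 1) hr hJ₀ hJ ?_ subset_union_right ⟨r, by simp⟩
        (Or.inr (by simp)), insert_union, union_insert, show m - (r + 1) + 1 = m - r by omega]
      refine union_subset_union_left (insert_subset (by simp) (hR.1.trans ?_))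
      exact range_subset_range.2 (Nat.le_succ r)
    -- The sum over `r` is the convolution for one more factor; its two extreme terms vanish because
    -- the gap series has no constant term.
    rw [sum_congr rfl hstep, ← sum_mul, pow_succ gapSeries (k + 1), PowerSeries.coeff_mul,
      Nat.sum_antidiagonal_eq_sum_range_succ_mk, sum_range_succ', sum_range_succ]
    simp only [Nat.sub_self, Nat.add_sub_add_right, coeff_gapSeries_zero, mul_zero, add_zero,
      coeff_zero_gapSeries_pow, zero_mul]

theorem isGapFamily_intervalsOf : IsGapFamily intervalsOf intervalClass ∅ where
  isBuildingSet _ hV := isBuildingSet_intervalsOf hV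
  contractBy := contractBy_intervalsOf
  intervalsOf_subset _ := subset_rfl
  cls_eq _ := cls_intervalsOf rfl
  mem_intervalsOf _ _ _ _ _ hS _ := hS

/-- A nonempty `J` contains the greatest element of the ground set, and an arc avoiding that element
does not wrap around. -/
theorem isGapFamily_arcsOf (r : ℕ) : IsGapFamily arcsOf arcClass {r} where
  isBuildingSet _ hV := isBuildingSet_arcsOf hV
  contractBy := contractBy_arcsOf
  intervalsOf_subset _ := intervalsOf_subset_arcsOf
  cls_eq _ := cls_arcsOf rfl
  mem_intervalsOf m J hJ₀ hJ S hS hSJ := by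
    have hne : J.Nonempty := ⟨r, hJ₀ (mem_singleton_self r)⟩
    have hmem := J.max'_mem hne
    refine mem_intervalsOf_of_mem_arcsOf (mem_union_right _ hmem) (fun v hv => ?_) hS
      (disjoint_right.1 hSJ hmem)
    rcases mem_union.1 hv with hv | hv
    · exact (mem_range.1 hv).le.trans (hJ _ hmem)
    · exact J.le_max' v hv

/-- The motivic interior of the path, by the number of uncovered vertices. -/
theorem intervalInterior_eq_sum {m : ℕ} (hm : m ≠ 0) :
    intervalInterior m = ∑ k ∈ range m,
      PowerSeries.coeff (m + 1) (gapSeries ^ (k + 2)) * intervalClass (k + 1) := by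
  have hB := isBuildingSet_intervalsOf (nonempty_range_iff.2 hm)
  rw [← nestedInterior_intervalsOf (card_range m), nestedInterior_eq_sum hB, sum_powerset,
    card_range, sum_range_succ', powersetCard_zero, sum_singleton, nestedInteriorOver_empty hB,
    add_zero]
  refine sum_congr rfl fun k _ => ?_
  have := isGapFamily_intervalsOf.sum_nestedInteriorOver (k + 1) m ∅ subset_rfl (by simp)
    (by omega)
  simpa only [union_empty, card_empty, add_zero] using this

/-- The gap series is the compositional inverse of the series of the path classes. -/
theorem sum_coeff_gapSeries_pow {m : ℕ} (hm : m ≠ 0) :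
    ∑ k ∈ range (m + 1), PowerSeries.coeff (m + 1) (gapSeries ^ (k + 1)) * intervalClass k = 0 := by
  obtain ⟨m, rfl⟩ := Nat.exists_eq_succ_of_ne_zero hm
  -- The terms with k > 0 add up to the motivic interior of the path, and the term k = 0 is its
  -- negative.
  rw [sum_range_succ', ← intervalInterior_eq_sum m.succ_ne_zero, zero_add, pow_one,
    intervalClass_zero, mul_one]
  exact (congrArg _ (coeff_gapSeries m)).trans (add_neg_cancel _)

/-- The motivic interior of the poset of nested sets of a cycle, by the number of uncovered
vertices. -/
theorem nestedInterior_cycleGraph (m : ℕ) :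
    nestedInterior univ (graphBuilding (SimpleGraph.cycleGraph (m + 1))) =
      (m + 1 : ℚ) • ∑ k ∈ range (m + 1), (1 / (k + 1 : ℚ)) •
        (PowerSeries.coeff (m + 1) (gapSeries ^ (k + 1)) * arcClass (k + 1)) := by
  set B := graphBuilding (SimpleGraph.cycleGraph (m + 1)) with hBdef
  have hB : IsBuildingSet univ B := isBuildingSet_graphBuilding SimpleGraph.cycleGraph_connected
  -- Each nonempty `R` is distributed evenly over its elements `v`; by rotation all `v` give the
  -- same amount.
  let D : Fin (m + 1) → PosetAlgebra := fun v =>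
    ∑ R : Finset (Fin (m + 1)), if v ∈ R then (1 / (#R : ℚ)) • nestedInteriorOver univ B R else 0
  have hsum : nestedInterior univ B = ∑ v, D v := by
    rw [nestedInterior_eq_sum hB, sum_comm, powerset_univ]
    refine sum_congr rfl fun R _ => ?_
    rw [← sum_filter, filter_mem_eq_inter, univ_inter, sum_const]
    rcases R.eq_empty_or_nonempty with rfl | hR
    · rw [nestedInteriorOver_empty hB, smul_zero, smul_zero]
    · rw [← Nat.cast_smul_eq_nsmul ℚ, smul_smul, mul_one_div_cancel, one_smul]
      exact_mod_cast (card_pos.2 hR).ne'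
  have hrot : ∀ v, D v = D (Fin.last m) := by
    intro v
    refine Fintype.sum_equiv (Equiv.addRight (Fin.last m - v)).finsetCongr _ _ fun R => ?_
    rw [Equiv.finsetCongr_apply, card_map, nestedInteriorOver_relabel _ (map_univ_equiv _).symm
      (graphBuilding_cycleGraph_rotate m _)]
    refine if_congr ?_ rfl rfl
    rw [mem_map_equiv]
    simp
  have hlast : D (Fin.last m) = ∑ k ∈ range (m + 1), (1 / (k + 1 : ℚ)) •
      (PowerSeries.coeff (m + 1) (gapSeries ^ (k + 1)) * arcClass (k + 1)) := by
    -- With the last vertex uncovered, the cycle is the gap family of arcs with `J = {m}`: a further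
    -- k uncovered vertices leave k + 1 gaps.
    let f : Fin (m + 1) ↪o ℕ := Fin.valOrderEmb (m + 1)
    have hV : range (m + 1) = univ.map f.toEmbedding := by
      ext x
      simp only [mem_range, mem_map, mem_univ, true_and]
      exact ⟨fun h => ⟨⟨x, h⟩, rfl⟩, by rintro ⟨y, rfl⟩; exact y.2⟩
    have harcs : arcsOf (range (m + 1)) = Finset.map f.toEmbedding '' B := by
      rw [hBdef, graphBuilding_cycleGraph, ← arcsOf_map, hV]
    let F : Finset ℕ → PosetAlgebra := fun R => if m ∈ R then
      (1 / (#R : ℚ)) • nestedInteriorOver (range (m + 1)) (arcsOf (range (m + 1))) R else 0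
    have hDF : D (Fin.last m) = ∑ R ∈ (range (m + 1)).powerset, F R := by
      refine sum_bij' (fun R _ => R.map f.toEmbedding)
        (fun R _ => univ.filter fun v => f v ∈ R) (fun R _ => ?_) (fun R _ => mem_univ _)
        (fun R _ => ?_) (fun R hR => ?_) (fun R _ => ?_)
      · rw [hV, mem_powerset]
        exact map_subset_map.2 (subset_univ R)
      · ext v
        simp
      · ext x
        simp only [mem_map, mem_filter, mem_univ, true_and]
        constructor
        · rintro ⟨v, hv, rfl⟩
          exact hv
        · intro hx
          exact ⟨⟨x, mem_range.1 (mem_powerset.1 hR hx)⟩, hx, rfl⟩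
      · simp only [F]
        rw [card_map, nestedInteriorOver_relabel f.toEmbedding hV harcs]
        refine if_congr ?_ rfl rfl
        exact (mem_map' f.toEmbedding (a := Fin.last m)).symm
    rw [hDF, range_add_one, sum_powerset_insert (by simp), sum_eq_zero, zero_add, sum_powerset,
      card_range, ← range_add_one]
    · refine sum_congr rfl fun k _ => ?_
      have hgap := (isGapFamily_arcsOf m).sum_nestedInteriorOver k m {m} subset_rfl (by simp)
        (by simp)
      rw [card_singleton] at hgap
      rw [← hgap, smul_sum]
      refine sum_congr rfl fun R hR => ?_
      rw [mem_powersetCard] at hR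
      have hmR : m ∉ R := fun h => absurd (hR.1 h) (by simp)
      simp only [F]
      rw [if_pos (mem_insert_self m R), card_insert_of_notMem hmR, hR.2, range_add_one]
      congr 1
      · push_cast
        rfl
      · rw [insert_eq, union_comm, insert_eq, union_comm {m} R]
    · intro R hR
      refine if_neg fun h => ?_
      exact absurd (mem_powerset.1 hR h) (by simp)
  rw [hsum, sum_congr rfl fun v _ => hrot v, sum_const, card_univ, Fintype.card_fin, hlast,
    ← Nat.cast_smul_eq_nsmul ℚ]
  push_cast
  rfl

end GapSums

/-! ### Composition and inversion of power series -/

namespace PowerSeries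

section Composition

variable {K : Type*} [CommRing K]

theorem coeff_pow_eq_zero_of_lt {h : PowerSeries K} (hh : constantCoeff h = 0) {n k : ℕ}
    (hnk : n < k) : coeff n (h ^ k) = 0 := by
  obtain ⟨q, rfl⟩ := X_dvd_iff.2 hh
  rw [mul_pow, coeff_X_pow_mul', if_neg (by omega)]

theorem coeff_subst_eq_sum_range {h : PowerSeries K} (hh : constantCoeff h = 0)
    (f : PowerSeries K) (n : ℕ) :
    coeff n (f.subst h) = ∑ k ∈ Finset.range (n + 1), coeff k f * coeff n (h ^ k) := by
  rw [coeff_subst' (HasSubst.of_constantCoeff_zero' hh)]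
  refine finsum_eq_sum_of_support_subset _ fun k hk => ?_
  rw [Finset.coe_range, Set.mem_Iio]
  by_contra hlt
  exact hk (by simp [coeff_pow_eq_zero_of_lt hh (show n < k by omega)])

theorem coeff_mul_subst {h : PowerSeries K} (hh : constantCoeff h = 0)
    (q f : PowerSeries K) (n : ℕ) :
    coeff n (q * f.subst h) = ∑ k ∈ Finset.range (n + 1), coeff k f * coeff n (q * h ^ k) := by
  have hle : ∀ j ≤ n, coeff j (f.subst h) =
      ∑ k ∈ Finset.range (n + 1), coeff k f * coeff j (h ^ k) := by
    intro j hj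
    rw [coeff_subst_eq_sum_range hh]
    refine Finset.sum_subset (Finset.range_subset_range.2 (by omega)) fun k _ hk => ?_
    rw [coeff_pow_eq_zero_of_lt hh (by simpa using hk), mul_zero]
  simp only [coeff_mul, Finset.mul_sum]
  rw [Finset.sum_comm]
  refine Finset.sum_congr rfl fun p hp => ?_
  rw [hle p.2 (by have := Finset.HasAntidiagonal.mem_antidiagonal.1 hp; omega), Finset.mul_sum]
  exact Finset.sum_congr rfl fun k _ => by ring

/-- The multinomial theorem for the coefficients of powers of a power series. -/
theorem coeff_pow_eq_sum_weightVectors {h : PowerSeries K} (hh : constantCoeff h = 0) (n k : ℕ) :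
    coeff n (h ^ k) = ∑ κ ∈ (weightVectors n).filter fun κ => ∑ i, κ i = k,
      (Nat.multinomial Finset.univ κ : K) * ∏ i : Fin n, coeff ((i : ℕ) + 1) h ^ κ i := by
  classical
  -- Modulo `X ^ (n + 1)` the series is a polynomial with n terms, to which the multinomial theorem
  -- applies.
  set p : PowerSeries K := ∑ i : Fin n, C (coeff ((i : ℕ) + 1) h) * X ^ ((i : ℕ) + 1) with hp
  have hdvd : X ^ (n + 1) ∣ h - p := by
    rw [X_pow_dvd_iff]
    intro m hm
    rw [map_sub, sub_eq_zero, hp, map_sum]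
    simp only [coeff_C_mul, coeff_X_pow, mul_ite, mul_one, mul_zero]
    rcases m with _ | m
    · rw [coeff_zero_eq_constantCoeff_apply, hh]
      exact (Finset.sum_eq_zero fun i _ => if_neg (by omega)).symm
    · rw [Finset.sum_eq_single (⟨m, by omega⟩ : Fin n) (fun i _ hi => if_neg fun hm' => hi
        (Fin.ext (by simp at hm'; exact hm'.symm))) (by simp)]
      simp
  have hpow : coeff n (h ^ k) = coeff n (p ^ k) := by
    obtain ⟨q, hq⟩ := hdvd.trans (sub_dvd_pow_sub_pow h p k)
    rw [← sub_eq_zero, ← map_sub, hq, coeff_X_pow_mul', if_neg (by omega)]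
  rw [hpow, hp, Finset.sum_pow_eq_sum_piAntidiag, map_sum]
  have hterm : ∀ κ : Fin n → ℕ,
      coeff n ((Nat.multinomial Finset.univ κ : PowerSeries K) *
        ∏ i : Fin n, (C (coeff ((i : ℕ) + 1) h) * X ^ ((i : ℕ) + 1)) ^ κ i) =
      if ∑ i : Fin n, ((i : ℕ) + 1) * κ i = n then
        (Nat.multinomial Finset.univ κ : K) * ∏ i : Fin n, coeff ((i : ℕ) + 1) h ^ κ i else 0 := by
    intro κ
    have h1 : (Nat.multinomial Finset.univ κ : PowerSeries K) *
        ∏ i : Fin n, (C (coeff ((i : ℕ) + 1) h) * X ^ ((i : ℕ) + 1)) ^ κ i =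
        C ((Nat.multinomial Finset.univ κ : K) * ∏ i : Fin n, coeff ((i : ℕ) + 1) h ^ κ i) *
          X ^ (∑ i : Fin n, ((i : ℕ) + 1) * κ i) := by
      simp only [mul_pow, Finset.prod_mul_distrib, ← pow_mul, Finset.prod_pow_eq_pow_sum, map_mul,
        map_prod, map_pow, map_natCast, mul_assoc]
    rw [h1, coeff_C_mul, coeff_X_pow, mul_ite, mul_one, mul_zero]
    simp only [eq_comm]
  rw [Finset.sum_congr rfl fun κ _ => hterm κ, ← Finset.sum_filter]
  refine Finset.sum_congr ?_ fun _ _ => rfl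
  ext κ
  simp only [Finset.mem_filter, Finset.mem_piAntidiag, Finset.mem_univ, implies_true, and_true,
    mem_weightVectors]
  tauto

/-- Faà di Bruno's formula. -/
theorem coeff_subst_eq_sum_weightVectors {h : PowerSeries K} (hh : constantCoeff h = 0)
    (f : PowerSeries K) (n : ℕ) :
    coeff n (f.subst h) = ∑ κ ∈ weightVectors n, (Nat.multinomial Finset.univ κ : K) *
      (coeff (∑ i, κ i) f * ∏ i : Fin n, coeff ((i : ℕ) + 1) h ^ κ i) := by
  rw [coeff_subst_eq_sum_range hh, ← Finset.sum_fiberwise_of_maps_to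
    (t := Finset.range (n + 1)) (g := fun κ : Fin n → ℕ => ∑ i, κ i)]
  · refine Finset.sum_congr rfl fun k _ => ?_
    rw [coeff_pow_eq_sum_weightVectors hh, Finset.mul_sum]
    refine Finset.sum_congr rfl fun κ hκ => ?_
    rw [(Finset.mem_filter.1 hκ).2]
    ring
  · intro κ hκ
    rw [mem_weightVectors] at hκ
    refine Finset.mem_range.2 (Nat.lt_succ_of_le (le_trans ?_ hκ.le))
    exact Finset.sum_le_sum fun i _ => Nat.le_mul_of_pos_left _ (Nat.succ_pos _)

end Composition

section Inversion

variable {K : Type*} [CommRing K] [Algebra ℚ K]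

theorem natCast_mul_left_cancel {m : ℕ} (hm : m ≠ 0) {x y : K} (h : (m : K) * x = m * y) :
    x = y := by
  have hu : IsUnit (m : K) := by
    have : IsUnit (algebraMap ℚ K m) := (isUnit_iff_ne_zero.2 (Nat.cast_ne_zero.2 hm)).map _
    rwa [map_natCast] at this
  exact hu.mul_left_cancel h

/-- For g = Xψ this coefficient is the residue of g'/g^(j+1), which for j > 0 is the derivative of
-g^(-j)/j and so has residue zero. Multiplying by the exponent replaces Laurent series by an
identity of power series. -/
theorem coeff_pow_mul_derivative {θ ψ : PowerSeries K} (h1 : θ * ψ = 1)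
    (hψ : constantCoeff ψ = 1) (j : ℕ) :
    coeff j (θ ^ (j + 1) * derivative K (X * ψ)) = if j = 0 then 1 else 0 := by
  have hθ : constantCoeff θ = 1 := by
    have := congrArg constantCoeff h1
    rwa [map_mul, hψ, mul_one, map_one] at this
  rcases j with _ | j
  · rw [if_pos rfl, coeff_zero_eq_constantCoeff_apply, Derivation.leibniz]
    simp [hθ, hψ]
  · rw [if_neg j.succ_ne_zero]
    refine natCast_mul_left_cancel (m := j + 1) j.succ_ne_zero ?_
    have hd : derivative K θ = -(θ ^ 2 * derivative K ψ) := by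
      have := congrArg (derivative K) h1
      rw [Derivation.leibniz, Derivation.map_one_eq_zero, smul_eq_mul, smul_eq_mul] at this
      linear_combination θ * this - derivative K θ * h1
    have hd' : X * derivative K (θ ^ (j + 1)) =
        -(((j + 1 : ℕ) : PowerSeries K) * (X * (θ ^ (j + 2) * derivative K ψ))) := by
      rw [derivative_pow, hd]
      simp only [Nat.add_sub_cancel]
      ring
    have hc := congrArg (coeff (j + 1)) hd'
    rw [coeff_succ_X_mul, coeff_derivative, map_neg, ← nsmul_eq_mul, map_nsmul, nsmul_eq_mul] at hc
    have hs : θ ^ (j + 1 + 1) * derivative K (X * ψ) =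
        θ ^ (j + 1) + X * (θ ^ (j + 2) * derivative K ψ) := by
      rw [Derivation.leibniz, derivative_X, smul_eq_mul, smul_eq_mul]
      linear_combination θ ^ (j + 1) * h1
    rw [hs, map_add, mul_add, mul_zero]
    push_cast at hc ⊢
    linear_combination hc

/-- Lagrange inversion. -/
theorem coeff_eq_of_subst_eq_X {θ ψ h : PowerSeries K} (h1 : θ * ψ = 1)
    (hψ : constantCoeff ψ = 1) (hh : h.subst (X * ψ) = X) (m : ℕ) :
    ((m + 1 : ℕ) : K) * coeff (m + 1) h = coeff m (θ ^ (m + 1)) := by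
  have hg : constantCoeff (X * ψ) = 0 := by simp
  -- `(X * ψ) ^ k` cancels k factors `θ` and shifts the degree by k, which leaves the residue of
  -- index m - k.
  have hpow : ∀ k ≤ m, coeff m (θ ^ (m + 1) * derivative K (X * ψ) * (X * ψ) ^ k) =
      if m - k = 0 then 1 else 0 := by
    intro k hk
    obtain ⟨j, rfl⟩ := Nat.exists_eq_add_of_le hk
    have : θ ^ (k + j + 1) * derivative K (X * ψ) * (X * ψ) ^ k =
        X ^ k * (θ ^ (j + 1) * derivative K (X * ψ)) := by
      have h2 : θ ^ k * ψ ^ k = 1 := by rw [← mul_pow, h1, one_pow]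
      rw [mul_pow, add_assoc, pow_add]
      linear_combination θ ^ (j + 1) * derivative K (X * ψ) * X ^ k * h2
    rw [this, coeff_X_pow_mul', if_pos hk, Nat.add_sub_cancel_left, coeff_pow_mul_derivative h1 hψ]
  -- Differentiate h(g) = X and multiply by `θ ^ (m + 1)`; in the coefficient of `X ^ m` only the
  -- m-th term of h'(g) survives.
  have hd := congrArg (derivative K) hh
  rw [derivative_subst (HasSubst.of_constantCoeff_zero' hg), derivative_X] at hd
  have hc := congrArg (fun F => coeff m (θ ^ (m + 1) * F)) hd
  simp only [mul_one] at hc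
  rw [mul_comm (subst _ _), ← mul_assoc, coeff_mul_subst hg, Finset.sum_range_succ,
    Finset.sum_eq_zero, zero_add] at hc
  · rw [← hc, coeff_derivative, hpow m le_rfl, Nat.sub_self, if_pos rfl]
    push_cast
    ring
  · intro k hk
    rw [Finset.mem_range] at hk
    rw [hpow k hk.le, if_neg (by omega), mul_zero]

/-- The coefficients of the compositional inverse of `X * (1 + u)`. -/
theorem coeff_eq_inversionCoeff {u h : PowerSeries K} (hu : constantCoeff u = 0)
    (hh : h.subst (X * (1 + u)) = X) (m : ℕ) :
    coeff (m + 1) h = inversionCoeff m fun i => coeff i u := by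
  have hneg : constantCoeff (-u) = 0 := by rw [map_neg, hu, neg_zero]
  have hs := HasSubst.of_constantCoeff_zero' hneg
  -- Substituting -u into (1 - X)^(-d) gives (1 + u)^(-d), whose expansion has binomial
  -- coefficients.
  have hinv : ∀ d : ℕ, ((invOneSubPow K d).val.subst (-u)) * (1 + u) ^ d = 1 := by
    intro d
    have h1 := congrArg (fun F : PowerSeries K => F.subst (-u)) (invOneSubPow K d).val_inv
    simp only [invOneSubPow_inv_eq_one_sub_pow] at h1
    rw [subst_mul hs, subst_pow hs, subst_sub hs, subst_X hs, ← coe_substAlgHom hs, map_one,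
      sub_neg_eq_add] at h1
    rw [← coe_substAlgHom hs]
    exact h1
  have hpow : ((invOneSubPow K 1).val.subst (-u)) ^ (m + 1) =
      (invOneSubPow K (m + 1)).val.subst (-u) := by
    have e1 := hinv 1
    have e2 := hinv (m + 1)
    rw [pow_one] at e1
    have e3 : ((invOneSubPow K 1).val.subst (-u)) ^ (m + 1) * (1 + u) ^ (m + 1) = 1 := by
      rw [← mul_pow, e1, one_pow]
    linear_combination ((invOneSubPow K (m + 1)).val.subst (-u)) * e3 -
      ((invOneSubPow K 1).val.subst (-u)) ^ (m + 1) * e2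
  have hL := coeff_eq_of_subst_eq_X (θ := (invOneSubPow K 1).val.subst (-u)) (ψ := 1 + u)
    (by simpa using hinv 1) (by simp [hu]) hh m
  rw [hpow, coeff_subst_eq_sum_weightVectors hneg] at hL
  refine natCast_mul_left_cancel (m := m + 1) m.succ_ne_zero (hL.trans ?_)
  rw [inversionCoeff, ← nsmul_eq_mul, ← Nat.cast_smul_eq_nsmul ℚ, smul_smul, Finset.smul_sum]
  refine Finset.sum_congr rfl fun κ _ => ?_
  rw [invOneSubPow_val_succ_eq_mk_add_choose, coeff_mk, smul_smul]
  simp only [map_neg]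
  rw [Finset.prod_congr rfl fun i _ => neg_pow _ _, Finset.prod_mul_distrib,
    Finset.prod_pow_eq_pow_sum, Algebra.smul_def, ← mul_assoc, ← mul_assoc]
  congr 1
  -- The factor m + 1 from Lagrange inversion turns 1/(m+1)! into 1/m!, and (m+k)!/(m! ∏ kᵢ!) is the
  -- binomial coefficient times the multinomial one.
  have hq : ((m + 1 : ℕ) : ℚ) * (1 / ((m + 1)! : ℚ)) *
      ((-1) ^ (∑ i, κ i) * ((m + ∑ i, κ i)! : ℚ) / (∏ i, (κ i)! : ℕ)) =
      (Nat.multinomial Finset.univ κ : ℚ) * ((m + ∑ i, κ i).choose m : ℚ) * (-1) ^ (∑ i, κ i) := by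
    have h1 : ((∏ i, (κ i)! : ℕ) : ℚ) * (Nat.multinomial Finset.univ κ : ℚ) =
        ((∑ i, κ i)! : ℕ) := by
      exact_mod_cast Nat.multinomial_spec Finset.univ κ
    have h2 : ((m + ∑ i, κ i).choose m : ℚ) * (m ! : ℕ) * ((∑ i, κ i)! : ℕ) =
        ((m + ∑ i, κ i)! : ℕ) := by
      have := Nat.choose_mul_factorial_mul_factorial (Nat.le_add_right m (∑ i, κ i))
      rw [Nat.add_sub_cancel_left] at this
      exact_mod_cast this
    have h3 : ((∏ i, (κ i)! : ℕ) : ℚ) ≠ 0 :=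
      Nat.cast_ne_zero.2 (Finset.prod_ne_zero_iff.2 fun i _ => Nat.factorial_ne_zero _)
    have h4 : ((m ! : ℕ) : ℚ) ≠ 0 := Nat.cast_ne_zero.2 (Nat.factorial_ne_zero m)
    have h5 : ((m + 1 : ℕ) : ℚ) ≠ 0 := Nat.cast_ne_zero.2 m.succ_ne_zero
    rw [← h2, ← h1, Nat.factorial_succ, Nat.cast_mul]
    field_simp
  rw [hq]
  simp

end Inversion

end PowerSeries

/-! ### Compositional inverses and the polynomials `D_n` -/

section MainSeries

open PowerSeries

variable {K : Type*} [CommRing K]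

theorem constantCoeff_seriesOf (a : ℕ → K) : constantCoeff (seriesOf a) = 0 := by
  rw [← coeff_zero_eq_constantCoeff_apply, seriesOf, coeff_mk, if_pos rfl]

theorem coeff_seriesOf (a : ℕ → K) {n : ℕ} (hn : n ≠ 0) : coeff n (seriesOf a) = a n := by
  rw [seriesOf, coeff_mk, if_neg hn]

/-- A right inverse for composition agrees with the compositional inverse. -/
theorem IsCompInverse.eq_of_subst_eq {g h h' : PowerSeries K} (hgh : IsCompInverse g h)
    (h0 : constantCoeff h' = 0) (hX : g.subst h' = X) : h' = h := by
  obtain ⟨hg, -, -, hl⟩ := hgh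
  have h1 := subst_comp_subst_apply (HasSubst.of_constantCoeff_zero' hg)
    (HasSubst.of_constantCoeff_zero' h0) h
  rw [hl, hX, subst_X (HasSubst.of_constantCoeff_zero' h0), ← map_algebraMap_eq_subst_X] at h1
  rw [h1]
  simp

theorem exists_isCompInverse {g : PowerSeries K} (hg : constantCoeff g = 0)
    (h1 : coeff 1 g = 1) : ∃ h, IsCompInverse g h := by
  have hu : IsUnit (coeff 1 g) := by rw [h1]; exact isUnit_one
  exact ⟨g.substInvOfIsUnit hu, hg, constantCoeff_substInvOfIsUnit g hu,
    subst_substInvOfIsUnit_right g hg hu, subst_substInvOfIsUnit_left g hg hu⟩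

theorem existsUnique_isCompInverse {g : PowerSeries K} (hg : constantCoeff g = 0)
    (h1 : coeff 1 g = 1) : ∃! h, IsCompInverse g h := by
  obtain ⟨h, hh⟩ := exists_isCompInverse hg h1
  exact ⟨h, hh, fun h' hh' => hh.eq_of_subst_eq hh'.2.1 hh'.2.2.1⟩

variable [Algebra ℚ K]

theorem IsCompInverse.coeff_eq_inversionCoeff {b : ℕ → K} (hb : b 1 = 1) {h : PowerSeries K}
    (hh : IsCompInverse (seriesOf b) h) (m : ℕ) :
    coeff (m + 1) h = inversionCoeff m fun i => b (i + 1) := by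
  -- The constant term is set to 0, so that `b 1 = 1` is the leading 1 of `1 + u`.
  set u : PowerSeries K := PowerSeries.mk fun i => if i = 0 then 0 else b (i + 1) with hu
  have hu0 : constantCoeff u = 0 := by
    rw [← coeff_zero_eq_constantCoeff_apply, hu, coeff_mk, if_pos rfl]
  have hg : seriesOf b = X * (1 + u) := by
    ext n
    rcases n with _ | _ | n
    · simp [constantCoeff_seriesOf]
    · refine (coeff_seriesOf b one_ne_zero).trans ?_
      rw [coeff_succ_X_mul]
      simp [hu0, hb]
    · rw [coeff_seriesOf _ (Nat.succ_ne_zero _), coeff_succ_X_mul, map_add, coeff_one,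
        if_neg (Nat.succ_ne_zero _), hu, coeff_mk, if_neg (Nat.succ_ne_zero _), zero_add]
  rw [PowerSeries.coeff_eq_inversionCoeff hu0 (hg ▸ hh.2.2.2), inversionCoeff, inversionCoeff]
  simp only [hu, coeff_mk, Nat.succ_ne_zero, if_false]

/-- The polynomials `D_n(a, b)` are the coefficients of the composition with the compositional
inverse. -/
theorem IsCompInverse.subst_eq_seriesOf {a b : ℕ → K} (hb : b 1 = 1) {h : PowerSeries K}
    (hh : IsCompInverse (seriesOf b) h) :
    (seriesOf a).subst h = seriesOf fun n => compInvPoly n a b := by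
  ext n
  by_cases hn : n = 0
  · subst hn
    rw [coeff_subst_eq_sum_range hh.2.1]
    simp [constantCoeff_seriesOf]
  · rw [coeff_seriesOf _ hn, coeff_subst_eq_sum_weightVectors hh.2.1, compInvPoly, faaDiBruno]
    refine Finset.sum_congr rfl fun κ hκ => ?_
    rw [mem_weightVectors] at hκ
    -- `seriesOf` discards `a 0`; for n ≠ 0 no weight vector has total 0, so `D_n` does not involve
    -- it either.
    have hk : ∑ i, κ i ≠ 0 := fun h0 => by
      rw [Finset.sum_eq_zero_iff] at h0
      exact hn (hκ.symm.trans (Finset.sum_eq_zero fun i hi => by rw [h0 i hi, mul_zero]))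
    rw [coeff_seriesOf _ hk]
    simp only [hh.coeff_eq_inversionCoeff hb, Nat.add_sub_cancel]

/-- `D_n(a, b)` in terms of the powers of the compositional inverse. -/
theorem IsCompInverse.compInvPoly_eq_sum {a b : ℕ → K} (hb : b 1 = 1) {h : PowerSeries K}
    (hh : IsCompInverse (seriesOf b) h) (m : ℕ) :
    compInvPoly (m + 1) a b =
      ∑ k ∈ Finset.range (m + 1), a (k + 1) * coeff (m + 1) (h ^ (k + 1)) := by
  have h1 := congrArg (coeff (m + 1)) (hh.subst_eq_seriesOf (a := a) hb)
  rw [coeff_seriesOf _ m.succ_ne_zero, coeff_subst_eq_sum_range hh.2.1, Finset.sum_range_succ',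
    coeff_zero_eq_constantCoeff_apply, constantCoeff_seriesOf, zero_mul, add_zero] at h1
  rw [← h1]
  exact Finset.sum_congr rfl fun k _ => by rw [coeff_seriesOf _ k.succ_ne_zero]

end MainSeries

/-! ### The motivic interior of the cyclohedron -/

section Cyclohedra

open PowerSeries RatPolytopeAlgebra

/-- The generating series of the associahedra. -/
noncomputable def associahedronSeq (j : ℕ) : RatPolytopeAlgebra :=
  PolytopeRing.toRat (associahedronClass (j - 1))

theorem associahedronSeq_one : associahedronSeq 1 = 1 := map_one _

theorem toPosetAlgebra_associahedronSeq (j : ℕ) :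
    toPosetAlgebra (associahedronSeq (j + 1)) = intervalClass j := by
  rcases j with _ | j
  · rw [associahedronSeq_one, map_one, intervalClass_zero]
  · refine (ConvexPolytope.toPosetAlgebra_graphAssociahedron _).trans ?_
    rw [graphBuilding_pathGraph, intervalClass]

theorem toPosetAlgebra_cyclohedronClass (j : ℕ) :
    toPosetAlgebra (PolytopeRing.toRat (cyclohedronClass (j + 1))) = arcClass (j + 1) := by
  refine (ConvexPolytope.toPosetAlgebra_graphAssociahedron _).trans ?_
  rw [graphBuilding_cycleGraph, arcClass]

/-- The gap series is the image of the compositional inverse of the series of the associahedra. -/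
theorem map_eq_gapSeries {h : PowerSeries RatPolytopeAlgebra}
    (hh : IsCompInverse (seriesOf associahedronSeq) h) :
    PowerSeries.map toPosetAlgebra.toRingHom h = gapSeries := by
  set f : RatPolytopeAlgebra →+* PosetAlgebra := toPosetAlgebra.toRingHom with hf
  obtain ⟨h1, h2, h3, h4⟩ := hh
  have hmap : IsCompInverse (PowerSeries.map f (seriesOf associahedronSeq))
      (PowerSeries.map f h) := by
    refine ⟨?_, ?_, ?_, ?_⟩
    · rw [← coeff_zero_eq_constantCoeff_apply, coeff_map, coeff_zero_eq_constantCoeff_apply, h1,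
        map_zero]
    · rw [← coeff_zero_eq_constantCoeff_apply, coeff_map, coeff_zero_eq_constantCoeff_apply, h2,
        map_zero]
    · rw [← map_X f, ← h3]
      exact (map_subst (HasSubst.of_constantCoeff_zero' h2) _).symm
    · rw [← map_X f, ← h4]
      exact (map_subst (HasSubst.of_constantCoeff_zero' h1) _).symm
  have hgap : constantCoeff gapSeries = 0 := by
    rw [← coeff_zero_eq_constantCoeff_apply, coeff_gapSeries_zero]
  -- Both series are inverse to the series of associahedra, so it suffices that the gap series is a
  -- right inverse.
  refine (hmap.eq_of_subst_eq hgap ?_).symm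
  ext n
  rw [coeff_subst_eq_sum_range hgap, Finset.sum_range_succ', coeff_map,
    coeff_zero_eq_constantCoeff_apply, constantCoeff_seriesOf, map_zero, zero_mul, add_zero]
  have hterm : ∀ k, coeff (k + 1) (PowerSeries.map f (seriesOf associahedronSeq)) *
      coeff n (gapSeries ^ (k + 1)) = coeff n (gapSeries ^ (k + 1)) * intervalClass k := by
    intro k
    rw [coeff_map, coeff_seriesOf _ k.succ_ne_zero, mul_comm, hf]
    exact congrArg _ (toPosetAlgebra_associahedronSeq k)
  rw [Finset.sum_congr rfl fun k _ => hterm k]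
  rcases n with _ | _ | n
  · rw [Finset.range_zero, Finset.sum_empty, coeff_zero_X]
  · rw [zero_add, Finset.sum_range_one, zero_add, pow_one, coeff_gapSeries_one, one_mul,
      intervalClass_zero, coeff_one_X]
  · rw [sum_coeff_gapSeries_pow n.succ_ne_zero, coeff_X, if_neg (by omega)]

/-- The motivic interior of the cyclohedron. -/
theorem toRat_cyclohedronInterior (m : ℕ) :
    PolytopeRing.toRat (cyclohedronInterior (m + 1)) =
      ((m + 1 : ℕ) : RatPolytopeAlgebra) * compInvPoly (m + 1)
        (fun j => (1 / (j : ℚ)) • PolytopeRing.toRat (cyclohedronClass j)) associahedronSeq := by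
  obtain ⟨h, hh⟩ := exists_isCompInverse (constantCoeff_seriesOf associahedronSeq)
    ((coeff_seriesOf _ one_ne_zero).trans associahedronSeq_one)
  have hpow : ∀ k, toPosetAlgebra (coeff (m + 1) (h ^ (k + 1))) =
      coeff (m + 1) (gapSeries ^ (k + 1)) := fun k => by
    rw [← map_eq_gapSeries hh, ← map_pow, coeff_map]
    rfl
  apply toPosetAlgebra_injective
  refine (ConvexPolytope.toPosetAlgebra_motivicInterior _).trans ?_
  rw [nestedInterior_cycleGraph, hh.compInvPoly_eq_sum associahedronSeq_one, map_mul, map_natCast,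
    map_sum, ← nsmul_eq_mul, ← Nat.cast_smul_eq_nsmul ℚ, Nat.cast_succ]
  congr 1
  refine Finset.sum_congr rfl fun k _ => ?_
  rw [map_mul, hpow, map_smul, toPosetAlgebra_cyclohedronClass, Nat.cast_succ, smul_mul_assoc,
    mul_comm]

end Cyclohedra

theorem corollary6p2 :
    -- the polynomials `D_n(a, b)` are the coefficients of `f(g⁻¹(x))`
    (∀ (K : Type*) [CommRing K] [Algebra ℚ K] (a b : ℕ → K), b 1 = 1 →
      (∃! h : PowerSeries K, IsCompInverse (seriesOf b) h) ∧
      ∀ h : PowerSeries K, IsCompInverse (seriesOf b) h →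
        (seriesOf a).subst h = seriesOf fun n => compInvPoly n a b) ∧
    -- the cyclohedra
    (∀ n : ℕ, 1 ≤ n →
      PolytopeRing.toRat (cyclohedronInterior n) =
        (n : RatPolytopeAlgebra) *
          compInvPoly n
            (fun j => (1 / (j : ℚ)) • PolytopeRing.toRat (cyclohedronClass j))
            (fun j => PolytopeRing.toRat (associahedronClass (j - 1)))) := by
  refine ⟨fun K _ _ a b hb => ⟨existsUnique_isCompInverse (constantCoeff_seriesOf b)
      ((coeff_seriesOf b one_ne_zero).trans hb), fun h hh => hh.subst_eq_seriesOf hb⟩,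
    fun n hn => ?_⟩
  obtain ⟨m, rfl⟩ := Nat.exists_eq_add_of_le' hn
  exact toRat_cyclohedronInterior m
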